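/- For $\nu\ge 0$ let $J_\nu$ and $Y_\nu$ be the Bessel functions of order $\nu$ of the first and second kinds, and let $N_\nu=J_\nu^2+Y_\nu^2$. Fix $b>1$ and define $$U_\nu(\rho,t)=J_\nu(\rho t)Y_\nu(\rho b)-J_\nu(\rho b)Y_\nu(\rho t)\qquad(\rho>0,\ t>0).$$ For each $\nu\ge0$ the positive zeros of $\rho\mapsto U_\nu(\rho,1)$ form an infinite strictly increasing sequence $(\rho_{\nu,m})_{m\ge1}$, and the following hold. (i) If $\nu\ge\frac12$, then $\rho_{\nu,m}>\frac1b\left(\nu+\frac m4\right)$ for all $m\ge1$. Also, for any $\nu\ge0$, $\dfrac{\rho_{\nu,m}}{m}\to\dfrac{\pi}{b-1}$ as $m\to\infty$. (ii) If $\nu\ge0$, $m\ge1$ and $U_\nu(\rho_{\nu,m},a)=0$, where $0<a\le b$, then $$\left\{\frac{\partial U_\nu}{\partial t}(\rho_{\nu,m},a)\right\}^2=\frac{4}{\pi^2a^2}\,\frac{N_\nu(\rho_{\nu,m}b)}{N_\nu(\rho_{\nu,m}a)}\le\frac{4}{\pi^2a^2}.$$ (iii) If $\nu\ge0$, $m\ge1$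 and $U_\nu(\rho_{\nu,m},a)=0$, where $0<a<b$, then $$\rho_{\nu,m}^2\int_a^b\{U_\nu(\rho_{\nu,m},t)\}^2\,t\,dt=\frac{2}{\pi^2}\left(1-\frac{N_\nu(\rho_{\nu,m}b)}{N_\nu(\rho_{\nu,m}a)}\right)\le\frac{2}{\pi^2}.$$ (iv) If $\nu\ge\frac12$, then $$\rho_{\nu,m}^2\int_1^b\{U_\nu(\rho_{\nu,m},t)\}^2\,t\,dt\ge\frac{2}{\pi^2}\,\frac{b-1}{b}\qquad(m\ge1).$$ Also, $$\rho_{0,m}^2\int_1^b\{U_0(\rho_{0,m},t)\}^2\,t\,dt\ge\frac{2}{\pi^2}\left(1-\frac{N_0(\rho_{0,1}b)}{N_0(\rho_{0,1})}\right)\qquad(m\ge1).$$ (v) If $\nu>0$, $m\ge1$ and $a$ is the least positive zero of $U_\nu(\rho_{\nu,m},\cdot)$, then $$|U_\nu(\rho_{\nu,m},t)|\le\frac{t^{-\nu}}{\pi\nu}\qquad(0<t<a).$$ -/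

import Mathlib

open Filter Topology

/-- The Bessel function of the first kind `J_ν(x)` of real order `ν`, for `x > 0`, by its series
`∑ (-1)^k / (k! Γ(ν + k + 1)) (x / 2)^(ν + 2k)`.  At the poles of `Γ` the coefficient is `0`
(the value of the entire function `1 / Γ` there): `Real.Gamma` is `0` there and `0⁻¹ = 0`. -/
noncomputable def besselJ (ν x : ℝ) : ℝ :=
  (x / 2) ^ ν *
    ∑' k : ℕ, (-1 : ℝ) ^ k * ((k.factorial : ℝ) * Real.Gamma (ν + k + 1))⁻¹ * (x / 2) ^ (2 * k)

/-- The quotient `(J_ν(x) cos νπ - J_{-ν}(x)) / sin νπ`, meaningful for non-integer `ν`. -/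
noncomputable def besselYQuot (ν x : ℝ) : ℝ :=
  (besselJ ν x * Real.cos (ν * Real.pi) - besselJ (-ν) x) / Real.sin (ν * Real.pi)

open Classical in
/-- The Bessel function of the second kind `Y_ν(x)` of real order `ν`, for `x > 0`: the quotient
above for non-integer `ν`, and its limit in the order at integers. -/
noncomputable def besselY (ν x : ℝ) : ℝ :=
  if ∃ n : ℤ, (n : ℝ) = ν then limUnder (𝓝[≠] ν) (fun μ => besselYQuot μ x)
  else besselYQuot ν x

/-- `N_ν = J_ν² + Y_ν²`. -/
noncomputable def besselN (ν x : ℝ) : ℝ := besselJ ν x ^ 2 + besselY ν x ^ 2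

/-- The cross product `U_ν(ρ, t) = J_ν(ρt) Y_ν(ρb) - J_ν(ρb) Y_ν(ρt)`. -/
noncomputable def besselU (b ν ρ t : ℝ) : ℝ :=
  besselJ ν (ρ * t) * besselY ν (ρ * b) - besselJ ν (ρ * b) * besselY ν (ρ * t)

/-- For `m ≥ 1`, the `m`-th positive zero `ρ_{ν,m}` of `ρ ↦ U_ν(ρ, 1)`: each term is the least
zero beyond the previous one, starting from the dummy value `0` at index `0`. -/
noncomputable def besselRho (b ν : ℝ) : ℕ → ℝ
  | 0 => 0
  | m + 1 => sInf {ρ : ℝ | besselRho b ν m < ρ ∧ besselU b ν ρ 1 = 0}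

/-!
On the half-line the pairs `(J_ν, J_{ν+1})` and `(Y_ν, Y_{ν+1})` solve one first-order linear
system, and everything rests on Nicholson's formula
`N_ν(x) = (8 / π²) ∫_0^∞ K_0(2x sinh t) cosh (2νt) dt`. Integrals of this kind are the coefficients
of a quadratic form in `(A, B)` that is constant in `x` on every solution of the system. For
`-1 < ν < 0` its values on `J_ν` and `J_{-ν}` are read off as `x → 0`, and they determine `N_ν`;
the recurrence in the order then reaches all non-integer orders, and integer orders are limits.

The formula makes `N_ν` decreasing, `x N_ν(x)` decreasing to `2 / π` for `ν ≥ 1/2`, and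
`N_0(bx) / N_0(x)` monotone. As the Wronskian is `2 / (πx)`, one has
`J_ν + i Y_ν = √N_ν e^{iθ}` with `θ' = 2 / (π x N_ν)`, so that
`U_ν(ρ, t) = √(N_ν(ρt) N_ν(ρb)) sin (θ(ρb) - θ(ρt))`. The zeros `ρ_{ν,m}` are therefore the
solutions of `θ(ρb) - θ(ρ) = mπ`, and `θ' → 1` gives their asymptotics. For the lower bound, Sturm
comparison puts the point where `θ` has grown by `π` beyond `ν + 1`, and `θ' ≤ 1` does the rest.
At a zero of `U_ν(ρ, ·)` the Wronskian turns the derivative into a quotient of values of `N_ν`;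
Lommel's integral and the bound before the first zero are both expressed by such derivatives.
-/

section

open Real Set MeasureTheory

/-! ### The reciprocal Gamma function -/

lemma inv_Gamma_eq_self_mul_inv_Gamma_add_one (s : ℝ) : (Gamma s)⁻¹ = s * (Gamma (s + 1))⁻¹ := by
  have h := Complex.one_div_Gamma_eq_self_mul_one_div_Gamma_add_one (s : ℂ)
  rw [← Complex.ofReal_one, ← Complex.ofReal_add, Complex.Gamma_ofReal, Complex.Gamma_ofReal] at h
  exact_mod_cast h

lemma inv_Gamma_mul_inv_Gamma_one_sub (s : ℝ) :
    (Gamma s)⁻¹ * (Gamma (1 - s))⁻¹ = sin (s * π) / π := by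
  rw [← mul_inv, Gamma_mul_Gamma_one_sub, inv_div, mul_comm s]

lemma norm_inv_Gamma_add_one_le {s : ℂ} (hs : 1 ≤ ‖s‖) :
    ‖(Complex.Gamma (s + 1))⁻¹‖ ≤ ‖(Complex.Gamma s)⁻¹‖ := by
  rw [Complex.one_div_Gamma_eq_self_mul_one_div_Gamma_add_one s, norm_mul]
  exact le_mul_of_one_le_left (norm_nonneg _) hs

lemma exists_forall_norm_inv_Gamma_add_le (R : ℝ) :
    ∃ M, ∀ ν : ℂ, ‖ν‖ ≤ R → ∀ k : ℕ, ‖(Complex.Gamma (ν + k + 1))⁻¹‖ ≤ M := by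
  obtain ⟨n, hn⟩ := exists_nat_ge R
  obtain ⟨M, hM⟩ := (isCompact_closedBall (0 : ℂ) (R + n + 1)).exists_bound_of_continuousOn
    Complex.differentiable_one_div_Gamma.continuous.continuousOn
  have norm_natCast_add_one (k : ℕ) : ‖(k : ℂ) + 1‖ = k + 1 := by
    exact_mod_cast Complex.norm_natCast (k + 1)
  refine ⟨M, fun ν hν k => ?_⟩
  induction k with
  | zero =>
    refine hM _ (mem_closedBall_zero_iff.2 ((norm_add_le _ _).trans ?_))
    simp only [Nat.cast_zero, add_zero, norm_one]
    linarith [(Nat.cast_nonneg n : (0 : ℝ) ≤ n)]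
  | succ k ih =>
    rcases le_or_gt (k + 1) n with hk | hk
    · refine hM _ (mem_closedBall_zero_iff.2 ?_)
      rw [add_assoc]
      have hkn : ((k + 1 : ℕ) : ℝ) ≤ n := by exact_mod_cast hk
      linarith [norm_add_le ν (((k + 1 : ℕ) : ℂ) + 1), norm_natCast_add_one (k + 1)]
    · have hnk : (n : ℝ) ≤ k := by exact_mod_cast Nat.lt_succ_iff.1 hk
      have one_le_norm : 1 ≤ ‖ν + k + 1‖ := by
        have h := norm_sub_le (ν + k + 1) ν
        rw [add_assoc, add_sub_cancel_left, norm_natCast_add_one, ← add_assoc] at h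
        linarith
      rw [Nat.cast_add_one, ← add_assoc]
      exact (norm_inv_Gamma_add_one_le one_le_norm).trans ih

/-! ### The entire function behind `J_ν` -/

lemma hasDerivAt_tsum_mul_pow {𝕜 : Type*} [RCLike 𝕜] {c : ℕ → 𝕜} {M : ℝ}
    (hc : ∀ k, ‖c k‖ ≤ M / k.factorial) (w : 𝕜) :
    HasDerivAt (fun w => ∑' k, c k * w ^ k) (∑' k : ℕ, (k + 1) * c (k + 1) * w ^ k) w := by
  set R : ℝ := ‖w‖ + 1
  have hw : w ∈ Metric.ball (0 : 𝕜) R := by simp [R]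
  have hu : Summable fun k : ℕ => M * (R ^ (k - 1) / (k - 1).factorial) := by
    refine (summable_nat_add_iff 1).1 ?_
    simpa using (summable_pow_div_factorial R).mul_left M
  have hbound (k : ℕ) (y : 𝕜) (hy : y ∈ Metric.ball (0 : 𝕜) R) :
      ‖c k * (k * y ^ (k - 1))‖ ≤ M * (R ^ (k - 1) / (k - 1).factorial) := by
    have hyR : ‖y‖ ≤ R := (mem_ball_zero_iff.1 hy).le
    have hM : 0 ≤ M := by simpa using (norm_nonneg _).trans (hc 0)
    rcases k with _ | k
    · simpa using hM
    · simp only [norm_mul, norm_pow, RCLike.norm_natCast, Nat.add_sub_cancel]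
      calc ‖c (k + 1)‖ * ((k + 1 : ℕ) * ‖y‖ ^ k)
          ≤ M / (k + 1).factorial * ((k + 1 : ℕ) * R ^ k) := by gcongr; exact hc _
        _ = M * (R ^ k / k.factorial) := by
          rw [Nat.factorial_succ]; push_cast; field_simp
  have hsum : Summable fun k => c k * w ^ k := by
    refine .of_norm_bounded ((summable_pow_div_factorial ‖w‖).mul_left M) fun k => ?_
    rw [norm_mul, norm_pow, mul_div_left_comm, mul_comm]
    gcongr
    exact hc k
  refine (hasDerivAt_tsum_of_isPreconnected hu Metric.isOpen_ball
    (convex_ball (0 : 𝕜) R).isPreconnected (g := fun k y => c k * y ^ k)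
    (fun k y _ => (hasDerivAt_pow k y).const_mul (c k)) hbound hw hsum hw).congr_deriv ?_
  rw [(Summable.of_norm_bounded hu fun k => hbound k w hw).tsum_eq_zero_add]
  simp only [Nat.cast_zero, zero_mul, mul_zero, zero_add, Nat.add_sub_cancel]
  exact tsum_congr fun k => by push_cast; ring

/-- The coefficient `(-1)^k / (k! Γ(ν + k + 1))` of `w ^ k` in the Bessel–Clifford function. -/
noncomputable def besselCoeff (ν : ℝ) (k : ℕ) : ℝ :=
  (-1) ^ k * (k.factorial * Gamma (ν + k + 1))⁻¹

/-- The Bessel–Clifford function of order `ν` at `-w`: an entire function of `w`, also for negative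
`ν`, with `J_ν(x) = (x / 2)^ν * besselClifford ν (x² / 4)`. -/
noncomputable def besselClifford (ν w : ℝ) : ℝ :=
  ∑' k : ℕ, besselCoeff ν k * w ^ k

lemma besselJ_eq_rpow_mul_besselClifford (ν x : ℝ) :
    besselJ ν x = (x / 2) ^ ν * besselClifford ν ((x / 2) ^ 2) := by
  simp only [besselJ, besselClifford, besselCoeff, pow_mul]

lemma exists_abs_besselCoeff_le (ν : ℝ) : ∃ M, ∀ k, |besselCoeff ν k| ≤ M / k.factorial := by
  obtain ⟨M, hM⟩ := exists_forall_norm_inv_Gamma_add_le |ν|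
  refine ⟨M, fun k => ?_⟩
  have h := hM ν (Complex.norm_real ν).le k
  rw [show (ν : ℂ) + k + 1 = ((ν + k + 1 : ℝ) : ℂ) by push_cast; rfl, Complex.Gamma_ofReal,
    ← Complex.ofReal_inv, Complex.norm_real, norm_eq_abs] at h
  rw [besselCoeff, abs_mul, abs_neg_one_pow, one_mul, mul_inv, abs_mul, abs_inv, Nat.abs_cast,
    inv_mul_eq_div]
  gcongr

lemma succ_mul_besselCoeff_succ (ν : ℝ) (k : ℕ) :
    (k + 1) * besselCoeff ν (k + 1) = -besselCoeff (ν + 1) k := by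
  rw [besselCoeff, besselCoeff, Nat.factorial_succ, pow_succ, Nat.cast_add_one, Nat.cast_mul,
    show ν + (k + 1) + 1 = ν + 1 + k + 1 by ring]
  field_simp
  push_cast
  ring

lemma besselCoeff_eq_mul_besselCoeff_add_one (ν : ℝ) (k : ℕ) :
    besselCoeff ν k = (ν + k + 1) * besselCoeff (ν + 1) k := by
  rw [besselCoeff, besselCoeff, mul_inv, inv_Gamma_eq_self_mul_inv_Gamma_add_one,
    show ν + 1 + k + 1 = ν + k + 1 + 1 by ring]
  ring

lemma summable_besselCoeff_mul_pow (ν w : ℝ) : Summable fun k => besselCoeff ν k * w ^ k := by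
  obtain ⟨M, hM⟩ := exists_abs_besselCoeff_le ν
  refine .of_norm_bounded ((summable_pow_div_factorial |w|).mul_left M) fun k => ?_
  rw [norm_mul, norm_pow, norm_eq_abs, norm_eq_abs, mul_div_left_comm, mul_comm]
  gcongr
  exact hM k

lemma hasDerivAt_besselClifford (ν w : ℝ) :
    HasDerivAt (besselClifford ν) (-besselClifford (ν + 1) w) w := by
  obtain ⟨M, hM⟩ := exists_abs_besselCoeff_le ν
  refine (hasDerivAt_tsum_mul_pow hM w).congr_deriv ?_
  simp only [succ_mul_besselCoeff_succ, neg_mul, tsum_neg, besselClifford]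

@[fun_prop]
lemma continuous_besselClifford (ν : ℝ) : Continuous (besselClifford ν) :=
  continuous_iff_continuousAt.2 fun w => (hasDerivAt_besselClifford ν w).continuousAt

lemma besselClifford_zero_right (ν : ℝ) : besselClifford ν 0 = (Gamma (ν + 1))⁻¹ := by
  rw [besselClifford, tsum_eq_single 0 fun k hk => by simp only [zero_pow hk, mul_zero]]
  simp [besselCoeff]

lemma besselClifford_eq_sub (ν w : ℝ) :
    besselClifford ν w = (ν + 1) * besselClifford (ν + 1) w - w * besselClifford (ν + 2) w := by
  have hs := summable_besselCoeff_mul_pow ν w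
  have hs1 := (summable_besselCoeff_mul_pow (ν + 1) w).mul_left (ν + 1)
  have hterm (k : ℕ) : besselCoeff ν k * w ^ k - (ν + 1) * (besselCoeff (ν + 1) k * w ^ k) =
      k * besselCoeff (ν + 1) k * w ^ k := by
    rw [besselCoeff_eq_mul_besselCoeff_add_one ν]; ring
  suffices besselClifford ν w - (ν + 1) * besselClifford (ν + 1) w =
      -(w * besselClifford (ν + 2) w) by linarith
  rw [besselClifford, besselClifford, ← tsum_mul_left, ← hs.tsum_sub hs1,
    (hs.sub hs1).tsum_eq_zero_add]
  simp only [hterm, Nat.cast_zero, zero_mul, zero_add, Nat.cast_add_one, succ_mul_besselCoeff_succ]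
  rw [besselClifford, ← tsum_mul_left, ← tsum_neg, show ν + 1 + 1 = ν + 2 by ring]
  exact tsum_congr fun k => by ring

lemma differentiable_besselClifford_order (w : ℝ) : Differentiable ℝ (besselClifford · w) := by
  intro ν
  let F : ℕ → ℂ → ℂ := fun k z =>
    (-1 : ℂ) ^ k * (k.factorial : ℂ)⁻¹ * (Complex.Gamma (z + k + 1))⁻¹ * (w : ℂ) ^ k
  obtain ⟨M, hM⟩ := exists_forall_norm_inv_Gamma_add_le (|ν| + 1)
  have hF (k : ℕ) : Differentiable ℂ (F k) :=
    ((Complex.differentiable_one_div_Gamma.comp (by fun_prop : Differentiable ℂ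
      fun z : ℂ => z + k + 1)).const_mul _).mul_const _
  have hF_le (k : ℕ) (z : ℂ) (hz : z ∈ Metric.ball (0 : ℂ) (|ν| + 1)) :
      ‖F k z‖ ≤ M * (|w| ^ k / k.factorial) := by
    have h := hM z (mem_ball_zero_iff.1 hz).le k
    simp only [F, norm_mul, norm_pow, norm_neg, norm_one, one_pow, one_mul, norm_inv,
      Complex.norm_real, norm_eq_abs, Complex.norm_natCast] at h ⊢
    calc _ = ‖Complex.Gamma (z + k + 1)‖⁻¹ * (|w| ^ k / k.factorial) := by ring
      _ ≤ _ := by gcongr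
  have hsum : DifferentiableAt ℂ (fun z => ∑' k, F k z) ν :=
    (Complex.differentiableOn_tsum_of_summable_norm ((summable_pow_div_factorial |w|).mul_left M)
      (fun k => (hF k).differentiableOn) Metric.isOpen_ball hF_le).differentiableAt
      (Metric.isOpen_ball.mem_nhds (by simp))
  have hF_ofReal (k : ℕ) (μ : ℝ) : F k μ = ((besselCoeff μ k * w ^ k : ℝ) : ℂ) := by
    simp only [F, besselCoeff, show (μ : ℂ) + k + 1 = ((μ + k + 1 : ℝ) : ℂ) by push_cast; rfl,
      Complex.Gamma_ofReal]
    push_cast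
    rw [mul_inv]; ring
  refine hsum.hasDerivAt.real_of_complex.differentiableAt.congr_of_eventuallyEq (.of_forall ?_)
  intro μ
  simp only [hF_ofReal, ← Complex.ofReal_tsum, Complex.ofReal_re, besselClifford]

lemma differentiable_besselJ_order {x : ℝ} (hx : 0 < x) : Differentiable ℝ (besselJ · x) := by
  simp only [besselJ_eq_rpow_mul_besselClifford]
  exact fun ν => ((hasDerivAt_id ν).const_rpow (half_pos hx)).differentiableAt.mul
    (differentiable_besselClifford_order _ ν)

/-! ### The first order system satisfied by pairs of contiguous Bessel functions -/

/-- `(A, B)` solves on `(0, ∞)` the first order system satisfied by `(J_ν, J_{ν+1})`, which is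
equivalent to Bessel's equation of order `ν` for `A`. -/
def IsBesselPair (ν : ℝ) (A B : ℝ → ℝ) : Prop :=
  ∀ x, 0 < x → HasDerivAt A (ν / x * A x - B x) x ∧ HasDerivAt B (A x - (ν + 1) / x * B x) x

lemma hasDerivAt_besselJ (ν : ℝ) {x : ℝ} (hx : 0 < x) :
    HasDerivAt (besselJ ν) (ν / x * besselJ ν x - besselJ (ν + 1) x) x := by
  have hx2 : 0 < x / 2 := half_pos hx
  have hpow : HasDerivAt (fun x : ℝ => (x / 2) ^ ν) (ν / x * (x / 2) ^ ν) x := by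
    refine (((hasDerivAt_id x).div_const 2).rpow_const (p := ν) (.inl hx2.ne')).congr_deriv ?_
    rw [id, rpow_sub_one hx2.ne']
    field_simp
  have hsq : HasDerivAt (fun x : ℝ => (x / 2) ^ 2) (x / 2) x := by
    refine (((hasDerivAt_id x).div_const 2).pow 2).congr_deriv ?_
    simp only [id, Nat.cast_ofNat]
    ring
  rw [funext (besselJ_eq_rpow_mul_besselClifford ν)]
  refine (hpow.mul ((hasDerivAt_besselClifford ν _).comp x hsq)).congr_deriv ?_
  rw [Function.comp_apply, besselJ_eq_rpow_mul_besselClifford, rpow_add_one hx2.ne']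
  ring

lemma besselJ_add_besselJ_add_two (ν : ℝ) {x : ℝ} (hx : 0 < x) :
    besselJ ν x + besselJ (ν + 2) x = 2 * (ν + 1) / x * besselJ (ν + 1) x := by
  have hx2 : x / 2 ≠ 0 := (half_pos hx).ne'
  simp only [besselJ_eq_rpow_mul_besselClifford]
  rw [besselClifford_eq_sub ν, show ν + 2 = ν + 1 + 1 by ring, rpow_add_one hx2, rpow_add_one hx2]
  field_simp
  ring

lemma isBesselPair_besselJ (ν : ℝ) : IsBesselPair ν (besselJ ν) (besselJ (ν + 1)) := by
  intro x hx
  refine ⟨hasDerivAt_besselJ ν hx, (hasDerivAt_besselJ (ν + 1) hx).congr_deriv ?_⟩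
  rw [show ν + 1 + 1 = ν + 2 by ring, eq_sub_of_add_eq (besselJ_add_besselJ_add_two ν hx)]
  ring

lemma isBesselPair_besselJ_neg (ν : ℝ) :
    IsBesselPair ν (besselJ (-ν)) (fun x => -besselJ (-ν - 1) x) := by
  intro x hx
  have h := besselJ_add_besselJ_add_two (-ν - 1) hx
  rw [show -ν - 1 + 2 = -ν + 1 by ring, sub_add_cancel] at h
  refine ⟨(hasDerivAt_besselJ (-ν) hx).congr_deriv ?_,
    (hasDerivAt_besselJ (-ν - 1) hx).neg.congr_deriv ?_⟩
  · rw [eq_sub_of_add_eq' h]; ring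
  · rw [sub_add_cancel]; ring

lemma IsBesselPair.linear_combination {ν : ℝ} {A B A' B' : ℝ → ℝ} (h : IsBesselPair ν A B)
    (h' : IsBesselPair ν A' B') (p q : ℝ) :
    IsBesselPair ν (fun x => p * A x + q * A' x) (fun x => p * B x + q * B' x) := by
  intro x hx
  refine ⟨(((h x hx).1.const_mul p).add ((h' x hx).1.const_mul q)).congr_deriv ?_,
    (((h x hx).2.const_mul p).add ((h' x hx).2.const_mul q)).congr_deriv ?_⟩ <;> ring

lemma eq_of_tendsto_of_hasDerivAt_zero {f : ℝ → ℝ} {c : ℝ} {l : Filter ℝ} [l.NeBot]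
    (hl : ∀ᶠ x in l, 0 < x) (hf : ∀ x, 0 < x → HasDerivAt f 0 x) (hc : Tendsto f l (𝓝 c)) {x : ℝ}
    (hx : 0 < x) : f x = c := by
  refine tendsto_nhds_unique (tendsto_const_nhds.congr' ?_) hc
  filter_upwards [hl] with y hy
  exact isOpen_Ioi.is_const_of_deriv_eq_zero isPreconnected_Ioi
    (fun z hz => (hf z hz).differentiableAt.differentiableWithinAt) (fun z hz => (hf z hz).deriv)
    hx hy

lemma IsBesselPair.hasDerivAt_wronskian {ν : ℝ} {A B A' B' : ℝ → ℝ} (h : IsBesselPair ν A B)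
    (h' : IsBesselPair ν A' B') {x : ℝ} (hx : 0 < x) :
    HasDerivAt (fun x => x * (A x * B' x - B x * A' x)) 0 x := by
  obtain ⟨hA, hB⟩ := h x hx
  obtain ⟨hA', hB'⟩ := h' x hx
  refine ((hasDerivAt_id x).mul ((hA.mul hB').sub (hB.mul hA'))).congr_deriv ?_
  simp only [id, Pi.sub_apply, Pi.mul_apply]
  field_simp
  ring

lemma wronskian_besselJ_besselJ_neg (ν : ℝ) {x : ℝ} (hx : 0 < x) :
    x * (besselJ ν x * -besselJ (-ν - 1) x - besselJ (ν + 1) x * besselJ (-ν) x) =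
      2 * sin (ν * π) / π := by
  refine eq_of_tendsto_of_hasDerivAt_zero (l := 𝓝[>] 0) self_mem_nhdsWithin
    (fun x hx => (isBesselPair_besselJ ν).hasDerivAt_wronskian (isBesselPair_besselJ_neg ν) hx)
    ?_ hx
  let W : ℝ → ℝ := fun x =>
    -2 * (besselClifford ν ((x / 2) ^ 2) * besselClifford (-ν - 1) ((x / 2) ^ 2)) -
      x ^ 2 / 2 * (besselClifford (ν + 1) ((x / 2) ^ 2) * besselClifford (-ν) ((x / 2) ^ 2))
  have hW : Continuous W := by fun_prop
  have hW_zero : W 0 = 2 * sin (ν * π) / π := by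
    have h := inv_Gamma_mul_inv_Gamma_one_sub (ν + 1)
    rw [add_mul, one_mul, sin_add_pi, show 1 - (ν + 1) = -ν by ring] at h
    norm_num [W, besselClifford_zero_right]
    rw [← mul_inv, mul_inv, h]
    ring
  refine ((hW_zero ▸ hW.tendsto 0).mono_left nhdsWithin_le_nhds).congr' ?_
  filter_upwards [self_mem_nhdsWithin] with x (hx : 0 < x)
  have hx2 : 0 < x / 2 := half_pos hx
  simp only [W, besselJ_eq_rpow_mul_besselClifford]
  rw [rpow_sub_one hx2.ne', rpow_add_one hx2.ne', rpow_neg hx2.le]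
  have := (rpow_pos_of_pos hx2 ν).ne'
  field_simp

/-! ### `Y_ν` of non-integer order -/

section

variable {ν : ℝ} (hν : ν ∉ range ((↑) : ℤ → ℝ))

include hν

lemma besselY_of_notMem_range_intCast (x : ℝ) :
    besselY ν x = (besselJ ν x * cos (ν * π) - besselJ (-ν) x) / sin (ν * π) := by
  rw [besselY, besselYQuot]
  exact if_neg hν

lemma besselY_add_one_of_notMem_range_intCast (x : ℝ) :
    besselY (ν + 1) x = (besselJ (ν + 1) x * cos (ν * π) + besselJ (-ν - 1) x) / sin (ν * π) := by
  have hν' : ν + 1 ∉ range ((↑) : ℤ → ℝ) := by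
    rintro ⟨n, hn⟩
    exact hν ⟨n - 1, by rw [Int.cast_sub, hn, Int.cast_one, add_sub_cancel_right]⟩
  rw [besselY_of_notMem_range_intCast hν', add_mul, one_mul, sin_add_pi,
    cos_add_pi, show -(ν + 1) = -ν - 1 by ring, div_neg, ← neg_div]
  ring

lemma isBesselPair_besselY_of_notMem_range_intCast :
    IsBesselPair ν (besselY ν) (besselY (ν + 1)) := by
  convert (isBesselPair_besselJ ν).linear_combination (isBesselPair_besselJ_neg ν)
    (cos (ν * π) / sin (ν * π)) (-1 / sin (ν * π)) using 1
  · ext x; rw [besselY_of_notMem_range_intCast hν]; ring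
  · ext x; rw [besselY_add_one_of_notMem_range_intCast hν]; ring

lemma sin_mul_pi_ne_zero : sin (ν * π) ≠ 0 := by
  intro h
  obtain ⟨n, hn⟩ := sin_eq_zero_iff.1 h
  exact hν ⟨n, mul_right_cancel₀ pi_ne_zero hn⟩

lemma wronskian_besselJ_besselY_of_notMem_range_intCast {x : ℝ} (hx : 0 < x) :
    x * (besselJ (ν + 1) x * besselY ν x - besselJ ν x * besselY (ν + 1) x) = 2 / π := by
  have hs := sin_mul_pi_ne_zero hν
  have h := wronskian_besselJ_besselJ_neg ν hx
  rw [besselY_of_notMem_range_intCast hν, besselY_add_one_of_notMem_range_intCast hν]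
  have := pi_ne_zero
  field_simp at h ⊢
  linarith

end

/-! ### The Macdonald functions `K_0` and `K_1` -/

/-- The integrals `∫_0^∞ cosh^n t exp(-z cosh t) dt`, which for `n = 0` and `n = 1` are the
Macdonald functions `K_0` and `K_1`. -/
noncomputable def coshMoment (n : ℕ) (z : ℝ) : ℝ :=
  ∫ t in Ioi 0, cosh t ^ n * exp (-z * cosh t)

local notation "K₀" => coshMoment 0
local notation "K₁" => coshMoment 1

lemma exp_neg_le_rpow_div {a s : ℝ} (ha : 0 < a) (hs : 0 < s) : exp (-s) ≤ (s / a) ^ (-a) := by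
  rw [rpow_neg (by positivity), exp_neg]
  refine inv_anti₀ (by positivity) ?_
  calc (s / a) ^ a ≤ exp (s / a) ^ a := by
        gcongr
        linarith [add_one_le_exp (s / a)]
    _ = exp s := by rw [← exp_mul, div_mul_cancel₀ s ha.ne']

lemma integrableOn_cosh_rpow_neg {b : ℝ} (hb : 0 < b) :
    IntegrableOn (fun t => cosh t ^ (-b)) (Ioi 0) := by
  refine ((exp_neg_integrableOn_Ioi 0 hb).const_mul (2 ^ b)).mono'
    (continuous_cosh.rpow_const fun t => .inl (cosh_pos t).ne').aestronglyMeasurable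
    (.of_forall fun t => ?_)
  have exp_div_two_le_cosh : exp t / 2 ≤ cosh t := by
    rw [cosh_eq]
    linarith [exp_pos (-t)]
  rw [norm_of_nonneg (rpow_nonneg (cosh_pos t).le _)]
  calc cosh t ^ (-b) ≤ (exp t / 2) ^ (-b) :=
        rpow_le_rpow_of_nonpos (by positivity) exp_div_two_le_cosh (neg_nonpos.2 hb.le)
    _ = 2 ^ b * exp (-b * t) := by
      rw [div_rpow (exp_pos t).le zero_le_two, rpow_neg zero_le_two, div_inv_eq_mul, ← exp_mul,
        mul_comm, mul_comm t]

lemma cosh_pow_mul_exp_le (n : ℕ) {b z : ℝ} (hb : 0 < b) (hz : 0 < z) (t : ℝ) :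
    cosh t ^ n * exp (-z * cosh t) ≤
      (z / (2 * (n + b))) ^ (-(n + b)) * exp (-(z / 2)) * cosh t ^ (-b) := by
  have hc := cosh_pos t
  calc cosh t ^ n * exp (-z * cosh t)
      = cosh t ^ n * (exp (-(z / 2 * cosh t)) * exp (-(z / 2 * cosh t))) := by
        rw [← exp_add]; ring_nf
    _ ≤ cosh t ^ n * ((z / 2 * cosh t / (n + b)) ^ (-(n + b)) * exp (-(z / 2))) := by
        gcongr
        · exact exp_neg_le_rpow_div (by positivity) (by positivity)
        · exact le_mul_of_one_le_right (by positivity) (one_le_cosh t)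
    _ = _ := by
        rw [show z / 2 * cosh t / (n + b) = z / (2 * (n + b)) * cosh t by field_simp,
          mul_rpow (by positivity) hc.le, neg_add (n : ℝ) b, rpow_add hc, rpow_neg hc.le n,
          rpow_natCast]
        field_simp

lemma integrableOn_cosh_pow_mul_exp (n : ℕ) {z : ℝ} (hz : 0 < z) :
    IntegrableOn (fun t => cosh t ^ n * exp (-z * cosh t)) (Ioi 0) := by
  refine .mono' ((integrableOn_cosh_rpow_neg one_pos).const_mul _) (by fun_prop)
    (.of_forall fun t => (norm_of_nonneg ?_).trans_le (cosh_pow_mul_exp_le n one_pos hz t))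
  have := cosh_pos t
  positivity

lemma exists_coshMoment_le (n : ℕ) {b : ℝ} (hb : 0 < b) :
    ∃ C, 0 ≤ C ∧ ∀ z, 0 < z → coshMoment n z ≤ C * (z ^ (-(n + b)) * exp (-(z / 2))) := by
  have : 0 ≤ ∫ t in Ioi 0, cosh t ^ (-b) :=
    setIntegral_nonneg measurableSet_Ioi fun t _ => rpow_nonneg (cosh_pos t).le _
  refine ⟨(2 * (n + b)) ^ (n + b) * ∫ t in Ioi 0, cosh t ^ (-b), by positivity, fun z hz => ?_⟩
  calc coshMoment n z
      ≤ ∫ t in Ioi 0, (z / (2 * (n + b))) ^ (-(n + b)) * exp (-(z / 2)) * cosh t ^ (-b) :=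
        integral_mono (integrableOn_cosh_pow_mul_exp n hz)
          ((integrableOn_cosh_rpow_neg hb).const_mul _) (cosh_pow_mul_exp_le n hb hz)
    _ = _ := by
        rw [integral_const_mul, div_rpow hz.le (by positivity),
          rpow_neg (show 0 ≤ 2 * (n + b) by positivity), div_inv_eq_mul]
        ring

lemma coshMoment_pos (n : ℕ) {z : ℝ} (hz : 0 < z) : 0 < coshMoment n z := by
  have integrand_pos (t : ℝ) : 0 < cosh t ^ n * exp (-z * cosh t) :=
    mul_pos (pow_pos (cosh_pos t) n) (exp_pos _)
  refine (setIntegral_pos_iff_support_of_nonneg_ae (.of_forall fun t => (integrand_pos t).le)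
    (integrableOn_cosh_pow_mul_exp n hz)).2 ?_
  rw [Function.support_eq_univ fun t => (integrand_pos t).ne']
  simp

lemma coshMoment_le_coshMoment_succ (n : ℕ) {z : ℝ} (hz : 0 < z) :
    coshMoment n z ≤ coshMoment (n + 1) z :=
  integral_mono (integrableOn_cosh_pow_mul_exp n hz) (integrableOn_cosh_pow_mul_exp (n + 1) hz)
    fun t => mul_le_mul_of_nonneg_right (pow_le_pow_right₀ (one_le_cosh t) n.le_succ) (exp_pos _).le

lemma hasDerivAt_coshMoment (n : ℕ) {z : ℝ} (hz : 0 < z) :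
    HasDerivAt (coshMoment n) (-coshMoment (n + 1) z) z := by
  have h := (hasDerivAt_integral_of_dominated_loc_of_deriv_le
    (μ := volume.restrict (Ioi 0)) (s := Ioi (z / 2)) (x₀ := z)
    (F := fun z t => cosh t ^ n * exp (-z * cosh t))
    (F' := fun z t => -(cosh t ^ (n + 1) * exp (-z * cosh t)))
    (bound := fun t => cosh t ^ (n + 1) * exp (-(z / 2) * cosh t))
    (Ioi_mem_nhds (half_lt_self hz))
    (.of_forall fun z => by fun_prop) (integrableOn_cosh_pow_mul_exp n hz)
    (by fun_prop) (.of_forall fun t y hy => ?_)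
    (integrableOn_cosh_pow_mul_exp (n + 1) (half_pos hz))
    (.of_forall fun t y _ => ?_)).2
  · rwa [integral_neg] at h
  · have := cosh_pos t
    rw [norm_neg, norm_of_nonneg (by positivity)]
    gcongr
    exact (mem_Ioi.1 hy).le
  · refine ((((hasDerivAt_id y).neg.mul_const (cosh t)).exp).const_mul _).congr_deriv ?_
    simp only [Pi.neg_apply, id]
    ring

lemma continuousOn_coshMoment (n : ℕ) : ContinuousOn (coshMoment n) (Ioi 0) :=
  fun _ hz => (hasDerivAt_coshMoment n hz).continuousAt.continuousWithinAt

lemma strictAntiOn_coshMoment (n : ℕ) : StrictAntiOn (coshMoment n) (Ioi 0) := by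
  refine strictAntiOn_of_deriv_neg (convex_Ioi 0) (continuousOn_coshMoment n) fun z hz => ?_
  rw [interior_Ioi] at hz
  rw [(hasDerivAt_coshMoment n hz).deriv]
  exact neg_neg_of_pos (coshMoment_pos (n + 1) hz)

lemma tendsto_sinh_mul_exp_neg_mul_cosh {z : ℝ} (hz : 0 < z) :
    Tendsto (fun t => sinh t * exp (-z * cosh t)) atTop (𝓝 0) := by
  have tendsto_cosh : Tendsto cosh atTop atTop :=
    tendsto_atTop_mono (fun t => (sinh_lt_cosh t).le) sinhOrderIso.tendsto_atTop
  have h : Tendsto (fun t => cosh t * exp (-z * cosh t)) atTop (𝓝 0) := by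
    simpa [Function.comp_def] using
      (tendsto_rpow_mul_exp_neg_mul_atTop_nhds_zero 1 z hz).comp tendsto_cosh
  refine squeeze_zero' ?_ (.of_forall fun t => ?_) h
  · filter_upwards [eventually_ge_atTop 0] with t ht
    exact mul_nonneg (sinh_nonneg_iff.2 ht) (exp_pos _).le
  · exact mul_le_mul_of_nonneg_right (sinh_lt_cosh t).le (exp_pos _).le

lemma coshMoment_two {z : ℝ} (hz : 0 < z) : coshMoment 2 z = K₀ z + K₁ z / z := by
  have hint (n : ℕ) := integrableOn_cosh_pow_mul_exp n hz
  have hint_sub : IntegrableOn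
      (fun t => cosh t ^ 2 * exp (-z * cosh t) - cosh t ^ 0 * exp (-z * cosh t)) (Ioi 0) :=
    (hint 2).sub (hint 0)
  have hderiv (t : ℝ) : HasDerivAt (fun t => sinh t * exp (-z * cosh t))
      (cosh t ^ 1 * exp (-z * cosh t) -
        z * (cosh t ^ 2 * exp (-z * cosh t) - cosh t ^ 0 * exp (-z * cosh t))) t := by
    refine ((hasDerivAt_sinh t).mul ((hasDerivAt_cosh t).const_mul (-z)).exp).congr_deriv ?_
    linear_combination z * exp (-z * cosh t) * cosh_sq t
  have by_parts := integral_Ioi_of_hasDerivAt_of_tendsto' (a := 0) (fun t _ => hderiv t)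
    ((hint 1).sub (hint_sub.const_mul z)) (tendsto_sinh_mul_exp_neg_mul_cosh hz)
  rw [integral_sub (hint 1) (hint_sub.const_mul z), integral_const_mul,
    integral_sub (hint 2) (hint 0), sinh_zero, zero_mul, sub_zero] at by_parts
  change K₁ z - z * (coshMoment 2 z - K₀ z) = 0 at by_parts
  field_simp
  linarith

/-! ### The Mellin transform of `K_0` -/

lemma integral_rpow_mul_one_sub_rpow {u v : ℝ} (hu : 0 < u) (hv : 0 < v) :
    ∫ x in Ioo 0 1, x ^ (u - 1) * (1 - x) ^ (v - 1) = Gamma u * Gamma v / Gamma (u + v) := by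
  have h : Complex.betaIntegral u v =
      ((∫ x in Ioo 0 1, x ^ (u - 1) * (1 - x) ^ (v - 1) : ℝ) : ℂ) := by
    rw [Complex.betaIntegral, intervalIntegral.integral_of_le zero_le_one,
      integral_Ioc_eq_integral_Ioo, ← integral_complex_ofReal]
    refine setIntegral_congr_fun measurableSet_Ioo fun x hx => ?_
    push_cast [Complex.ofReal_cpow hx.1.le, Complex.ofReal_cpow (sub_nonneg.2 hx.2.le)]
    rfl
  have h' := ProbabilityTheory.beta_eq_betaIntegralReal u v hu hv
  rwa [h, Complex.ofReal_re, ProbabilityTheory.beta, eq_comm] at h'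

lemma sigmoid_mul_one_sub_sigmoid (t : ℝ) :
    sigmoid t * (1 - sigmoid t) = (2 * cosh (t / 2)) ^ (-2 : ℝ) := by
  have sigmoid_eq (s : ℝ) : sigmoid s = exp (s / 2) / (2 * cosh (s / 2)) := by
    rw [sigmoid_def, cosh_eq, mul_div_cancel₀ _ two_ne_zero]
    refine inv_eq_of_mul_eq_one_left ?_
    field_simp
    rw [mul_add, ← exp_add]
    ring_nf
  have := cosh_pos (t / 2)
  rw [← sigmoid_neg, sigmoid_eq, sigmoid_eq, neg_div, cosh_neg, rpow_neg (by positivity), rpow_two,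
    div_mul_div_comm, ← exp_add, add_neg_cancel, exp_zero, ← sq, one_div]

lemma integral_cosh_rpow_neg {s : ℝ} (hs : 0 < s) :
    ∫ t in Ioi 0, cosh t ^ (-(2 * s)) =
      2 ^ (2 * s - 2) * (Gamma s ^ 2 / Gamma (2 * s)) := by
  have integrand_eq (t : ℝ) : |sigmoid t * (1 - sigmoid t)| •
      (sigmoid t ^ (s - 1) * (1 - sigmoid t) ^ (s - 1)) =
        2 ^ (-(2 * s)) * cosh (2⁻¹ * |t|) ^ (-(2 * s)) := by
    have h0 := sigmoid_pos t
    have h1 : 0 < 1 - sigmoid t := sub_pos.2 (sigmoid_lt_one t)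
    have := cosh_pos (t / 2)
    rw [abs_of_pos (mul_pos h0 h1), ← mul_rpow h0.le h1.le, smul_eq_mul,
      ← rpow_one_add' (mul_pos h0 h1).le (by simpa using hs.ne'), sigmoid_mul_one_sub_sigmoid,
      ← rpow_mul (by positivity), mul_rpow zero_le_two this.le, add_sub_cancel, neg_mul,
      ← cosh_abs (t / 2), abs_div, abs_two, div_eq_inv_mul]
  have substitution := integral_image_eq_integral_abs_deriv_smul MeasurableSet.univ
    (fun t _ => (hasDerivAt_sigmoid t).hasDerivWithinAt) sigmoid_injective.injOn
    (fun x : ℝ => x ^ (s - 1) * (1 - x) ^ (s - 1))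
  rw [image_univ, range_sigmoid, integral_rpow_mul_one_sub_rpow hs hs, ← sq, ← two_mul]
    at substitution
  simp only [integrand_eq, setIntegral_univ] at substitution
  rw [integral_comp_abs (f := fun t => 2 ^ (-(2 * s)) * cosh (2⁻¹ * t) ^ (-(2 * s))),
    integral_const_mul, integral_comp_mul_left_Ioi (fun t => cosh t ^ (-(2 * s))) 0
      (by norm_num : (0 : ℝ) < 2⁻¹), mul_zero, smul_eq_mul, inv_inv] at substitution
  rw [substitution, rpow_sub (by norm_num), rpow_neg (by norm_num)]
  field_simp
  norm_num
  ring

lemma integral_rpow_mul_exp_neg_mul_cosh {a : ℝ} (ha : 0 < a) (t : ℝ) :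
    ∫ z in Ioi 0, z ^ (a - 1) * exp (-z * cosh t) = Gamma a * cosh t ^ (-a) := by
  rw [rpow_neg (cosh_pos t).le, ← inv_rpow (cosh_pos t).le, mul_comm (Gamma a), ← one_div,
    ← integral_rpow_mul_exp_neg_mul_Ioi ha (cosh_pos t)]
  simp only [neg_mul, mul_comm (cosh t)]

lemma integrable_rpow_mul_exp_neg_mul_cosh {a : ℝ} (ha : 0 < a) :
    Integrable (Function.uncurry fun z t => z ^ (a - 1) * exp (-z * cosh t))
      ((volume.restrict (Ioi 0)).prod (volume.restrict (Ioi 0))) := by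
  have hmeas : AEStronglyMeasurable
      (Function.uncurry fun z t => z ^ (a - 1) * exp (-z * cosh t))
      ((volume.restrict (Ioi 0)).prod (volume.restrict (Ioi 0))) := by
    rw [Measure.prod_restrict]
    refine ContinuousOn.aestronglyMeasurable ?_ (measurableSet_Ioi.prod measurableSet_Ioi)
    exact (continuousOn_fst.rpow_const fun p hp => .inl (ne_of_gt hp.1)).mul (by fun_prop)
  refine (integrable_prod_iff' hmeas).2 ⟨.of_forall fun t => ?_, ?_⟩
  · refine .of_integral_ne_zero ?_
    simp only [Function.uncurry, integral_rpow_mul_exp_neg_mul_cosh ha]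
    have := cosh_pos t
    have := Gamma_pos_of_pos ha
    positivity
  · refine ((integrableOn_cosh_rpow_neg ha).const_mul (Gamma a)).congr (.of_forall fun t => ?_)
    simp only [Function.uncurry, ← integral_rpow_mul_exp_neg_mul_cosh ha t]
    refine setIntegral_congr_fun measurableSet_Ioi fun z (hz : 0 < z) => ?_
    exact (norm_of_nonneg (by positivity)).symm

lemma integral_rpow_mul_coshMoment_zero {s : ℝ} (hs : 0 < s) :
    ∫ z in Ioi 0, z ^ (2 * s - 1) * K₀ z = 2 ^ (2 * s - 2) * Gamma s ^ 2 := by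
  have hs2 : 0 < 2 * s := by positivity
  have := Gamma_pos_of_pos hs2
  calc _ = ∫ z in Ioi 0, ∫ t in Ioi 0, z ^ (2 * s - 1) * exp (-z * cosh t) := by
        simp only [coshMoment, pow_zero, one_mul, integral_const_mul]
    _ = ∫ t in Ioi 0, Gamma (2 * s) * cosh t ^ (-(2 * s)) := by
        rw [integral_integral_swap (integrable_rpow_mul_exp_neg_mul_cosh hs2)]
        simp only [integral_rpow_mul_exp_neg_mul_cosh hs2]
    _ = _ := by
        rw [integral_const_mul, integral_cosh_rpow_neg hs]
        field_simp

/-! ### Integrals against functions of moderate growth -/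

/-- `p` is continuous on `(0, ∞)`, is `O(y ^ n)` at `0` and grows at most polynomially at `∞`: the
class of functions whose product with `coshMoment n` is integrable. -/
def HasModerateGrowth (n : ℕ) (p : ℝ → ℝ) : Prop :=
  ContinuousOn p (Ioi 0) ∧ ∃ C, ∃ N : ℕ, ∀ y, 0 < y → |p y| ≤ C * (y ^ n * (1 + y) ^ N)

namespace HasModerateGrowth

variable {n : ℕ} {p q : ℝ → ℝ}

lemma of_abs_le (hq : HasModerateGrowth n q) (hp : ContinuousOn p (Ioi 0))
    (h : ∀ y, 0 < y → |p y| ≤ |q y|) : HasModerateGrowth n p := by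
  obtain ⟨-, C, N, hC⟩ := hq
  exact ⟨hp, C, N, fun y hy => (h y hy).trans (hC y hy)⟩

lemma mul {m : ℕ} (hp : HasModerateGrowth m p) (hq : HasModerateGrowth n q) :
    HasModerateGrowth (m + n) fun y => p y * q y := by
  obtain ⟨hpc, C, M, hC⟩ := hp
  obtain ⟨hqc, D, N, hD⟩ := hq
  refine ⟨hpc.mul hqc, C * D, M + N, fun y hy => ?_⟩
  calc |p y * q y| = |p y| * |q y| := abs_mul _ _
    _ ≤ C * (y ^ m * (1 + y) ^ M) * (D * (y ^ n * (1 + y) ^ N)) :=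
      mul_le_mul (hC y hy) (hD y hy) (abs_nonneg _) ((abs_nonneg _).trans (hC y hy))
    _ = C * D * (y ^ (m + n) * (1 + y) ^ (M + N)) := by ring

protected lemma abs (hp : HasModerateGrowth n p) : HasModerateGrowth n fun y => |p y| :=
  hp.of_abs_le hp.1.abs fun y _ => (abs_abs (p y)).le

lemma of_succ (hp : HasModerateGrowth (n + 1) p) : HasModerateGrowth n p := by
  obtain ⟨hpc, C, N, hC⟩ := hp
  refine ⟨hpc, |C|, N + 1, fun y hy => (hC y hy).trans ?_⟩
  calc C * (y ^ (n + 1) * (1 + y) ^ N) = C * (y ^ n * (y * (1 + y) ^ N)) := by ring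
    _ ≤ |C| * (y ^ n * ((1 + y) * (1 + y) ^ N)) := by
      gcongr
      · exact le_abs_self C
      · linarith
    _ = |C| * (y ^ n * (1 + y) ^ (N + 1)) := by ring

protected lemma pow (n : ℕ) : HasModerateGrowth n fun y => y ^ n :=
  ⟨by fun_prop, 1, 0, fun y hy => by rw [abs_of_pos (by positivity)]; simp⟩

protected lemma id : HasModerateGrowth 1 fun y => y := by
  simpa using HasModerateGrowth.pow 1

protected lemma const (c : ℝ) : HasModerateGrowth 0 fun _ => c :=
  ⟨continuousOn_const, |c|, 0, by simp⟩

lemma one_add_rpow (a : ℝ) : HasModerateGrowth 0 fun y => (1 + y) ^ a := by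
  have hpos {y : ℝ} (hy : 0 < y) : 0 < 1 + y := by positivity
  refine ⟨ContinuousOn.rpow_const (by fun_prop) fun y hy => .inl (hpos hy).ne', 1, ⌈a⌉₊,
    fun y hy => ?_⟩
  rw [abs_of_pos (rpow_pos_of_pos (hpos hy) a), one_mul, pow_zero, one_mul, ← rpow_natCast]
  exact rpow_le_rpow_of_exponent_le (by linarith) (Nat.le_ceil a)

end HasModerateGrowth

/-- The transform `x ↦ ∫ coshMoment n (2xy) p(y) dy` over `(0, ∞)`. -/
noncomputable def coshTransform (n : ℕ) (p : ℝ → ℝ) (x : ℝ) : ℝ :=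
  ∫ y in Ioi (0 : ℝ), coshMoment n (2 * x * y) * p y

section

variable {n : ℕ} {p : ℝ → ℝ} {x : ℝ}

lemma one_add_pow_mul_exp_neg_le {a : ℝ} (N : ℕ) (ha : 0 < a) :
    ∃ C, ∀ y, 0 < y → (1 + y) ^ N * exp (-(a * y)) ≤ C := by
  refine ⟨N.factorial / a ^ N * exp a, fun y hy => ?_⟩
  have hpow : (a * (1 + y)) ^ N / N.factorial ≤ exp (a * (1 + y)) :=
    pow_div_factorial_le_exp _ (by positivity) N
  rw [exp_neg, ← div_eq_mul_inv, div_le_iff₀ (exp_pos _), mul_assoc, ← exp_add]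
  rw [div_le_iff₀ (by positivity), mul_pow] at hpow
  rw [div_mul_eq_mul_div, le_div_iff₀ (by positivity), show a + a * y = a * (1 + y) by ring]
  linarith

lemma HasModerateGrowth.exists_abs_coshMoment_mul_le (hp : HasModerateGrowth n p) (hx : 0 < x) :
    ∃ C, ∀ y, 0 < y → |coshMoment n (2 * x * y) * p y| ≤
      C * (y ^ (-(1 / 2) : ℝ) * exp (-(x / 2) * y)) := by
  obtain ⟨-, C, N, hC⟩ := hp
  obtain ⟨D, hD0, hD⟩ := exists_coshMoment_le n (b := 1 / 2) (by norm_num)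
  obtain ⟨E, hE⟩ := one_add_pow_mul_exp_neg_le N (half_pos hx)
  have hC0 : 0 ≤ C :=
    nonneg_of_mul_nonneg_left ((abs_nonneg _).trans (hC 1 one_pos)) (by positivity)
  set c := (2 * x) ^ (-(n + 1 / 2 : ℝ))
  refine ⟨D * c * C * E, fun y hy => ?_⟩
  have hpow : (2 * x * y) ^ (-(n + 1 / 2 : ℝ)) * y ^ n = c * y ^ (-(1 / 2) : ℝ) := by
    rw [mul_rpow (by positivity) hy.le, mul_assoc, ← rpow_add_natCast hy.ne']
    congr 2
    ring
  have hexp : exp (-(2 * x * y / 2)) = exp (-(x / 2 * y)) * exp (-(x / 2) * y) := by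
    rw [← exp_add]; congr 1; ring
  rw [abs_mul, abs_of_pos (coshMoment_pos n (by positivity))]
  calc coshMoment n (2 * x * y) * |p y|
      ≤ D * ((2 * x * y) ^ (-(n + 1 / 2 : ℝ)) * exp (-(2 * x * y / 2))) *
          (C * (y ^ n * (1 + y) ^ N)) :=
        mul_le_mul (hD _ (by positivity)) (hC y hy) (abs_nonneg _) (by positivity)
    _ = D * C * ((2 * x * y) ^ (-(n + 1 / 2 : ℝ)) * y ^ n) *
          ((1 + y) ^ N * exp (-(x / 2 * y))) * exp (-(x / 2) * y) := by rw [hexp]; ring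
    _ ≤ D * C * (c * y ^ (-(1 / 2) : ℝ)) * E * exp (-(x / 2) * y) := by
      rw [hpow]
      gcongr
      exact hE y hy
    _ = D * c * C * E * (y ^ (-(1 / 2) : ℝ) * exp (-(x / 2) * y)) := by ring

lemma continuousOn_coshMoment_two_mul_mul (n : ℕ) (hx : 0 < x) :
    ContinuousOn (fun y => coshMoment n (2 * x * y)) (Ioi 0) :=
  (continuousOn_coshMoment n).comp (by fun_prop) fun _ hy => mul_pos (mul_pos two_pos hx) hy

lemma integrableOn_rpow_mul_exp_neg_mul (hx : 0 < x) {s : ℝ} (hs : -1 < s) :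
    IntegrableOn (fun y => y ^ s * exp (-x * y)) (Ioi 0) := by
  simpa using integrableOn_rpow_mul_exp_neg_mul_rpow hs one_pos hx

lemma HasModerateGrowth.integrableOn (hp : HasModerateGrowth n p) (hx : 0 < x) :
    IntegrableOn (fun y => coshMoment n (2 * x * y) * p y) (Ioi 0) := by
  obtain ⟨C, hC⟩ := hp.exists_abs_coshMoment_mul_le hx
  refine ((integrableOn_rpow_mul_exp_neg_mul (half_pos hx) (by norm_num)).const_mul C).mono'
    (((continuousOn_coshMoment_two_mul_mul n hx).mul hp.1).aestronglyMeasurable measurableSet_Ioi)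
    ((ae_restrict_iff' measurableSet_Ioi).2 (.of_forall hC))

lemma HasModerateGrowth.integrableOn_one (hp : HasModerateGrowth n p) :
    IntegrableOn (fun y => coshMoment n (2 * y) * p y) (Ioi 0) := by
  simpa using hp.integrableOn one_pos

lemma HasModerateGrowth.coshTransform_pos (hp : HasModerateGrowth n p)
    (hpos : ∀ y, 0 < y → 0 < p y) (hx : 0 < x) : 0 < coshTransform n p x := by
  have hmul (y : ℝ) (hy : y ∈ Ioi 0) : 0 < coshMoment n (2 * x * y) * p y :=
    mul_pos (coshMoment_pos n (mul_pos (mul_pos two_pos hx) hy)) (hpos y hy)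
  refine (setIntegral_pos_iff_support_of_nonneg_ae ((ae_restrict_iff' measurableSet_Ioi).2
    (.of_forall fun y hy => (hmul y hy).le)) (hp.integrableOn hx)).2 ?_
  refine lt_of_lt_of_le (b := volume (Ioi (0 : ℝ))) (by simp) (measure_mono ?_)
  exact fun y hy => ⟨(hmul y hy).ne', hy⟩

lemma HasModerateGrowth.hasDerivAt_coshTransform (hp : HasModerateGrowth n p) (hx : 0 < x) :
    HasDerivAt (coshTransform n p) (-(2 * coshTransform (n + 1) (fun y => y * p y) x)) x := by
  have hq : HasModerateGrowth (n + 1) fun y => y * p y := by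
    simpa only [add_comm] using HasModerateGrowth.id.mul hp
  have hx2 : 0 < x / 2 := half_pos hx
  have h := (hasDerivAt_integral_of_dominated_loc_of_deriv_le
    (μ := volume.restrict (Ioi (0 : ℝ))) (s := Ioi (x / 2)) (x₀ := x)
    (F := fun x y => coshMoment n (2 * x * y) * p y)
    (F' := fun x y => -2 * (coshMoment (n + 1) (2 * x * y) * (y * p y)))
    (bound := fun y => 2 * (coshMoment (n + 1) (2 * (x / 2) * y) * |y * p y|))
    (Ioi_mem_nhds (by linarith))
    ((eventually_gt_nhds hx).mono fun z hz => (hp.integrableOn hz).1) (hp.integrableOn hx)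
    ((hq.integrableOn hx).const_mul (-2)).1
    ((ae_restrict_iff' measurableSet_Ioi).2
      (.of_forall fun y (hy : 0 < y) z (hz : x / 2 < z) => ?_))
    ((hq.abs.integrableOn hx2).const_mul 2)
    ((ae_restrict_iff' measurableSet_Ioi).2
      (.of_forall fun y (hy : 0 < y) z (hz : x / 2 < z) => ?_))).2
  · exact h.congr_deriv (by rw [integral_const_mul, coshTransform]; ring)
  · have hz0 : 0 < z := hx2.trans hz
    rw [norm_mul, norm_mul, norm_neg, Real.norm_two, norm_eq_abs (y * p y),
      Real.norm_of_nonneg (coshMoment_pos _ (by positivity)).le]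
    gcongr
    exact (strictAntiOn_coshMoment _).antitoneOn (mem_Ioi.2 (by positivity))
      (mem_Ioi.2 (by positivity)) (by gcongr)
  · have hz0 : 0 < z := hx2.trans hz
    have hlin : HasDerivAt (fun x : ℝ => 2 * x * y) (2 * y) z :=
      (((hasDerivAt_id z).const_mul 2).mul_const y).congr_deriv (by ring)
    exact (((hasDerivAt_coshMoment n (by positivity)).comp z hlin).mul_const (p y)).congr_deriv
      (by ring)

lemma HasModerateGrowth.hasDerivAt_coshTransform_one (hp : HasModerateGrowth 1 p) (hx : 0 < x) :
    HasDerivAt (coshTransform 1 p)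
      (-(2 * coshTransform 0 (fun y => y * p y) x) - coshTransform 1 p x / x) x := by
  have hq : HasModerateGrowth 0 fun y => y * p y := (HasModerateGrowth.id.mul hp).of_succ.of_succ
  refine (hp.hasDerivAt_coshTransform hx).congr_deriv ?_
  have hsplit : coshTransform 2 (fun y => y * p y) x =
      coshTransform 0 (fun y => y * p y) x + 1 / (2 * x) * coshTransform 1 p x := by
    simp only [coshTransform]
    rw [← integral_const_mul, ← integral_add (hq.integrableOn hx)
      ((hp.integrableOn hx).const_mul _)]
    refine setIntegral_congr_fun measurableSet_Ioi fun y (hy : 0 < y) => ?_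
    have := hy.ne'
    simp only [coshMoment_two (mul_pos (mul_pos two_pos hx) hy)]
    field_simp
  rw [hsplit]
  field_simp
  ring

lemma mul_coshTransform (n : ℕ) (p : ℝ → ℝ) (hx : 0 < x) :
    x * coshTransform n p x = ∫ y in Ioi (0 : ℝ), coshMoment n (2 * y) * p (y / x) := by
  have h := integral_comp_mul_left_Ioi' (fun y => coshMoment n (2 * y) * p (y / x)) 0 hx
  simp only [mul_zero, mul_div_cancel_left₀ _ hx.ne', ← mul_assoc, smul_eq_mul] at h
  exact h

lemma HasModerateGrowth.aestronglyMeasurable_comp_div (hp : HasModerateGrowth n p) (hx : 0 < x) :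
    AEStronglyMeasurable (fun y => coshMoment n (2 * y) * p (y / x)) (volume.restrict (Ioi 0)) := by
  have hK := continuousOn_coshMoment_two_mul_mul n one_pos
  simp only [mul_one] at hK
  exact (hK.mul (hp.1.comp (by fun_prop) fun _ hy => div_pos hy hx)).aestronglyMeasurable
    measurableSet_Ioi

lemma HasModerateGrowth.tendsto_mul_coshTransform_atTop (hp : HasModerateGrowth n p) {c : ℝ}
    (hc : Tendsto p (𝓝[>] 0) (𝓝 c)) :
    Tendsto (fun x => x * coshTransform n p x) atTop
      (𝓝 ((∫ y in Ioi (0 : ℝ), coshMoment n (2 * y)) * c)) := by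
  obtain ⟨-, C, N, hC⟩ := id hp
  have hC0 : 0 ≤ C :=
    nonneg_of_mul_nonneg_left ((abs_nonneg _).trans (hC 1 one_pos)) (by positivity)
  have hbound : HasModerateGrowth n fun y => C * (y ^ n * (1 + y) ^ N) :=
    ⟨by fun_prop, C, N, fun y hy => (abs_of_nonneg (by positivity)).le⟩
  rw [← integral_mul_const]
  refine (tendsto_integral_filter_of_dominated_convergence _
    ((eventually_gt_atTop 0).mono fun x hx => hp.aestronglyMeasurable_comp_div hx)
    ?_ hbound.integrableOn_one ?_).congr'
    ((eventually_gt_atTop 0).mono fun x hx => (mul_coshTransform n p hx).symm)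
  · filter_upwards [eventually_ge_atTop 1] with x hx
    refine (ae_restrict_iff' measurableSet_Ioi).2 (.of_forall fun y (hy : 0 < y) => ?_)
    have : 0 < x := one_pos.trans_le hx
    have hyx : y / x ≤ y := div_le_self hy.le hx
    rw [norm_mul, Real.norm_of_nonneg (coshMoment_pos n (by positivity)).le]
    gcongr ?_ * ?_
    · exact (coshMoment_pos n (by positivity)).le
    exact (hC _ (by positivity)).trans (by gcongr)
  · refine (ae_restrict_iff' measurableSet_Ioi).2 (.of_forall fun y (hy : 0 < y) => ?_)
    have hdiv : Tendsto (fun x => y / x) atTop (𝓝[>] 0) :=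
      tendsto_nhdsWithin_iff.2 ⟨tendsto_const_nhds.div_atTop tendsto_id,
        (eventually_gt_atTop 0).mono fun x hx => div_pos hy hx⟩
    exact (hc.comp hdiv).const_mul _

lemma integral_coshMoment_zero_two_mul_mul_rpow {s : ℝ} (hs : 0 < s) :
    ∫ y in Ioi (0 : ℝ), K₀ (2 * y) * (2 * y) ^ (2 * s - 1) = 2 ^ (2 * s - 2) * Gamma s ^ 2 / 2 := by
  rw [integral_comp_mul_left_Ioi (fun z => K₀ z * z ^ (2 * s - 1)) 0 two_pos, mul_zero,
    smul_eq_mul, ← integral_rpow_mul_coshMoment_zero hs]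
  simp only [mul_comm (K₀ _)]
  ring

lemma integral_coshMoment_zero_two_mul : ∫ y in Ioi (0 : ℝ), K₀ (2 * y) = π / 4 := by
  have h := integral_coshMoment_zero_two_mul_mul_rpow (s := 1 / 2) (by norm_num)
  norm_num [Gamma_one_half_eq, sq_sqrt pi_pos.le] at h
  rw [h]
  ring

lemma integrableOn_coshMoment_zero_two_mul_mul_rpow {s : ℝ} (hs : 0 < s) :
    IntegrableOn (fun y => K₀ (2 * y) * (2 * y) ^ (2 * s - 1)) (Ioi 0) := by
  refine Integrable.of_integral_ne_zero ?_
  rw [integral_coshMoment_zero_two_mul_mul_rpow hs]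
  have := Gamma_pos_of_pos hs
  positivity

lemma sqrt_sq_add_sq_rpow_le {x y : ℝ} (hx : x ∈ Ioo 0 1) (hy : 0 < y) (a : ℝ) :
    √(x ^ 2 + y ^ 2) ^ a ≤ y ^ a + (1 + y) ^ a := by
  obtain ⟨hx0, hx1⟩ := hx
  have hle : y ≤ √(x ^ 2 + y ^ 2) := le_sqrt_of_sq_le (by nlinarith)
  have hge : √(x ^ 2 + y ^ 2) ≤ 1 + y := sqrt_le_iff.2 ⟨by positivity, by nlinarith⟩
  rcases le_total 0 a with ha | ha
  · exact (rpow_le_rpow (by positivity) hge ha).trans (le_add_of_nonneg_left (by positivity))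
  · exact (rpow_le_rpow_of_nonpos hy hle ha).trans (le_add_of_nonneg_right (by positivity))

lemma abs_rpow_mul_comp_div_le {a C x y : ℝ}
    (hC : ∀ u, 0 < u → |p u| ≤ C * √(1 + u ^ 2) ^ a) (hx : x ∈ Ioo 0 1) (hy : 0 < y) :
    |x ^ a * p (y / x)| ≤ C * (y ^ a + (1 + y) ^ a) := by
  have hx0 : 0 < x := hx.1
  have hC0 : 0 ≤ C :=
    nonneg_of_mul_nonneg_left ((abs_nonneg _).trans (hC 1 one_pos)) (by positivity)
  have hsqrt : x * √(1 + (y / x) ^ 2) = √(x ^ 2 + y ^ 2) := by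
    rw [← sqrt_sq hx0.le, ← sqrt_mul (by positivity), sqrt_sq hx0.le]
    congr 1
    field_simp
  rw [abs_mul, abs_of_pos (rpow_pos_of_pos hx0 a)]
  calc x ^ a * |p (y / x)|
      ≤ x ^ a * (C * √(1 + (y / x) ^ 2) ^ a) := by
        gcongr
        exact hC _ (by positivity)
    _ = C * √(x ^ 2 + y ^ 2) ^ a := by
        rw [← hsqrt, mul_rpow hx0.le (by positivity)]
        ring
    _ ≤ C * (y ^ a + (1 + y) ^ a) := by
        gcongr
        exact sqrt_sq_add_sq_rpow_le hx hy a

lemma tendsto_rpow_mul_comp_div {a c y : ℝ}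
    (hc : Tendsto (fun u => p u / (2 * u) ^ a) atTop (𝓝 c)) (hy : 0 < y) :
    Tendsto (fun x => x ^ a * p (y / x)) (𝓝[>] 0) (𝓝 ((2 * y) ^ a * c)) := by
  have hdiv : Tendsto (fun x => y / x) (𝓝[>] 0) atTop :=
    tendsto_const_nhds.pos_mul_atTop hy tendsto_inv_nhdsGT_zero
  refine ((hc.comp hdiv).const_mul ((2 * y) ^ a)).congr' ?_
  filter_upwards [self_mem_nhdsWithin] with x (hx : 0 < x)
  have hdivx : 0 < 2 * (y / x) := by positivity
  have hsplit : (2 * y) ^ a = x ^ a * (2 * (y / x)) ^ a := by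
    rw [← mul_rpow hx.le hdivx.le]
    congr 1
    field_simp
  rw [Function.comp_apply, hsplit, mul_assoc, mul_div_cancel₀ _ (rpow_pos_of_pos hdivx a).ne']

/-- Substituting `y / x` for the variable, the behaviour of the transform at `0` is governed by
that of `p` at `∞`. -/
lemma HasModerateGrowth.tendsto_rpow_mul_coshTransform_zero (hp : HasModerateGrowth 0 p)
    {s c C : ℝ} (hs : 0 < s) (hC : ∀ u, 0 < u → |p u| ≤ C * √(1 + u ^ 2) ^ (2 * s - 1))
    (hc : Tendsto (fun u => p u / (2 * u) ^ (2 * s - 1)) atTop (𝓝 c)) :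
    Tendsto (fun x => x ^ (2 * s) * coshTransform 0 p x) (𝓝[>] 0)
      (𝓝 (2 ^ (2 * s - 2) * Gamma s ^ 2 / 2 * c)) := by
  set a := 2 * s - 1
  have hi : IntegrableOn (fun y => K₀ (2 * y) * y ^ a) (Ioi 0) := by
    refine IntegrableOn.congr_fun
      ((integrableOn_coshMoment_zero_two_mul_mul_rpow hs).const_mul (2 ^ (-a)))
      (fun y (hy : 0 < y) => ?_) measurableSet_Ioi
    simp only [a, mul_rpow zero_le_two hy.le]
    rw [mul_left_comm, ← mul_assoc (2 ^ _), ← rpow_add two_pos, neg_add_cancel, rpow_zero, one_mul]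
  rw [← integral_coshMoment_zero_two_mul_mul_rpow hs, ← integral_mul_const]
  refine (tendsto_integral_filter_of_dominated_convergence
    (F := fun x y => x ^ a * (K₀ (2 * y) * p (y / x)))
    (fun y => C * (K₀ (2 * y) * y ^ a + K₀ (2 * y) * (1 + y) ^ a)) ?_ ?_
    ((hi.add (HasModerateGrowth.one_add_rpow a).integrableOn_one).const_mul C) ?_).congr' ?_
  · filter_upwards [self_mem_nhdsWithin] with x hx
    exact (hp.aestronglyMeasurable_comp_div hx).const_mul _
  · filter_upwards [Ioo_mem_nhdsGT one_pos] with x hx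
    refine (ae_restrict_iff' measurableSet_Ioi).2 (.of_forall fun y (hy : 0 < y) => ?_)
    have hK : 0 < K₀ (2 * y) := coshMoment_pos 0 (by positivity)
    have hbound := mul_le_mul_of_nonneg_left (abs_rpow_mul_comp_div_le hC hx hy) hK.le
    rw [mul_left_comm, norm_mul, Real.norm_of_nonneg hK.le, Real.norm_eq_abs]
    exact hbound.trans_eq (by ring)
  · refine (ae_restrict_iff' measurableSet_Ioi).2 (.of_forall fun y (hy : 0 < y) => ?_)
    simpa only [mul_left_comm, mul_assoc] using
      (tendsto_rpow_mul_comp_div hc hy).const_mul (K₀ (2 * y))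
  · filter_upwards [self_mem_nhdsWithin] with x (hx : 0 < x)
    rw [integral_const_mul, ← mul_coshTransform 0 p hx, ← mul_assoc, ← rpow_add_one hx.ne',
      sub_add_cancel]

end

/-! ### Nicholson's integrals -/

lemma one_le_sqrt_one_add_sq (y : ℝ) : 1 ≤ √(1 + y ^ 2) :=
  one_le_sqrt.2 (le_add_of_nonneg_right (sq_nonneg y))

lemma exp_arsinh_le (y : ℝ) : exp (arsinh y) ≤ 2 * √(1 + y ^ 2) := by
  rw [exp_arsinh]
  linarith [le_sqrt_of_sq_le (le_add_of_nonneg_left zero_le_one : y ^ 2 ≤ 1 + y ^ 2)]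

lemma cosh_mul_arsinh_le (a : ℝ) {y : ℝ} (hy : 0 ≤ y) :
    cosh (a * arsinh y) ≤ (2 * √(1 + y ^ 2)) ^ |a| := by
  have hcosh : cosh (a * arsinh y) ≤ exp (|a| * arsinh y) := by
    rw [← cosh_abs, abs_mul, abs_of_nonneg (arsinh_nonneg_iff.2 hy)]
    have hnonneg : 0 ≤ |a| * arsinh y := mul_nonneg (abs_nonneg a) (arsinh_nonneg_iff.2 hy)
    linarith [cosh_add_sinh (|a| * arsinh y), sinh_nonneg_iff.2 hnonneg]
  refine hcosh.trans ?_
  rw [mul_comm, exp_mul]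
  exact rpow_le_rpow (exp_pos _).le (exp_arsinh_le y) (abs_nonneg a)

lemma cosh_mul_arsinh_mono {a b y : ℝ} (h : |a| ≤ b) :
    cosh (a * arsinh y) ≤ cosh (b * arsinh y) := by
  rw [cosh_le_cosh, abs_mul, abs_mul]
  exact mul_le_mul_of_nonneg_right (h.trans (le_abs_self b)) (abs_nonneg _)

lemma sinh_le_mul_cosh {u : ℝ} (hu : 0 ≤ u) : sinh u ≤ u * cosh u := by
  have hmono : MonotoneOn (fun u => u * cosh u - sinh u) (Ici 0) := by
    refine monotoneOn_of_deriv_nonneg (convex_Ici 0) (by fun_prop) (by fun_prop) fun v hv => ?_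
    rw [interior_Ici] at hv
    have hderiv := ((hasDerivAt_id v).mul (hasDerivAt_cosh v)).sub (hasDerivAt_sinh v)
    rw [HasDerivAt.deriv (f := fun u => u * cosh u - sinh u) hderiv]
    simpa using mul_nonneg (mem_Ioi.1 hv).le (sinh_nonneg_iff.2 (mem_Ioi.1 hv).le)
  have h := hmono self_mem_Ici (mem_Ici.2 hu) hu
  simp only [sinh_zero, zero_mul, sub_zero] at h
  linarith

lemma abs_sinh_mul_arsinh_le (a : ℝ) {y : ℝ} (hy : 0 ≤ y) :
    |sinh (a * arsinh y)| ≤ |a| * y * cosh (a * arsinh y) := by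
  have harsinh : 0 ≤ arsinh y := arsinh_nonneg_iff.2 hy
  have hle : arsinh y ≤ y := by simpa using self_le_sinh_iff.2 harsinh
  rw [abs_sinh, ← cosh_abs (a * arsinh y), abs_mul, abs_of_nonneg harsinh]
  refine (sinh_le_mul_cosh (by positivity)).trans ?_
  gcongr

lemma HasModerateGrowth.cosh_mul_arsinh (a : ℝ) :
    HasModerateGrowth 0 fun y => cosh (a * arsinh y) := by
  refine ((HasModerateGrowth.const (4 ^ |a|)).mul (one_add_rpow |a|)).of_abs_le (by fun_prop)
    fun y hy => ?_
  have hsqrt : √(1 + y ^ 2) ≤ 1 + y := sqrt_le_iff.2 ⟨by positivity, by nlinarith⟩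
  rw [abs_of_pos (cosh_pos _), abs_of_pos (by positivity), ← mul_rpow (by norm_num) (by positivity)]
  exact (cosh_mul_arsinh_le a hy.le).trans
    (rpow_le_rpow (by positivity) (by linarith) (abs_nonneg a))

lemma HasModerateGrowth.sinh_mul_arsinh (a : ℝ) :
    HasModerateGrowth 1 fun y => sinh (a * arsinh y) := by
  refine (HasModerateGrowth.id.mul ((HasModerateGrowth.const |a|).mul
    (cosh_mul_arsinh a))).of_abs_le (by fun_prop) fun y hy => ?_
  refine (abs_sinh_mul_arsinh_le a hy.le).trans (le_of_eq_of_le ?_ (le_abs_self _))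
  ring

lemma HasModerateGrowth.div_sqrt {n : ℕ} {p : ℝ → ℝ} (hp : HasModerateGrowth n p) :
    HasModerateGrowth n fun y => p y / √(1 + y ^ 2) := by
  refine hp.of_abs_le (hp.1.div (by fun_prop) fun y _ => by positivity) fun y _ => ?_
  rw [abs_div, abs_of_pos (by positivity : 0 < √(1 + y ^ 2))]
  exact div_le_self (abs_nonneg _) (one_le_sqrt_one_add_sq y)

/-- The integral `∫_0^∞ K_0(2x sinh t) cosh(2νt) dt`, in the variable `y = sinh t`.  Nicholson's
formula is `N_ν = (8 / π²) nicholsonP ν`. -/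
noncomputable def nicholsonP (ν x : ℝ) : ℝ :=
  coshTransform 0 (fun y => cosh (2 * ν * arsinh y) / √(1 + y ^ 2)) x

/-- The integral `∫_0^∞ K_1(2x sinh t) sinh((2ν+1)t) dt`, in the variable `y = sinh t`: the
companion of `nicholsonP` that closes the system of differential equations in `x`. -/
noncomputable def nicholsonR (ν x : ℝ) : ℝ :=
  coshTransform 1 (fun y => sinh ((2 * ν + 1) * arsinh y) / √(1 + y ^ 2)) x

lemma hasModerateGrowth_nicholsonP (ν : ℝ) :
    HasModerateGrowth 0 fun y => cosh (2 * ν * arsinh y) / √(1 + y ^ 2) :=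
  (HasModerateGrowth.cosh_mul_arsinh (2 * ν)).div_sqrt

lemma hasModerateGrowth_nicholsonR (ν : ℝ) :
    HasModerateGrowth 1 fun y => sinh ((2 * ν + 1) * arsinh y) / √(1 + y ^ 2) :=
  (HasModerateGrowth.sinh_mul_arsinh (2 * ν + 1)).div_sqrt

lemma nicholsonP_neg (ν x : ℝ) : nicholsonP (-ν) x = nicholsonP ν x := by
  simp only [nicholsonP, mul_neg, neg_mul, cosh_neg]

lemma nicholsonR_neg_sub_one (ν x : ℝ) : nicholsonR (-ν - 1) x = -nicholsonR ν x := by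
  simp only [nicholsonR, coshTransform, ← integral_neg]
  congr with y
  rw [show 2 * (-ν - 1) + 1 = -(2 * ν + 1) by ring, neg_mul, sinh_neg, neg_div, mul_neg]

lemma nicholsonP_pos (ν : ℝ) {x : ℝ} (hx : 0 < x) : 0 < nicholsonP ν x :=
  (hasModerateGrowth_nicholsonP ν).coshTransform_pos
    (fun _ _ => div_pos (cosh_pos _) (by positivity)) hx

section

variable {n : ℕ} {p p' : ℝ → ℝ} {x : ℝ}

lemma HasModerateGrowth.div_self (hp : HasModerateGrowth (n + 1) p) :
    HasModerateGrowth n fun y => p y / y := by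
  obtain ⟨hpc, C, N, hC⟩ := hp
  refine ⟨hpc.div continuousOn_id fun y hy => hy.ne', C, N, fun y hy => ?_⟩
  rw [abs_div, abs_of_pos hy, div_le_iff₀ hy]
  exact (hC y hy).trans_eq (by ring)

lemma HasModerateGrowth.exists_norm_coshMoment_mul_le (hp : HasModerateGrowth (n + 1) p)
    (hx : 0 < x) :
    ∃ C, ∀ y, 0 < y →
      ‖coshMoment n (2 * x * y) * p y‖ ≤ C * (y ^ (1 / 2 : ℝ) * exp (-(x / 2) * y)) := by
  obtain ⟨C, hC⟩ := hp.div_self.exists_abs_coshMoment_mul_le hx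
  refine ⟨C, fun y hy => ?_⟩
  have hpow : y ^ (1 / 2 : ℝ) = y * y ^ (-(1 / 2) : ℝ) := by
    rw [← rpow_one_add' hy.le (by norm_num)]
    norm_num
  calc ‖coshMoment n (2 * x * y) * p y‖ = y * |coshMoment n (2 * x * y) * (p y / y)| := by
        rw [← abs_of_pos hy, ← abs_mul, abs_of_pos hy, norm_eq_abs]
        congr 1
        field_simp
    _ ≤ y * (C * (y ^ (-(1 / 2) : ℝ) * exp (-(x / 2) * y))) := by
        gcongr
        exact hC y hy
    _ = C * (y ^ (1 / 2 : ℝ) * exp (-(x / 2) * y)) := by rw [hpow]; ring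

lemma HasModerateGrowth.tendsto_coshMoment_mul_nhdsGT_zero (hp : HasModerateGrowth (n + 1) p)
    (hx : 0 < x) : Tendsto (fun y => coshMoment n (2 * x * y) * p y) (𝓝[>] 0) (𝓝 0) := by
  obtain ⟨C, hC⟩ := hp.exists_norm_coshMoment_mul_le hx
  refine squeeze_zero_norm' (eventually_mem_nhdsWithin.mono hC) ?_
  have hcont : Continuous fun y : ℝ => C * (y ^ (1 / 2 : ℝ) * exp (-(x / 2) * y)) := by
    have := continuous_rpow_const (q := 1 / 2) (by norm_num)
    fun_prop
  simpa using (hcont.tendsto 0).mono_left nhdsWithin_le_nhds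

lemma HasModerateGrowth.tendsto_coshMoment_mul_atTop (hp : HasModerateGrowth (n + 1) p)
    (hx : 0 < x) : Tendsto (fun y => coshMoment n (2 * x * y) * p y) atTop (𝓝 0) := by
  obtain ⟨C, hC⟩ := hp.exists_norm_coshMoment_mul_le hx
  refine squeeze_zero_norm' ((eventually_gt_atTop 0).mono hC) ?_
  simpa using
    (tendsto_rpow_mul_exp_neg_mul_atTop_nhds_zero (1 / 2) (x / 2) (half_pos hx)).const_mul C

lemma HasModerateGrowth.coshTransform_deriv (hp : HasModerateGrowth (n + 1) p)
    (hp' : HasModerateGrowth n p') (h : ∀ y, 0 < y → HasDerivAt p (p' y) y) (hx : 0 < x) :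
    coshTransform n p' x = 2 * x * coshTransform (n + 1) p x := by
  have hK (y : ℝ) (hy : y ∈ Ioi 0) : HasDerivAt (fun y => coshMoment n (2 * x * y))
      (-(2 * x) * coshMoment (n + 1) (2 * x * y)) y := by
    have hlin : HasDerivAt (fun y : ℝ => 2 * x * y) (2 * x) y := by
      simpa using (hasDerivAt_id y).const_mul (2 * x)
    exact ((hasDerivAt_coshMoment n (mul_pos (mul_pos two_pos hx) hy)).comp y hlin).congr_deriv
      (by ring)
  have hint : IntegrableOn
      ((fun y => -(2 * x) * coshMoment (n + 1) (2 * x * y)) * p) (Ioi 0) :=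
    ((hp.integrableOn hx).const_mul (-(2 * x))).congr (.of_forall fun y => by
      simp only [Pi.mul_apply]; ring)
  rw [coshTransform, integral_Ioi_mul_deriv_eq_deriv_mul hK h (hp'.integrableOn hx) hint
    (hp.tendsto_coshMoment_mul_nhdsGT_zero hx) (hp.tendsto_coshMoment_mul_atTop hx),
    coshTransform, ← integral_const_mul]
  simp only [neg_mul, integral_neg, mul_assoc]
  ring

end

lemma mul_nicholsonP (ν : ℝ) {x : ℝ} (hx : 0 < x) :
    ν * nicholsonP ν x = x * coshTransform 1 (fun y => sinh (2 * ν * arsinh y)) x := by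
  have h := (HasModerateGrowth.sinh_mul_arsinh (2 * ν)).coshTransform_deriv
    ((HasModerateGrowth.const (2 * ν)).mul (hasModerateGrowth_nicholsonP ν)) (fun y _ =>
      (((hasDerivAt_arsinh y).const_mul (2 * ν)).sinh).congr_deriv (by ring)) hx
  have hconst : coshTransform 0 (fun y => 2 * ν * (cosh (2 * ν * arsinh y) / √(1 + y ^ 2))) x =
      2 * ν * nicholsonP ν x := by
    simp only [nicholsonP, coshTransform, ← integral_const_mul]
    congr with y
    ring
  linarith

lemma nicholsonR_eq_add (ν : ℝ) {x : ℝ} (hx : 0 < x) :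
    nicholsonR ν x = coshTransform 1 (fun y => sinh (2 * ν * arsinh y)) x +
      coshTransform 1 (fun y => y * (cosh (2 * ν * arsinh y) / √(1 + y ^ 2))) x := by
  simp only [nicholsonR, coshTransform]
  rw [← integral_add ((HasModerateGrowth.sinh_mul_arsinh (2 * ν)).integrableOn hx)
    ((HasModerateGrowth.id.mul (hasModerateGrowth_nicholsonP ν)).integrableOn hx)]
  congr with y
  have : 0 < √(1 + y ^ 2) := by positivity
  rw [add_mul, one_mul, sinh_add, sinh_arsinh, cosh_arsinh]
  field_simp

lemma hasDerivAt_nicholsonP (ν : ℝ) {x : ℝ} (hx : 0 < x) :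
    HasDerivAt (nicholsonP ν) (2 * ν / x * nicholsonP ν x - 2 * nicholsonR ν x) x := by
  refine ((hasModerateGrowth_nicholsonP ν).hasDerivAt_coshTransform hx).congr_deriv ?_
  have h : 2 * ν / x * nicholsonP ν x = 2 * (ν * nicholsonP ν x) / x := by ring
  rw [nicholsonR_eq_add ν hx, h, mul_nicholsonP ν hx]
  field_simp
  ring

lemma hasDerivAt_nicholsonP_add_one (ν : ℝ) {x : ℝ} (hx : 0 < x) :
    HasDerivAt (nicholsonP (ν + 1))
      (2 * nicholsonR ν x - 2 * (ν + 1) / x * nicholsonP (ν + 1) x) x := by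
  have h := hasDerivAt_nicholsonP (-ν - 1) hx
  rw [nicholsonR_neg_sub_one, show -ν - 1 = -(ν + 1) by ring, nicholsonP_neg] at h
  exact (h.congr_of_eventuallyEq
    (.of_forall fun z => (nicholsonP_neg (ν + 1) z).symm)).congr_deriv (by ring)

lemma nicholsonP_add_one_sub (ν : ℝ) {x : ℝ} (hx : 0 < x) :
    nicholsonP (ν + 1) x - nicholsonP ν x = 2 * coshTransform 0
      (fun y => y * (sinh ((2 * ν + 1) * arsinh y) / √(1 + y ^ 2))) x := by
  simp only [nicholsonP, coshTransform]
  rw [← integral_sub ((hasModerateGrowth_nicholsonP (ν + 1)).integrableOn hx)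
    ((hasModerateGrowth_nicholsonP ν).integrableOn hx), ← integral_const_mul]
  congr with y
  have : 0 < √(1 + y ^ 2) := by positivity
  rw [show 2 * (ν + 1) * arsinh y = (2 * ν + 1) * arsinh y + arsinh y by ring,
    show 2 * ν * arsinh y = (2 * ν + 1) * arsinh y - arsinh y by ring,
    cosh_add, cosh_sub, sinh_arsinh, cosh_arsinh]
  field_simp
  ring

lemma hasDerivAt_nicholsonR (ν : ℝ) {x : ℝ} (hx : 0 < x) :
    HasDerivAt (nicholsonR ν) (nicholsonP ν x - nicholsonP (ν + 1) x - nicholsonR ν x / x) x := by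
  refine ((hasModerateGrowth_nicholsonR ν).hasDerivAt_coshTransform_one hx).congr_deriv ?_
  rw [← nicholsonP_add_one_sub ν hx, nicholsonR]
  ring

lemma tendsto_mul_nicholsonP (ν : ℝ) :
    Tendsto (fun x => x * nicholsonP ν x) atTop (𝓝 (π / 4)) := by
  have hcont : ContinuousAt (fun y => cosh (2 * ν * arsinh y) / √(1 + y ^ 2)) 0 :=
    ContinuousAt.div (by fun_prop) (by fun_prop) (by positivity)
  have hzero := hcont.tendsto.mono_left (nhdsWithin_le_nhds (s := Ioi 0))
  have h := (hasModerateGrowth_nicholsonP ν).tendsto_mul_coshTransform_atTop hzero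
  rw [integral_coshMoment_zero_two_mul] at h
  simpa [nicholsonP] using h

lemma tendsto_mul_nicholsonR (ν : ℝ) : Tendsto (fun x => x * nicholsonR ν x) atTop (𝓝 0) := by
  have hcont : ContinuousAt (fun y => sinh ((2 * ν + 1) * arsinh y) / √(1 + y ^ 2)) 0 :=
    ContinuousAt.div (by fun_prop) (by fun_prop) (by positivity)
  have hzero := hcont.tendsto.mono_left (nhdsWithin_le_nhds (s := Ioi 0))
  simpa [nicholsonR] using
    (hasModerateGrowth_nicholsonR ν).tendsto_mul_coshTransform_atTop hzero

lemma tendsto_two_mul_cosh_mul_exp_neg_atTop :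
    Tendsto (fun t => 2 * cosh t * exp (-t)) atTop (𝓝 1) := by
  have h : Tendsto (fun t => 1 + exp (-t) ^ 2) atTop (𝓝 (1 + 0 ^ 2)) :=
    (tendsto_exp_neg_atTop_nhds_zero.pow 2).const_add 1
  norm_num at h
  refine h.congr fun t => ?_
  rw [cosh_eq, mul_div_cancel₀ _ two_ne_zero, add_mul, ← exp_add, add_neg_cancel, exp_zero, sq]

lemma tendsto_two_mul_sinh_mul_exp_neg_atTop :
    Tendsto (fun t => 2 * sinh t * exp (-t)) atTop (𝓝 1) := by
  have h : Tendsto (fun t => 1 - exp (-t) ^ 2) atTop (𝓝 (1 - 0 ^ 2)) :=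
    (tendsto_exp_neg_atTop_nhds_zero.pow 2).const_sub 1
  norm_num at h
  refine h.congr fun t => ?_
  rw [sinh_eq, mul_div_cancel₀ _ two_ne_zero, sub_mul, ← exp_add, add_neg_cancel, exp_zero, sq]

lemma tendsto_cosh_div_cosh_div_sinh_rpow {a : ℝ} (ha : 0 < a) :
    Tendsto (fun t => cosh (a * t) / cosh t / (2 * sinh t) ^ (a - 1)) atTop (𝓝 1) := by
  have hnum := tendsto_two_mul_cosh_mul_exp_neg_atTop.comp (tendsto_id.const_mul_atTop ha)
  have hsinh := tendsto_two_mul_sinh_mul_exp_neg_atTop.rpow_const (p := a - 1) (.inl one_ne_zero)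
  rw [one_rpow] at hsinh
  have h := (hnum.div tendsto_two_mul_cosh_mul_exp_neg_atTop one_ne_zero).div hsinh one_ne_zero
  norm_num at h
  refine h.congr' ?_
  filter_upwards [eventually_gt_atTop 0] with t ht
  have hsinh_pos := sinh_pos_iff.2 ht
  have hexp : exp (-(a * t)) = exp (-t) * exp (-t) ^ (a - 1) := by
    rw [← exp_mul, ← exp_add]
    ring_nf
  simp only [Pi.div_apply, Function.comp, hexp,
    mul_rpow (mul_pos two_pos hsinh_pos).le (exp_pos _).le]
  have := cosh_pos t
  have : 0 < exp (-t) ^ (a - 1) := by positivity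
  field_simp

lemma tendsto_arsinh_atTop : Tendsto arsinh atTop atTop :=
  sinhOrderIso.symm.tendsto_atTop

lemma abs_cosh_mul_arsinh_div_sqrt_le {a : ℝ} (ha : 0 ≤ a) {y : ℝ} (hy : 0 ≤ y) :
    |cosh (a * arsinh y) / √(1 + y ^ 2)| ≤ 2 ^ a * √(1 + y ^ 2) ^ (a - 1) := by
  have hsqrt : 0 < √(1 + y ^ 2) := by positivity
  have h := cosh_mul_arsinh_le a hy
  rw [abs_of_nonneg ha, mul_rpow zero_le_two hsqrt.le] at h
  rw [abs_of_pos (div_pos (cosh_pos _) hsqrt), rpow_sub_one hsqrt.ne', ← mul_div_assoc]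
  gcongr

lemma tendsto_rpow_mul_nicholsonP {s : ℝ} (hs : 0 < s) :
    Tendsto (fun x => x ^ (2 * s) * nicholsonP s x) (𝓝[>] 0)
      (𝓝 (2 ^ (2 * s - 2) * Gamma s ^ 2 / 2)) := by
  have h2s : 0 < 2 * s := by positivity
  have hweight := (tendsto_cosh_div_cosh_div_sinh_rpow h2s).comp tendsto_arsinh_atTop
  simp only [Function.comp_def, sinh_arsinh, cosh_arsinh] at hweight
  simpa [nicholsonP] using
    (hasModerateGrowth_nicholsonP s).tendsto_rpow_mul_coshTransform_zero hs
      (fun y hy => abs_cosh_mul_arsinh_div_sqrt_le h2s.le hy.le) hweight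

lemma continuous_nicholsonP_order {x : ℝ} (hx : 0 < x) : Continuous (nicholsonP · x) := by
  refine continuous_iff_continuousAt.2 fun ν₀ => ?_
  refine continuousAt_of_dominated (.of_forall fun ν =>
    ((hasModerateGrowth_nicholsonP ν).integrableOn hx).1) ?_
    ((HasModerateGrowth.cosh_mul_arsinh (2 * (|ν₀| + 1))).integrableOn hx)
    (.of_forall fun y => Continuous.continuousAt (by fun_prop))
  filter_upwards [Metric.ball_mem_nhds ν₀ one_pos] with ν (hdist : |ν - ν₀| < 1)
  refine (ae_restrict_iff' measurableSet_Ioi).2 (.of_forall fun y (hy : 0 < y) => ?_)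
  have hν : |2 * ν| ≤ 2 * (|ν₀| + 1) := by
    rw [abs_mul, abs_two]
    linarith [abs_sub_abs_le_abs_sub ν ν₀, hdist]
  have hK := coshMoment_pos 0 (by positivity : 0 < 2 * x * y)
  have hc := cosh_pos (2 * ν * arsinh y)
  rw [Real.norm_of_nonneg (by positivity)]
  gcongr
  exact (div_le_self hc.le (one_le_sqrt_one_add_sq _)).trans (cosh_mul_arsinh_mono hν)

lemma continuous_nicholsonR_order {x : ℝ} (hx : 0 < x) : Continuous (nicholsonR · x) := by
  refine continuous_iff_continuousAt.2 fun ν₀ => ?_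
  set M := 2 * |ν₀| + 3
  refine continuousAt_of_dominated (.of_forall fun ν =>
    ((hasModerateGrowth_nicholsonR ν).integrableOn hx).1) ?_
    ((HasModerateGrowth.id.mul ((HasModerateGrowth.const M).mul
      (HasModerateGrowth.cosh_mul_arsinh M))).integrableOn hx)
    (.of_forall fun y => Continuous.continuousAt (by fun_prop))
  filter_upwards [Metric.ball_mem_nhds ν₀ one_pos] with ν (hdist : |ν - ν₀| < 1)
  refine (ae_restrict_iff' measurableSet_Ioi).2 (.of_forall fun y (hy : 0 < y) => ?_)
  have hν : |2 * ν + 1| ≤ M := by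
    have := abs_add_le (2 * ν) 1
    rw [abs_mul, abs_two, abs_one] at this
    linarith [abs_sub_abs_le_abs_sub ν ν₀, hdist]
  have hK := coshMoment_pos 1 (by positivity : 0 < 2 * x * y)
  rw [norm_mul, Real.norm_of_nonneg hK.le, norm_eq_abs, abs_div,
    abs_of_pos (by positivity : 0 < √(1 + y ^ 2))]
  gcongr
  calc |sinh ((2 * ν + 1) * arsinh y)| / √(1 + y ^ 2)
      ≤ |sinh ((2 * ν + 1) * arsinh y)| := div_le_self (abs_nonneg _) (one_le_sqrt_one_add_sq y)
    _ ≤ |2 * ν + 1| * y * cosh ((2 * ν + 1) * arsinh y) := abs_sinh_mul_arsinh_le _ hy.le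
    _ ≤ M * y * cosh (M * arsinh y) :=
      mul_le_mul (by gcongr) (cosh_mul_arsinh_mono hν) (cosh_pos _).le (by positivity)
    _ = y * (M * cosh (M * arsinh y)) := by ring

/-! ### Nicholson's formula for non-integer order -/

/-- The symmetric form in two solutions `(A, B)` and `(A', B')` of the Bessel system whose
coefficients are Nicholson's integrals.  These are chosen so that it is constant in `x`. -/
noncomputable def nicholsonForm (ν : ℝ) (A B A' B' : ℝ → ℝ) (x : ℝ) : ℝ :=
  x ^ 2 * (A x * A' x * nicholsonP (ν + 1) x - (A x * B' x + B x * A' x) * nicholsonR ν x +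
    B x * B' x * nicholsonP ν x)

lemma IsBesselPair.hasDerivAt_nicholsonForm {ν : ℝ} {A B A' B' : ℝ → ℝ}
    (h : IsBesselPair ν A B) (h' : IsBesselPair ν A' B') {x : ℝ} (hx : 0 < x) :
    HasDerivAt (nicholsonForm ν A B A' B') 0 x := by
  obtain ⟨hA, hB⟩ := h x hx
  obtain ⟨hA', hB'⟩ := h' x hx
  refine (((hasDerivAt_id x).pow 2).mul
    ((((hA.mul hA').mul (hasDerivAt_nicholsonP_add_one ν hx)).sub
      (((hA.mul hB').add (hB.mul hA')).mul (hasDerivAt_nicholsonR ν hx))).add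
      ((hB.mul hB').mul (hasDerivAt_nicholsonP ν hx)))).congr_deriv ?_
  simp only [id, Pi.add_apply, Pi.mul_apply, Pi.sub_apply, Pi.pow_apply]
  field_simp
  ring

lemma nicholson_discriminant (ν : ℝ) {x : ℝ} (hx : 0 < x) :
    x ^ 2 * (nicholsonP ν x * nicholsonP (ν + 1) x - nicholsonR ν x ^ 2) = (π / 4) ^ 2 := by
  refine eq_of_tendsto_of_hasDerivAt_zero
    (f := fun x => x ^ 2 * (nicholsonP ν x * nicholsonP (ν + 1) x - nicholsonR ν x ^ 2))
    (eventually_gt_atTop 0) (fun x hx => ?_) ?_ hx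
  · refine (((hasDerivAt_id x).pow 2).mul (((hasDerivAt_nicholsonP ν hx).mul
      (hasDerivAt_nicholsonP_add_one ν hx)).sub
      ((hasDerivAt_nicholsonR ν hx).pow 2))).congr_deriv ?_
    simp only [id, Pi.mul_apply, Pi.sub_apply, Pi.pow_apply]
    field_simp
    ring
  · have h := ((tendsto_mul_nicholsonP ν).mul (tendsto_mul_nicholsonP (ν + 1))).sub
      ((tendsto_mul_nicholsonR ν).pow 2)
    rw [show π / 4 * (π / 4) - 0 ^ 2 = (π / 4) ^ 2 by ring] at h
    refine h.congr fun x => ?_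
    ring

section

variable (ν : ℝ) (A B A' B' : ℝ → ℝ)

lemma nicholsonForm_gram {x : ℝ} (hx : 0 < x) :
    nicholsonForm ν A B A B x * nicholsonForm ν A' B' A' B' x -
      nicholsonForm ν A B A' B' x ^ 2 =
      (π / 4) ^ 2 * (x * (A x * B' x - B x * A' x)) ^ 2 := by
  rw [← nicholson_discriminant ν hx]
  simp only [nicholsonForm]
  ring

lemma sq_wronskian_mul_nicholsonP (x : ℝ) :
    (x * (A x * B' x - B x * A' x)) ^ 2 * nicholsonP ν x =
      nicholsonForm ν A B A B x * A' x ^ 2 - 2 * nicholsonForm ν A B A' B' x * A x * A' x +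
        nicholsonForm ν A' B' A' B' x * A x ^ 2 := by
  simp only [nicholsonForm]
  ring

end

lemma tendsto_rpow_neg_mul_besselJ (ν : ℝ) :
    Tendsto (fun x => x ^ (-ν) * besselJ ν x) (𝓝[>] 0) (𝓝 (2 ^ (-ν) * (Gamma (ν + 1))⁻¹)) := by
  have hcont : Continuous fun x : ℝ => 2 ^ (-ν) * besselClifford ν ((x / 2) ^ 2) := by fun_prop
  have h := (hcont.tendsto 0).mono_left (nhdsWithin_le_nhds (s := Ioi 0))
  rw [zero_div, zero_pow two_ne_zero, besselClifford_zero_right] at h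
  refine h.congr' (eventually_mem_nhdsWithin.mono fun x (hx : 0 < x) => ?_)
  simp only [besselJ_eq_rpow_mul_besselClifford, div_rpow hx.le zero_le_two, rpow_neg hx.le,
    rpow_neg zero_le_two]
  have := rpow_pos_of_pos hx ν
  field_simp

lemma tendsto_sq_mul_besselJ_sq_mul_nicholsonP_add_one {ν : ℝ} (hν : -1 < ν) :
    Tendsto (fun x => x ^ 2 * besselJ ν x ^ 2 * nicholsonP (ν + 1) x) (𝓝[>] 0) (𝓝 (1 / 2)) := by
  have hGamma : 0 < Gamma (ν + 1) := Gamma_pos_of_pos (by linarith)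
  have h := ((tendsto_rpow_neg_mul_besselJ ν).pow 2).mul
    (tendsto_rpow_mul_nicholsonP (s := ν + 1) (by linarith))
  have hlim : (2 ^ (-ν) * (Gamma (ν + 1))⁻¹) ^ 2 *
      (2 ^ (2 * (ν + 1) - 2) * Gamma (ν + 1) ^ 2 / 2) = 1 / 2 := by
    rw [show 2 * (ν + 1) - 2 = ν + ν by ring, rpow_add two_pos, rpow_neg zero_le_two]
    have := rpow_pos_of_pos two_pos ν
    field_simp
  rw [hlim] at h
  refine h.congr' (eventually_mem_nhdsWithin.mono fun x (hx : 0 < x) => ?_)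
  rw [show 2 * (ν + 1) = ν + ν + (2 : ℕ) by push_cast; ring, rpow_add_natCast hx.ne',
    rpow_add hx, rpow_neg hx.le]
  have := rpow_pos_of_pos hx ν
  field_simp

lemma tendsto_sq_mul_besselJ_add_one_sq_mul_nicholsonP {ν : ℝ} (h1 : -1 < ν) (h0 : ν < 0) :
    Tendsto (fun x => x ^ 2 * besselJ (ν + 1) x ^ 2 * nicholsonP ν x) (𝓝[>] 0) (𝓝 0) := by
  have hrpow : Tendsto (fun x : ℝ => x ^ (4 + 4 * ν)) (𝓝[>] 0) (𝓝 0) := by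
    have h := (continuous_rpow_const (q := 4 + 4 * ν) (by linarith)).tendsto 0
    rw [zero_rpow (by linarith)] at h
    exact h.mono_left nhdsWithin_le_nhds
  have h := hrpow.mul (((tendsto_rpow_neg_mul_besselJ (ν + 1)).pow 2).mul
    (tendsto_rpow_mul_nicholsonP (s := -ν) (by linarith)))
  rw [zero_mul] at h
  refine h.congr' (eventually_mem_nhdsWithin.mono fun x (hx : 0 < x) => ?_)
  have hsq : x ^ (4 + 4 * ν) * ((x ^ (-(ν + 1))) ^ 2 * x ^ (2 * -ν)) = x ^ 2 := by
    rw [← rpow_mul_natCast hx.le, ← rpow_add hx, ← rpow_add hx, ← rpow_natCast x 2]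
    congr 1
    push_cast
    ring
  simp only [← hsq, nicholsonP_neg]
  ring

lemma tendsto_sq_mul_besselJ_mul_besselJ_add_one_mul_nicholsonR {ν : ℝ} (h1 : -1 < ν)
    (h0 : ν < 0) : Tendsto (fun x => x ^ 2 * (besselJ ν x * besselJ (ν + 1) x) * nicholsonR ν x)
      (𝓝[>] 0) (𝓝 0) := by
  have h := ((tendsto_sq_mul_besselJ_sq_mul_nicholsonP_add_one h1).mul
    (tendsto_sq_mul_besselJ_add_one_sq_mul_nicholsonP h1 h0)).sqrt
  rw [mul_zero, sqrt_zero] at h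
  refine squeeze_zero_norm' (eventually_mem_nhdsWithin.mono fun x (hx : 0 < x) => ?_) h
  refine abs_le_sqrt ?_
  -- Nicholson's discriminant is positive, so `R_ν² ≤ P_ν P_{ν+1}`.
  have hdisc : 0 ≤ x ^ 2 * (nicholsonP ν x * nicholsonP (ν + 1) x - nicholsonR ν x ^ 2) :=
    (sq_nonneg _).trans_eq (nicholson_discriminant ν hx).symm
  linarith [mul_nonneg (sq_nonneg (x * besselJ ν x * besselJ (ν + 1) x)) hdisc]

lemma nicholsonForm_besselJ {ν : ℝ} (h1 : -1 < ν) (h0 : ν < 0) {x : ℝ} (hx : 0 < x) :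
    nicholsonForm ν (besselJ ν) (besselJ (ν + 1)) (besselJ ν) (besselJ (ν + 1)) x = 1 / 2 := by
  refine eq_of_tendsto_of_hasDerivAt_zero (l := 𝓝[>] 0) self_mem_nhdsWithin
    (fun x hx => (isBesselPair_besselJ ν).hasDerivAt_nicholsonForm (isBesselPair_besselJ ν) hx)
    ?_ hx
  have h := ((tendsto_sq_mul_besselJ_sq_mul_nicholsonP_add_one h1).sub
    ((tendsto_sq_mul_besselJ_mul_besselJ_add_one_mul_nicholsonR h1 h0).const_mul 2)).add
    (tendsto_sq_mul_besselJ_add_one_sq_mul_nicholsonP h1 h0)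
  rw [mul_zero, sub_zero, add_zero] at h
  refine h.congr fun x => ?_
  rw [nicholsonForm]
  ring

lemma nicholsonForm_besselJ_neg {ν : ℝ} (h1 : -1 < ν) (h0 : ν < 0) {x : ℝ} (hx : 0 < x) :
    nicholsonForm ν (besselJ (-ν)) (fun x => -besselJ (-ν - 1) x) (besselJ (-ν))
      (fun x => -besselJ (-ν - 1) x) x = 1 / 2 := by
  rw [← nicholsonForm_besselJ (ν := -ν - 1) (by linarith) (by linarith) hx, nicholsonForm,
    nicholsonForm, nicholsonR_neg_sub_one, show -ν - 1 + 1 = -ν by ring, nicholsonP_neg,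
    show -ν - 1 = -(ν + 1) by ring, nicholsonP_neg]
  ring

/-- The value of `nicholsonForm` on the solutions `J_ν` and `J_{-ν}` of the Bessel system. -/
noncomputable def nicholsonMixed (ν x : ℝ) : ℝ :=
  nicholsonForm ν (besselJ ν) (besselJ (ν + 1)) (besselJ (-ν)) (fun x => -besselJ (-ν - 1) x) x

lemma nicholsonMixed_sq {ν : ℝ} (h1 : -1 < ν) (h0 : ν < 0) {x : ℝ} (hx : 0 < x) :
    nicholsonMixed ν x ^ 2 = (cos (ν * π) / 2) ^ 2 := by
  have h := nicholsonForm_gram ν (besselJ ν) (besselJ (ν + 1)) (besselJ (-ν))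
    (fun x => -besselJ (-ν - 1) x) hx
  rw [nicholsonForm_besselJ h1 h0 hx, nicholsonForm_besselJ_neg h1 h0 hx,
    wronskian_besselJ_besselJ_neg ν hx, ← nicholsonMixed] at h
  have hsin : (π / 4) ^ 2 * (2 * sin (ν * π) / π) ^ 2 = sin (ν * π) ^ 2 / 4 := by
    have := pi_ne_zero
    field_simp
    norm_num
  rw [hsin] at h
  linear_combination -h - sin_sq_add_cos_sq (ν * π) / 4

lemma nicholsonMixed_neg_sub_one (ν x : ℝ) : nicholsonMixed (-ν - 1) x = -nicholsonMixed ν x := by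
  simp only [nicholsonMixed, nicholsonForm]
  rw [nicholsonR_neg_sub_one, show -ν - 1 + 1 = -ν by ring, nicholsonP_neg,
    show -(-ν - 1) = ν + 1 by ring, show -ν - 1 = -(ν + 1) by ring, nicholsonP_neg,
    show ν + 1 - 1 = ν by ring]
  ring

lemma continuous_besselJ_order {x : ℝ} (hx : 0 < x) : Continuous (besselJ · x) :=
  (differentiable_besselJ_order hx).continuous

lemma continuous_nicholsonForm_order {A B A' B' : ℝ → ℝ → ℝ} {x : ℝ} (hx : 0 < x)
    (hA : Continuous (A · x)) (hB : Continuous (B · x)) (hA' : Continuous (A' · x))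
    (hB' : Continuous (B' · x)) :
    Continuous fun ν => nicholsonForm ν (A ν) (B ν) (A' ν) (B' ν) x := by
  have hP := continuous_nicholsonP_order hx
  have hP' : Continuous fun ν => nicholsonP (ν + 1) x := hP.comp (continuous_add_const 1)
  have hR := continuous_nicholsonR_order hx
  unfold nicholsonForm
  fun_prop

lemma continuous_nicholsonMixed {x : ℝ} (hx : 0 < x) : Continuous (nicholsonMixed · x) := by
  have hJ := continuous_besselJ_order hx
  exact continuous_nicholsonForm_order hx hJ (hJ.comp (continuous_add_const 1))
    (hJ.comp continuous_neg) (hJ.comp (continuous_neg.sub continuous_const)).neg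

lemma nicholsonMixed_zero {x : ℝ} (hx : 0 < x) : nicholsonMixed 0 x = 1 / 2 := by
  have hJ := continuous_besselJ_order hx
  have hJ' : Continuous fun ν => besselJ (ν + 1) x := hJ.comp (continuous_add_const 1)
  have hform := ((continuous_nicholsonForm_order hx hJ hJ' hJ hJ').tendsto 0).mono_left
    (nhdsWithin_le_nhds (s := Iio 0))
  have hhalf : ∀ᶠ ν in 𝓝[<] (0 : ℝ), 1 / 2 =
      nicholsonForm ν (besselJ ν) (besselJ (ν + 1)) (besselJ ν) (besselJ (ν + 1)) x := by
    filter_upwards [Ioo_mem_nhdsLT (neg_one_lt_zero (R := ℝ))] with ν hν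
    exact (nicholsonForm_besselJ hν.1 hν.2 hx).symm
  have hJ1 : -besselJ (-1) x = besselJ 1 x := by
    have h := besselJ_add_besselJ_add_two (-1) hx
    norm_num at h
    linarith
  rw [← tendsto_nhds_unique hform (tendsto_const_nhds.congr' hhalf), nicholsonMixed]
  simp only [nicholsonForm, neg_zero, zero_sub, zero_add, hJ1]

lemma nicholsonMixed_eq_of_neg_half_lt {ν : ℝ} (h1 : -(1 / 2) < ν) (h0 : ν < 0) {x : ℝ}
    (hx : 0 < x) : nicholsonMixed ν x = cos (ν * π) / 2 := by
  have hcos (μ : ℝ) (h : -(1 / 2) < μ) (h' : μ < 0) : 0 < cos (μ * π) :=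
    cos_pos_of_mem_Ioo ⟨by nlinarith [pi_pos], by nlinarith [pi_pos]⟩
  refine (sq_eq_sq_iff_eq_or_eq_neg.1 (nicholsonMixed_sq (by linarith) h0 hx)).resolve_right
    fun h => ?_
  -- A continuous square root of `(cos νπ / 2)² > 0` cannot change sign before `ν = 0`.
  have hneg : nicholsonMixed ν x < 0 := by linarith [hcos ν h1 h0]
  have hpos : 0 < nicholsonMixed 0 x := by rw [nicholsonMixed_zero hx]; norm_num
  obtain ⟨μ, hμ, hzero : nicholsonMixed μ x = 0⟩ := intermediate_value_Ioo h0.le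
    (continuous_nicholsonMixed hx).continuousOn ⟨hneg, hpos⟩
  have hsq := nicholsonMixed_sq (by linarith [hμ.1]) hμ.2 hx
  rw [hzero] at hsq
  nlinarith [hcos μ (h1.trans hμ.1) hμ.2]

lemma nicholsonMixed_eq {ν : ℝ} (h1 : -1 < ν) (h0 : ν < 0) {x : ℝ} (hx : 0 < x) :
    nicholsonMixed ν x = cos (ν * π) / 2 := by
  rcases lt_trichotomy ν (-(1 / 2)) with h | rfl | h
  · have hrefl := nicholsonMixed_eq_of_neg_half_lt (ν := -ν - 1) (by linarith) (by linarith) hx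
    rw [nicholsonMixed_neg_sub_one, show (-ν - 1) * π = -(ν * π + π) by ring, cos_neg,
      cos_add_pi] at hrefl
    linarith
  · have hsq := nicholsonMixed_sq h1 h0 hx
    have hcos : cos (-(1 / 2) * π) = 0 := by
      rw [show -(1 / 2) * π = -(π / 2) by ring, cos_neg, cos_pi_div_two]
    rw [hcos] at hsq ⊢
    simpa using hsq
  · exact nicholsonMixed_eq_of_neg_half_lt h h0 hx

lemma notMem_range_intCast_of_lt_of_lt {ν : ℝ} {n : ℤ} (h1 : n < ν) (h2 : ν < n + 1) :
    ν ∉ range ((↑) : ℤ → ℝ) := by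
  rintro ⟨k, rfl⟩
  have hnk : n < k := by exact_mod_cast h1
  have hkn : k < n + 1 := by exact_mod_cast h2
  lia

lemma besselN_eq_nicholsonP_of_neg {ν : ℝ} (h1 : -1 < ν) (h0 : ν < 0) {x : ℝ} (hx : 0 < x) :
    besselN ν x = 8 / π ^ 2 * nicholsonP ν x := by
  have hν : ν ∉ range ((↑) : ℤ → ℝ) :=
    notMem_range_intCast_of_lt_of_lt (n := -1) (by simpa) (by simpa)
  have h := sq_wronskian_mul_nicholsonP ν (besselJ ν) (besselJ (ν + 1)) (besselJ (-ν))
    (fun x => -besselJ (-ν - 1) x) x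
  rw [nicholsonForm_besselJ h1 h0 hx, nicholsonForm_besselJ_neg h1 h0 hx, ← nicholsonMixed,
    nicholsonMixed_eq h1 h0 hx, wronskian_besselJ_besselJ_neg ν hx] at h
  rw [besselN, besselY_of_notMem_range_intCast hν]
  have hsin := sin_mul_pi_ne_zero hν
  have := pi_ne_zero
  field_simp at h ⊢
  linear_combination π ^ 2 * besselJ ν x ^ 2 * sin_sq_add_cos_sq (ν * π) - h

/-- The combination `J_ν J_{ν+1} + Y_ν Y_{ν+1}`, the real part of `H_ν conj(H_{ν+1})` for the
Hankel function `H_ν = J_ν + i Y_ν`. -/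
noncomputable def besselS (ν x : ℝ) : ℝ :=
  besselJ ν x * besselJ (ν + 1) x + besselY ν x * besselY (ν + 1) x

section

variable {ν : ℝ} (hY : IsBesselPair ν (besselY ν) (besselY (ν + 1)))

include hY

lemma hasDerivAt_besselN {x : ℝ} (hx : 0 < x) :
    HasDerivAt (besselN ν) (2 * ν / x * besselN ν x - 2 * besselS ν x) x := by
  refine (((isBesselPair_besselJ ν x hx).1.pow 2).add ((hY x hx).1.pow 2)).congr_deriv ?_
  simp only [besselN, besselS]
  push_cast
  ring

lemma hasDerivAt_besselS {x : ℝ} (hx : 0 < x) :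
    HasDerivAt (besselS ν) (besselN ν x - besselN (ν + 1) x - besselS ν x / x) x := by
  obtain ⟨hJ, hJ'⟩ := isBesselPair_besselJ ν x hx
  obtain ⟨hY, hY'⟩ := hY x hx
  refine ((hJ.mul hJ').add (hY.mul hY')).congr_deriv ?_
  simp only [besselN, besselS]
  ring

variable (hN : ∀ x, 0 < x → besselN ν x = 8 / π ^ 2 * nicholsonP ν x)

include hN

lemma besselS_eq_nicholsonR {x : ℝ} (hx : 0 < x) :
    besselS ν x = 8 / π ^ 2 * nicholsonR ν x := by
  have h := (((hasDerivAt_nicholsonP ν hx).const_mul (8 / π ^ 2)).congr_of_eventuallyEq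
    ((eventually_gt_nhds hx).mono hN)).unique (hasDerivAt_besselN hY hx)
  rw [hN x hx] at h
  linear_combination h / 2

lemma besselN_add_one_eq_nicholsonP {x : ℝ} (hx : 0 < x) :
    besselN (ν + 1) x = 8 / π ^ 2 * nicholsonP (ν + 1) x := by
  have hS (y : ℝ) (hy : 0 < y) := besselS_eq_nicholsonR hY hN hy
  have h := (((hasDerivAt_nicholsonR ν hx).const_mul (8 / π ^ 2)).congr_of_eventuallyEq
    ((eventually_gt_nhds hx).mono hS)).unique (hasDerivAt_besselS hY hx)
  rw [hN x hx, hS x hx] at h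
  linear_combination h

end

lemma besselN_eq_nicholsonP_of_mem_Ioo (n : ℕ) {ν : ℝ} (hν : ν ∈ Ioo (n - 1 : ℝ) n) {x : ℝ}
    (hx : 0 < x) : besselN ν x = 8 / π ^ 2 * nicholsonP ν x := by
  induction n generalizing ν x with
  | zero => exact besselN_eq_nicholsonP_of_neg (by simpa using hν.1) (by simpa using hν.2) hx
  | succ n ih =>
    obtain ⟨h1, h2⟩ := hν
    push_cast at h1 h2
    have hνn : ν - 1 ∈ Ioo (n - 1 : ℝ) n := ⟨by linarith, by linarith⟩
    have hint : ν - 1 ∉ range ((↑) : ℤ → ℝ) :=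
      notMem_range_intCast_of_lt_of_lt (n := n - 1) (by simpa using h1) (by simpa using hνn.2)
    have h := besselN_add_one_eq_nicholsonP (isBesselPair_besselY_of_notMem_range_intCast hint)
      (fun x hx => ih hνn hx) hx
    rwa [sub_add_cancel] at h

/-! ### Nicholson's formula for nonnegative order -/

section

variable {ι : Type*} {l : Filter ι} [l.NeBot] {s : Set ℝ} {f g : ι → ℝ → ℝ} {F G M : ℝ → ℝ}

lemma continuousOn_of_tendsto_of_hasDerivAt (hs : IsOpen s)
    (hf : ∀ᶠ i in l, ∀ x ∈ s, HasDerivAt (f i) (g i x) x)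
    (hfF : ∀ x ∈ s, Tendsto (f · x) l (𝓝 (F x))) (hM : ContinuousOn M s)
    (hgM : ∀ᶠ i in l, ∀ x ∈ s, |g i x| ≤ M x) : ContinuousOn F s := by
  intro x hx
  have hMx : ∀ᶠ y in 𝓝 x, y ∈ s ∧ M y < M x + 1 := (hs.eventually_mem hx).and
    ((hM.continuousAt (hs.mem_nhds hx)).tendsto.eventually_lt_const (lt_add_one _))
  obtain ⟨ε, hε, hball⟩ := Metric.eventually_nhds_iff_ball.1 hMx
  have hlip (y : ℝ) (hy : y ∈ Metric.ball x ε) : ‖F y - F x‖ ≤ (M x + 1) * ‖y - x‖ := by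
    refine le_of_tendsto ((hfF y (hball y hy).1).sub (hfF x hx)).norm ?_
    filter_upwards [hf, hgM] with i hfi hgi
    exact (convex_ball x ε).norm_image_sub_le_of_norm_hasDerivWithin_le
      (fun z hz => (hfi z (hball z hz).1).hasDerivWithinAt)
      (fun z hz => (hgi z (hball z hz).1).trans (hball z hz).2.le) (Metric.mem_ball_self hε) hy
  refine (tendsto_iff_norm_sub_tendsto_zero.2 (squeeze_zero' (.of_forall fun _ => norm_nonneg _)
    (eventually_of_mem (Metric.ball_mem_nhds x hε) hlip) ?_)).mono_left nhdsWithin_le_nhds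
  have hcont : Continuous fun y => (M x + 1) * ‖y - x‖ := by fun_prop
  simpa using hcont.tendsto x

lemma hasDerivAt_of_tendsto_of_dominated [l.IsCountablyGenerated] (hs : IsOpen s)
    (hs' : s.OrdConnected) (hf : ∀ᶠ i in l, ∀ x ∈ s, HasDerivAt (f i) (g i x) x)
    (hg : ∀ᶠ i in l, ContinuousOn (g i) s) (hfF : ∀ x ∈ s, Tendsto (f · x) l (𝓝 (F x)))
    (hgG : ∀ x ∈ s, Tendsto (g · x) l (𝓝 (G x))) (hG : ContinuousOn G s) (hM : ContinuousOn M s)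
    (hgM : ∀ᶠ i in l, ∀ x ∈ s, |g i x| ≤ M x) {x : ℝ} (hx : x ∈ s) : HasDerivAt F (G x) x := by
  have hftc (y : ℝ) (hy : y ∈ s) : F y = F x + ∫ t in x..y, G t := by
    have hsub : uIcc x y ⊆ s := hs'.uIcc_subset hx hy
    have hsub' : uIoc x y ⊆ s := uIoc_subset_uIcc.trans hsub
    have hlim : Tendsto (fun i => ∫ t in x..y, g i t) l (𝓝 (∫ t in x..y, G t)) :=
      intervalIntegral.tendsto_integral_filter_of_dominated_convergence M
        (hg.mono fun i hgi => (hgi.mono hsub').aestronglyMeasurable measurableSet_uIoc)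
        (hgM.mono fun i hgi => .of_forall fun t ht => hgi t (hsub' ht))
        (hM.mono hsub).intervalIntegrable (.of_forall fun t ht => hgG t (hsub' ht))
    have hint : ∀ᶠ i in l, ∫ t in x..y, g i t = f i y - f i x := by
      filter_upwards [hf, hg] with i hfi hgi
      exact intervalIntegral.integral_eq_sub_of_hasDerivAt (fun t ht => hfi t (hsub ht))
        (hgi.mono hsub).intervalIntegrable
    linarith [tendsto_nhds_unique (hlim.congr' hint) ((hfF y hy).sub (hfF x hx))]
  have hderiv := intervalIntegral.integral_hasDerivAt_right (a := x) (b := x) (f := G)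
    IntervalIntegrable.refl
    (hG.stronglyMeasurableAtFilter hs x hx) (hG.continuousAt (hs.mem_nhds hx))
  exact (hderiv.const_add (F x)).congr_of_eventuallyEq
    (eventually_of_mem (hs.mem_nhds hx) hftc)

end

lemma IsBesselPair.continuousOn {ν : ℝ} {A B : ℝ → ℝ} (h : IsBesselPair ν A B) :
    ContinuousOn A (Ioi 0) :=
  fun x hx => (h x hx).1.continuousAt.continuousWithinAt

lemma IsBesselPair.swap {ν : ℝ} {A B : ℝ → ℝ} (h : IsBesselPair ν A B) :
    IsBesselPair (-ν - 1) B (fun x => -A x) :=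
  fun x hx => ⟨(h x hx).2.congr_deriv (by ring), (h x hx).1.neg.congr_deriv (by ring)⟩

section

variable {ι : Type*} {l : Filter ι} [l.NeBot] {ν : ι → ℝ} {A B : ι → ℝ → ℝ}
  {μ : ℝ} {A' B' M : ℝ → ℝ}

lemma continuousOn_const_div_mul_sub (c : ℝ) (hA : ContinuousOn A' (Ioi 0))
    (hB : ContinuousOn B' (Ioi 0)) : ContinuousOn (fun x => c / x * A' x - B' x) (Ioi 0) :=
  ((continuousOn_const.div continuousOn_id fun _ hx => (mem_Ioi.1 hx).ne').mul hA).sub hB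

variable (hpair : ∀ᶠ i in l, IsBesselPair (ν i) (A i) (B i)) (hν : Tendsto ν l (𝓝 μ))
  (hA : ∀ x, 0 < x → Tendsto (A · x) l (𝓝 (A' x))) (hM : ContinuousOn M (Ioi 0))
  (hAM : ∀ᶠ i in l, ∀ x, 0 < x → |A i x| ≤ M x) (hBM : ∀ᶠ i in l, ∀ x, 0 < x → |B i x| ≤ M x)

omit [l.NeBot] in
include hν hAM hBM in
lemma eventually_abs_div_mul_sub_le :
    ∀ᶠ i in l, ∀ x ∈ Ioi 0, |ν i / x * A i x - B i x| ≤ (|μ| + 1) / x * M x + M x := by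
  filter_upwards [hAM, hBM, hν.abs.eventually_le_const (lt_add_one |μ|)] with i hAi hBi hνi x hx
  have hx : 0 < x := hx
  refine (abs_sub _ _).trans (add_le_add ?_ (hBi x hx))
  rw [abs_mul, abs_div, abs_of_pos hx]
  gcongr
  exact hAi x hx

include hpair hν hA hM hAM hBM

lemma IsBesselPair.continuousOn_of_tendsto : ContinuousOn A' (Ioi 0) :=
  continuousOn_of_tendsto_of_hasDerivAt isOpen_Ioi (hpair.mono fun _ hi x hx => (hi x hx).1) hA
    (((continuousOn_const.div continuousOn_id fun _ hx => (mem_Ioi.1 hx).ne').mul hM).add hM)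
    (eventually_abs_div_mul_sub_le hν hAM hBM)

variable [l.IsCountablyGenerated] (hB : ∀ x, 0 < x → Tendsto (B · x) l (𝓝 (B' x)))

include hB

lemma IsBesselPair.hasDerivAt_of_tendsto {x : ℝ} (hx : 0 < x) :
    HasDerivAt A' (μ / x * A' x - B' x) x := by
  have hν' : Tendsto (fun i => -ν i - 1) l (𝓝 (-μ - 1)) := hν.neg.sub_const 1
  have hA' := IsBesselPair.continuousOn_of_tendsto hpair hν hA hM hAM hBM
  have hB' := IsBesselPair.continuousOn_of_tendsto (hpair.mono fun i hi => hi.swap) hν' hB hM hBM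
    (by simpa only [abs_neg] using hAM)
  exact hasDerivAt_of_tendsto_of_dominated isOpen_Ioi ordConnected_Ioi
    (hpair.mono fun _ hi x hx => (hi x hx).1)
    (hpair.mono fun i hi => continuousOn_const_div_mul_sub (ν i) hi.continuousOn
      hi.swap.continuousOn) hA
    (fun x hx => ((hν.div_const x).mul (hA x hx)).sub (hB x hx))
    (continuousOn_const_div_mul_sub μ hA' hB')
    (((continuousOn_const.div continuousOn_id fun _ hx => (mem_Ioi.1 hx).ne').mul hM).add hM)
    (eventually_abs_div_mul_sub_le hν hAM hBM) hx

lemma IsBesselPair.of_tendsto : IsBesselPair μ A' B' := by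
  have hν' : Tendsto (fun i => -ν i - 1) l (𝓝 (-μ - 1)) := hν.neg.sub_const 1
  refine fun x hx => ⟨hasDerivAt_of_tendsto hpair hν hA hM hAM hBM hB hx, ?_⟩
  exact (hasDerivAt_of_tendsto (hpair.mono fun i hi => hi.swap) hν' hB hM hBM
    (by simpa only [abs_neg] using hAM) (fun x hx => (hA x hx).neg) hx).congr_deriv (by ring)

end

lemma nicholsonP_le_of_abs_le {ν μ x : ℝ} (h : |ν| ≤ μ) (hx : 0 < x) :
    nicholsonP ν x ≤ nicholsonP μ x := by
  refine setIntegral_mono_on ((hasModerateGrowth_nicholsonP ν).integrableOn hx)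
    ((hasModerateGrowth_nicholsonP μ).integrableOn hx) measurableSet_Ioi fun y hy => ?_
  have hK := coshMoment_pos 0 (mul_pos (mul_pos two_pos hx) hy)
  have hcosh : cosh (2 * ν * arsinh y) ≤ cosh (2 * μ * arsinh y) :=
    cosh_mul_arsinh_mono (by rw [abs_mul, abs_two]; linarith)
  exact mul_le_mul_of_nonneg_left (div_le_div_of_nonneg_right hcosh (sqrt_nonneg _)) hK.le

lemma continuousOn_nicholsonP (ν : ℝ) : ContinuousOn (nicholsonP ν) (Ioi 0) :=
  fun _ hx => (hasDerivAt_nicholsonP ν hx).continuousAt.continuousWithinAt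

lemma besselN_eq_nicholsonP_of_notMem_range_intCast {ν : ℝ} (h0 : 0 ≤ ν)
    (hν : ν ∉ range ((↑) : ℤ → ℝ)) {x : ℝ} (hx : 0 < x) :
    besselN ν x = 8 / π ^ 2 * nicholsonP ν x := by
  refine besselN_eq_nicholsonP_of_mem_Ioo ⌈ν⌉₊ ⟨?_, (Nat.le_ceil ν).lt_of_ne ?_⟩ hx
  · linarith [Nat.ceil_lt_add_one h0]
  · exact fun h => hν ⟨⌈ν⌉₊, by rw [Int.cast_natCast, ← h]⟩

section

variable (n : ℕ)

lemma eventually_nhdsGT_natCast_notMem_range_intCast :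
    ∀ᶠ ν in 𝓝[>] (n : ℝ), ν ∉ range ((↑) : ℤ → ℝ) := by
  filter_upwards [Ioo_mem_nhdsGT (lt_add_one (n : ℝ))] with ν hν
  exact notMem_range_intCast_of_lt_of_lt (n := n) (by simpa using hν.1) (by simpa using hν.2)

lemma eventually_nhdsGT_besselN_eq_nicholsonP :
    ∀ᶠ ν in 𝓝[>] (n : ℝ), ∀ x, 0 < x → besselN ν x = 8 / π ^ 2 * nicholsonP ν x := by
  filter_upwards [eventually_nhdsGT_natCast_notMem_range_intCast n, self_mem_nhdsWithin]
    with ν hν hn x hx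
  exact besselN_eq_nicholsonP_of_notMem_range_intCast (n.cast_nonneg.trans (mem_Ioi.1 hn).le) hν hx

/-- The numerator of `besselYQuot` is at most `|sin νπ| √N_ν`, and `N_ν` stays bounded as `ν → n` by
Nicholson's formula. -/
lemma besselJ_natCast_mul_cos_sub_besselJ_neg {x : ℝ} (hx : 0 < x) :
    besselJ n x * cos (n * π) - besselJ (-n) x = 0 := by
  have hJ := continuous_besselJ_order hx
  have hnum : Continuous fun ν => (besselJ ν x * cos (ν * π) - besselJ (-ν) x) ^ 2 :=
    ((hJ.mul (by fun_prop)).sub (hJ.comp continuous_neg)).pow 2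
  have hbound : Continuous fun ν => sin (ν * π) ^ 2 * (8 / π ^ 2 * nicholsonP ν x) :=
    Continuous.mul (by fun_prop) (continuous_const.mul (continuous_nicholsonP_order hx))
  have hle : (besselJ n x * cos (n * π) - besselJ (-n) x) ^ 2 ≤
      sin (n * π) ^ 2 * (8 / π ^ 2 * nicholsonP n x) := by
    refine le_of_tendsto_of_tendsto (b := 𝓝[>] (n : ℝ))
      ((hnum.tendsto _).mono_left nhdsWithin_le_nhds)
      ((hbound.tendsto _).mono_left nhdsWithin_le_nhds) ?_
    filter_upwards [eventually_nhdsGT_natCast_notMem_range_intCast n,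
      eventually_nhdsGT_besselN_eq_nicholsonP n] with ν hν hN
    rw [← hN x hx, besselN, besselY_of_notMem_range_intCast hν, mul_add, div_pow,
      mul_div_cancel₀ _ (pow_ne_zero 2 (sin_mul_pi_ne_zero hν))]
    exact le_add_of_nonneg_left (by positivity)
  rw [sin_nat_mul_pi, zero_pow two_ne_zero, zero_mul] at hle
  exact pow_eq_zero_iff two_ne_zero |>.1 (le_antisymm hle (sq_nonneg _))

lemma tendsto_besselYQuot {x : ℝ} (hx : 0 < x) :
    Tendsto (besselYQuot · x) (𝓝[≠] (n : ℝ)) (𝓝 (besselY n x)) := by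
  have hJ := differentiable_besselJ_order hx
  have hnum : Differentiable ℝ fun ν : ℝ => besselJ ν x * cos (ν * π) - besselJ (-ν) x :=
    (hJ.mul (by fun_prop)).sub (hJ.comp differentiable_neg)
  have hsin : HasDerivAt (fun ν : ℝ => sin (ν * π)) (cos (n * π) * π) (n : ℝ) := by
    simpa using ((hasDerivAt_id (n : ℝ)).mul_const π).sin
  have hne : cos (n * π) * π ≠ 0 := by
    rw [cos_nat_mul_pi]
    exact mul_ne_zero (pow_ne_zero _ (by norm_num)) pi_ne_zero
  have hslope := (hasDerivAt_iff_tendsto_slope.1 (hnum n).hasDerivAt).div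
    (hasDerivAt_iff_tendsto_slope.1 hsin) hne
  obtain ⟨L, hL⟩ : ∃ L, Tendsto (besselYQuot · x) (𝓝[≠] (n : ℝ)) (𝓝 L) := by
    refine ⟨_, hslope.congr' (eventually_mem_nhdsWithin.mono fun ν hν => ?_)⟩
    simp only [Pi.div_apply, slope_def_field, besselJ_natCast_mul_cos_sub_besselJ_neg n hx,
      sin_nat_mul_pi, sub_zero, besselYQuot]
    exact div_div_div_cancel_right₀ (sub_ne_zero.2 hν) _ _
  rwa [besselY, if_pos ⟨n, Int.cast_natCast n⟩, hL.limUnder_eq]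

lemma tendsto_besselY_nhdsGT {x : ℝ} (hx : 0 < x) :
    Tendsto (besselY · x) (𝓝[>] (n : ℝ)) (𝓝 (besselY n x)) := by
  refine ((tendsto_besselYQuot n hx).mono_left (nhdsWithin_mono _ fun ν hν => hν.ne')).congr' ?_
  filter_upwards [eventually_nhdsGT_natCast_notMem_range_intCast n] with ν hν
  exact (if_neg hν).symm

lemma tendsto_add_one_nhdsGT : Tendsto (· + 1) (𝓝[>] (n : ℝ)) (𝓝[>] ((n + 1 : ℕ) : ℝ)) := by
  refine tendsto_nhdsWithin_iff.2 ⟨?_, eventually_mem_nhdsWithin.mono fun ν hν => ?_⟩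
  · rw [Nat.cast_succ]
    exact ((continuous_add_const 1).tendsto _).mono_left nhdsWithin_le_nhds
  · rw [Nat.cast_succ]
    exact add_lt_add_left (mem_Ioi.1 hν) 1

lemma tendsto_besselY_add_one_nhdsGT {x : ℝ} (hx : 0 < x) :
    Tendsto (fun ν => besselY (ν + 1) x) (𝓝[>] (n : ℝ)) (𝓝 (besselY (n + 1) x)) := by
  simpa [Function.comp_def] using
    (tendsto_besselY_nhdsGT (n + 1) hx).comp (tendsto_add_one_nhdsGT n)

lemma eventually_nhdsGT_abs_besselY_le {μ : ℝ} (hμ : n < μ) :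
    ∀ᶠ ν in 𝓝[>] (n : ℝ), ∀ x, 0 < x → |besselY ν x| ≤ √(8 / π ^ 2 * nicholsonP μ x) := by
  filter_upwards [eventually_nhdsGT_besselN_eq_nicholsonP n, Ioo_mem_nhdsGT hμ] with ν hN hν x hx
  refine abs_le_sqrt ?_
  have hle : nicholsonP ν x ≤ nicholsonP μ x :=
    nicholsonP_le_of_abs_le ((abs_of_nonneg (n.cast_nonneg.trans hν.1.le)).trans_le hν.2.le) hx
  calc besselY ν x ^ 2 ≤ besselN ν x := le_add_of_nonneg_left (sq_nonneg _)
    _ ≤ 8 / π ^ 2 * nicholsonP μ x := by rw [hN x hx]; gcongr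

lemma isBesselPair_besselY_natCast : IsBesselPair n (besselY n) (besselY (n + 1)) := by
  have hbound := eventually_nhdsGT_abs_besselY_le (n + 1) (μ := n + 2)
    (by push_cast; linarith)
  exact IsBesselPair.of_tendsto (l := 𝓝[>] (n : ℝ)) (ν := id) (A := besselY)
    (B := fun ν => besselY (ν + 1)) (M := fun x => √(8 / π ^ 2 * nicholsonP (n + 2) x))
    ((eventually_nhdsGT_natCast_notMem_range_intCast n).mono fun ν hν =>
      isBesselPair_besselY_of_notMem_range_intCast hν)
    nhdsWithin_le_nhds (fun x hx => tendsto_besselY_nhdsGT n hx)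
    ((continuousOn_const.mul (continuousOn_nicholsonP _)).sqrt)
    (eventually_nhdsGT_abs_besselY_le n (by linarith))
    ((tendsto_add_one_nhdsGT n).eventually hbound)
    fun x hx => tendsto_besselY_add_one_nhdsGT n hx

end

lemma mem_range_natCast_or_notMem_range_intCast {ν : ℝ} (hν : 0 ≤ ν) :
    (∃ n : ℕ, n = ν) ∨ ν ∉ range ((↑) : ℤ → ℝ) := by
  refine or_iff_not_imp_right.2 fun h => ?_
  obtain ⟨n, rfl⟩ := not_not.1 h
  exact ⟨n.toNat, by exact_mod_cast Int.toNat_of_nonneg (by exact_mod_cast hν)⟩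

lemma isBesselPair_besselY {ν : ℝ} (hν : 0 ≤ ν) :
    IsBesselPair ν (besselY ν) (besselY (ν + 1)) := by
  obtain ⟨n, rfl⟩ | h := mem_range_natCast_or_notMem_range_intCast hν
  · exact isBesselPair_besselY_natCast n
  · exact isBesselPair_besselY_of_notMem_range_intCast h

theorem besselN_eq_nicholsonP {ν : ℝ} (hν : 0 ≤ ν) {x : ℝ} (hx : 0 < x) :
    besselN ν x = 8 / π ^ 2 * nicholsonP ν x := by
  obtain ⟨n, rfl⟩ | h := mem_range_natCast_or_notMem_range_intCast hν
  · have hN : Tendsto (besselN · x) (𝓝[>] (n : ℝ)) (𝓝 (besselN n x)) :=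
      (((continuous_besselJ_order hx).tendsto _).mono_left nhdsWithin_le_nhds |>.pow 2).add
        ((tendsto_besselY_nhdsGT n hx).pow 2)
    have hP : Tendsto (fun ν => 8 / π ^ 2 * nicholsonP ν x) (𝓝[>] (n : ℝ))
        (𝓝 (8 / π ^ 2 * nicholsonP n x)) :=
      (((continuous_nicholsonP_order hx).tendsto _).mono_left nhdsWithin_le_nhds).const_mul _
    exact tendsto_nhds_unique_of_eventuallyEq hN hP
      ((eventually_nhdsGT_besselN_eq_nicholsonP n).mono fun ν h => h x hx)
  · exact besselN_eq_nicholsonP_of_notMem_range_intCast hν h hx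

lemma wronskian_besselJ_besselY {ν : ℝ} (hν : 0 ≤ ν) {x : ℝ} (hx : 0 < x) :
    x * (besselJ (ν + 1) x * besselY ν x - besselJ ν x * besselY (ν + 1) x) = 2 / π := by
  obtain ⟨n, rfl⟩ | h := mem_range_natCast_or_notMem_range_intCast hν
  · have hJ := continuous_besselJ_order hx
    have hJ' : Continuous fun μ => besselJ (μ + 1) x := hJ.comp (continuous_add_const 1)
    have hW := ((((hJ'.tendsto n).mono_left nhdsWithin_le_nhds).mul
      (tendsto_besselY_nhdsGT n hx)).sub (((hJ.tendsto n).mono_left nhdsWithin_le_nhds).mul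
      (tendsto_besselY_add_one_nhdsGT n hx))).const_mul x
    exact tendsto_nhds_unique_of_eventuallyEq hW tendsto_const_nhds
      ((eventually_nhdsGT_natCast_notMem_range_intCast n).mono fun μ hμ =>
        wronskian_besselJ_besselY_of_notMem_range_intCast hμ hx)
  · exact wronskian_besselJ_besselY_of_notMem_range_intCast h hx

/-! ### Monotonicity of `N_ν`, `x N_ν(x)` and `N_0(bx) / N_0(x)` -/

lemma besselN_pos {ν : ℝ} (hν : 0 ≤ ν) {x : ℝ} (hx : 0 < x) : 0 < besselN ν x := by
  rw [besselN_eq_nicholsonP hν hx]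
  exact mul_pos (by positivity) (nicholsonP_pos ν hx)

lemma strictAntiOn_nicholsonP (ν : ℝ) : StrictAntiOn (nicholsonP ν) (Ioi 0) := by
  have hP := hasModerateGrowth_nicholsonP ν
  refine strictAntiOn_of_deriv_neg (convex_Ioi 0) (continuousOn_nicholsonP ν) fun x hx => ?_
  rw [interior_Ioi] at hx
  have hyP : HasModerateGrowth 1 fun y => y * (cosh (2 * ν * arsinh y) / √(1 + y ^ 2)) :=
    HasModerateGrowth.id.mul hP
  have hpos := hyP.coshTransform_pos (fun y hy =>
    mul_pos hy (div_pos (cosh_pos _) (by positivity))) hx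
  have hderiv : deriv (nicholsonP ν) x = _ := (hP.hasDerivAt_coshTransform hx).deriv
  rw [hderiv]
  exact neg_neg_of_pos (mul_pos two_pos hpos)

lemma strictAntiOn_besselN {ν : ℝ} (hν : 0 ≤ ν) : StrictAntiOn (besselN ν) (Ioi 0) := by
  intro x hx y hy hxy
  rw [besselN_eq_nicholsonP hν hx, besselN_eq_nicholsonP hν hy]
  exact mul_lt_mul_of_pos_left (strictAntiOn_nicholsonP ν hx hy hxy) (by positivity)

lemma cosh_mul_mul_cosh_le {a s t : ℝ} (ha : 1 ≤ a) (hs : 0 ≤ s) (hst : s ≤ t) :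
    cosh (a * s) * cosh t ≤ cosh (a * t) * cosh s := by
  have cosh_mul_cosh (u v : ℝ) : cosh u * cosh v = (cosh (u + v) + cosh (u - v)) / 2 := by
    rw [cosh_add, cosh_sub]
    ring
  have ht : 0 ≤ t := hs.trans hst
  have hadd : cosh (a * s + t) ≤ cosh (a * t + s) := by
    rw [cosh_le_cosh, abs_of_nonneg (by positivity), abs_of_nonneg (by positivity)]
    nlinarith
  have hsub : cosh (a * s - t) ≤ cosh (a * t - s) := by
    rw [cosh_le_cosh]
    exact (abs_le.2 ⟨by nlinarith, by nlinarith⟩).trans (le_abs_self _)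
  rw [cosh_mul_cosh, cosh_mul_cosh]
  linarith

lemma antitoneOn_mul_nicholsonP {ν : ℝ} (hν : 1 / 2 ≤ ν) :
    AntitoneOn (fun x => x * nicholsonP ν x) (Ioi 0) := by
  have integrable {x : ℝ} (hx : 0 < x) : IntegrableOn (fun y =>
      K₀ (2 * y) * (cosh (2 * ν * arsinh (y / x)) / √(1 + (y / x) ^ 2))) (Ioi 0) := by
    refine Integrable.of_integral_ne_zero ?_
    rw [← mul_coshTransform 0 (fun y => cosh (2 * ν * arsinh y) / √(1 + y ^ 2)) hx]
    exact (mul_pos hx (nicholsonP_pos ν hx)).ne'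
  intro x (hx : 0 < x) z (hz : 0 < z) hxz
  simp only [nicholsonP, mul_coshTransform 0 _ hx, mul_coshTransform 0 _ hz]
  refine setIntegral_mono_on (integrable hz) (integrable hx) measurableSet_Ioi fun y hy => ?_
  have hy : 0 < y := hy
  refine mul_le_mul_of_nonneg_left ?_ (coshMoment_pos 0 (mul_pos two_pos hy)).le
  rw [← cosh_arsinh, ← cosh_arsinh, div_le_div_iff₀ (cosh_pos _) (cosh_pos _)]
  exact cosh_mul_mul_cosh_le (by linarith) (arsinh_nonneg_iff.2 (by positivity))
    (arsinh_le_arsinh.2 (by gcongr))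

lemma antitoneOn_mul_besselN {ν : ℝ} (hν : 1 / 2 ≤ ν) :
    AntitoneOn (fun x => x * besselN ν x) (Ioi 0) := by
  have hν0 : 0 ≤ ν := by linarith
  intro x hx z hz hxz
  simp only [besselN_eq_nicholsonP hν0 hx, besselN_eq_nicholsonP hν0 hz]
  have h : z * nicholsonP ν z ≤ x * nicholsonP ν x := antitoneOn_mul_nicholsonP hν hx hz hxz
  calc z * (8 / π ^ 2 * nicholsonP ν z) = 8 / π ^ 2 * (z * nicholsonP ν z) := by ring
    _ ≤ 8 / π ^ 2 * (x * nicholsonP ν x) := by gcongr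
    _ = x * (8 / π ^ 2 * nicholsonP ν x) := by ring

lemma tendsto_mul_besselN {ν : ℝ} (hν : 0 ≤ ν) :
    Tendsto (fun x => x * besselN ν x) atTop (𝓝 (2 / π)) := by
  have h := (tendsto_mul_nicholsonP ν).const_mul (8 / π ^ 2)
  have hconst : 8 / π ^ 2 * (π / 4) = 2 / π := by
    field_simp
    norm_num
  rw [hconst] at h
  refine h.congr' ((eventually_gt_atTop 0).mono fun x hx => ?_)
  simp only [besselN_eq_nicholsonP hν hx]
  ring

lemma two_div_pi_le_mul_besselN {ν : ℝ} (hν : 1 / 2 ≤ ν) {x : ℝ} (hx : 0 < x) :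
    2 / π ≤ x * besselN ν x := by
  refine le_of_tendsto (tendsto_mul_besselN (by linarith : 0 ≤ ν)) ?_
  filter_upwards [eventually_ge_atTop x] with z hz
  exact antitoneOn_mul_besselN hν hx (mem_Ioi.2 (hx.trans_le hz)) hz

section

variable {α : Type*} [MeasurableSpace α] {μ : Measure α} [SFinite μ] {f₁ f₂ g₁ g₂ : α → ℝ}

/-- Andréief's identity, expanding a double integral of a product of two `2 × 2` determinants. -/
lemma integral_mul_integral_le_of_ae_prod (h11 : Integrable (fun y => f₁ y * g₁ y) μ)
    (h12 : Integrable (fun y => f₁ y * g₂ y) μ) (h21 : Integrable (fun y => f₂ y * g₁ y) μ)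
    (h22 : Integrable (fun y => f₂ y * g₂ y) μ)
    (h : ∀ᵐ p ∂(μ.prod μ), 0 ≤ (f₁ p.1 * f₂ p.2 - f₂ p.1 * f₁ p.2) *
      (g₁ p.1 * g₂ p.2 - g₂ p.1 * g₁ p.2)) :
    (∫ y, f₁ y * g₂ y ∂μ) * (∫ y, f₂ y * g₁ y ∂μ) ≤
      (∫ y, f₁ y * g₁ y ∂μ) * (∫ y, f₂ y * g₂ y ∂μ) := by
  have int_left : Integrable (fun p : α × α => f₁ p.1 * g₁ p.1 * (f₂ p.2 * g₂ p.2) -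
      f₁ p.1 * g₂ p.1 * (f₂ p.2 * g₁ p.2)) (μ.prod μ) := (h11.mul_prod h22).sub (h12.mul_prod h21)
  have int_right : Integrable (fun p : α × α => f₂ p.1 * g₁ p.1 * (f₁ p.2 * g₂ p.2) -
      f₂ p.1 * g₂ p.1 * (f₁ p.2 * g₁ p.2)) (μ.prod μ) := (h21.mul_prod h12).sub (h22.mul_prod h11)
  have expand : (fun p : α × α => (f₁ p.1 * f₂ p.2 - f₂ p.1 * f₁ p.2) *
      (g₁ p.1 * g₂ p.2 - g₂ p.1 * g₁ p.2)) = fun p =>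
      (f₁ p.1 * g₁ p.1 * (f₂ p.2 * g₂ p.2) - f₁ p.1 * g₂ p.1 * (f₂ p.2 * g₁ p.2)) -
      (f₂ p.1 * g₁ p.1 * (f₁ p.2 * g₂ p.2) - f₂ p.1 * g₂ p.1 * (f₁ p.2 * g₁ p.2)) := by
    ext p
    ring
  have hnonneg := integral_nonneg_of_ae h
  rw [expand, integral_sub int_left int_right,
    integral_sub (h11.mul_prod h22) (h12.mul_prod h21),
    integral_sub (h21.mul_prod h12) (h22.mul_prod h11),
    integral_prod_mul (fun y => f₁ y * g₁ y) (fun y => f₂ y * g₂ y),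
    integral_prod_mul (fun y => f₁ y * g₂ y) (fun y => f₂ y * g₁ y),
    integral_prod_mul (fun y => f₂ y * g₁ y) (fun y => f₁ y * g₂ y),
    integral_prod_mul (fun y => f₂ y * g₂ y) (fun y => f₁ y * g₁ y)] at hnonneg
  linarith

lemma setIntegral_mul_setIntegral_le [LinearOrder α] {s : Set α} (hs : MeasurableSet s)
    (h11 : IntegrableOn (fun y => f₁ y * g₁ y) s μ) (h12 : IntegrableOn (fun y => f₁ y * g₂ y) s μ)
    (h21 : IntegrableOn (fun y => f₂ y * g₁ y) s μ) (h22 : IntegrableOn (fun y => f₂ y * g₂ y) s μ)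
    (hf : ∀ y ∈ s, ∀ w ∈ s, y ≤ w → f₁ y * f₂ w ≤ f₂ y * f₁ w)
    (hg : ∀ y ∈ s, ∀ w ∈ s, y ≤ w → g₁ y * g₂ w ≤ g₂ y * g₁ w) :
    (∫ y in s, f₁ y * g₂ y ∂μ) * (∫ y in s, f₂ y * g₁ y ∂μ) ≤
      (∫ y in s, f₁ y * g₁ y ∂μ) * (∫ y in s, f₂ y * g₂ y ∂μ) := by
  refine integral_mul_integral_le_of_ae_prod h11 h12 h21 h22 ?_
  rw [Measure.prod_restrict]
  refine (ae_restrict_iff' (hs.prod hs)).2 (.of_forall fun p hp => ?_)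
  have dets_nonneg (y : α) (hy : y ∈ s) (w : α) (hw : w ∈ s) (hyw : y ≤ w) :
      0 ≤ (f₁ y * f₂ w - f₂ y * f₁ w) * (g₁ y * g₂ w - g₂ y * g₁ w) :=
    mul_nonneg_of_nonpos_of_nonpos (sub_nonpos.2 (hf y hy w hw hyw))
      (sub_nonpos.2 (hg y hy w hw hyw))
  rcases le_total p.1 p.2 with h | h
  · exact dets_nonneg _ hp.1 _ hp.2 h
  · linarith [dets_nonneg _ hp.2 _ hp.1 h]

end

lemma monotoneOn_mul_coshMoment_one_div_coshMoment_zero :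
    MonotoneOn (fun z => z * K₁ z / K₀ z) (Ioi 0) := by
  have hderiv (z : ℝ) (hz : 0 < z) : HasDerivAt (fun z => z * K₁ z / K₀ z)
      (z * (K₁ z ^ 2 - K₀ z ^ 2) / K₀ z ^ 2) z := by
    have hK := coshMoment_pos 0 hz
    refine (((hasDerivAt_id z).mul (hasDerivAt_coshMoment 1 hz)).div (hasDerivAt_coshMoment 0 hz)
      hK.ne').congr_deriv ?_
    simp only [id, Pi.mul_apply, zero_add, one_add_one_eq_two, coshMoment_two hz]
    field_simp
    ring
  refine monotoneOn_of_deriv_nonneg (convex_Ioi 0)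
    (fun z hz => (hderiv z hz).continuousAt.continuousWithinAt)
    (fun z hz => (hderiv z (interior_subset hz)).differentiableAt.differentiableWithinAt)
    fun z hz => ?_
  have hz : 0 < z := interior_subset hz
  rw [(hderiv z hz).deriv]
  have hK := pow_le_pow_left₀ (coshMoment_pos 0 hz).le (coshMoment_le_coshMoment_succ 0 hz) 2
  exact div_nonneg (mul_nonneg hz.le (sub_nonneg.2 hK)) (sq_nonneg _)

lemma antitoneOn_coshMoment_zero_mul_div {p q : ℝ} (hp : 0 < p) (hpq : p ≤ q) :
    AntitoneOn (fun y => K₀ (q * y) / K₀ (p * y)) (Ioi 0) := by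
  have hq : 0 < q := hp.trans_le hpq
  have hderivK (c y : ℝ) (hc : 0 < c) (hy : 0 < y) :
      HasDerivAt (fun y => K₀ (c * y)) (-K₁ (c * y) * c) y := by
    have hlin : HasDerivAt (fun y : ℝ => c * y) c y := by
      simpa using (hasDerivAt_id y).const_mul c
    exact (hasDerivAt_coshMoment 0 (mul_pos hc hy)).comp y hlin
  have hderiv (y : ℝ) (hy : 0 < y) : HasDerivAt (fun y => K₀ (q * y) / K₀ (p * y)) _ y :=
    (hderivK q y hq hy).div (hderivK p y hp hy) (coshMoment_pos 0 (mul_pos hp hy)).ne'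
  refine antitoneOn_of_deriv_nonpos (convex_Ioi 0)
    (fun y hy => (hderiv y hy).continuousAt.continuousWithinAt)
    (fun y hy => (hderiv y (interior_subset hy)).differentiableAt.differentiableWithinAt)
    fun y hy => ?_
  have hy : 0 < y := interior_subset hy
  rw [(hderiv y hy).deriv]
  have hmono := monotoneOn_mul_coshMoment_one_div_coshMoment_zero (mem_Ioi.2 (mul_pos hp hy))
    (mem_Ioi.2 (mul_pos hq hy)) (by gcongr : p * y ≤ q * y)
  simp only [div_le_div_iff₀ (coshMoment_pos 0 (mul_pos hp hy))
    (coshMoment_pos 0 (mul_pos hq hy))] at hmono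
  refine div_nonpos_of_nonpos_of_nonneg (nonpos_of_mul_nonpos_right ?_ hy) (sq_nonneg _)
  linarith

lemma coshTransform_zero_mul_coshTransform_zero_le {p q : ℝ → ℝ} (hp : HasModerateGrowth 0 p)
    (hq : HasModerateGrowth 0 q) (h : ∀ y, 0 < y → ∀ w, y ≤ w → p y * q w ≤ q y * p w) {x z : ℝ}
    (hx : 0 < x) (hxz : x ≤ z) :
    coshTransform 0 q x * coshTransform 0 p z ≤ coshTransform 0 p x * coshTransform 0 q z := by
  have hz : 0 < z := hx.trans_le hxz
  have hx2 : 0 < 2 * x := by positivity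
  refine setIntegral_mul_setIntegral_le measurableSet_Ioi (hp.integrableOn hx)
    (hq.integrableOn hx) (hp.integrableOn hz) (hq.integrableOn hz) (fun y hy w hw hyw => ?_)
    fun y hy w _ => h y hy w
  have hy : 0 < y := hy
  have hw : 0 < w := hw
  have hratio := antitoneOn_coshMoment_zero_mul_div hx2 (by linarith : 2 * x ≤ 2 * z) hy hw hyw
  simp only [div_le_div_iff₀ (coshMoment_pos 0 (mul_pos hx2 hw))
    (coshMoment_pos 0 (mul_pos hx2 hy))] at hratio
  linarith

lemma mul_coshTransform_mul (n : ℕ) (p : ℝ → ℝ) (x : ℝ) {c : ℝ} (hc : 0 < c) :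
    c * coshTransform n p (x * c) = coshTransform n (fun y => p (y / c)) x := by
  have h := integral_comp_mul_left_Ioi' (fun y => coshMoment n (2 * x * y) * p (y / c)) 0 hc
  simp only [mul_zero, mul_div_cancel_left₀ _ hc.ne', ← mul_assoc, smul_eq_mul] at h
  simpa only [coshTransform, ← mul_assoc] using h

lemma hasModerateGrowth_inv_sqrt_one_add_div_sq (c : ℝ) :
    HasModerateGrowth 0 fun y => (√(1 + (y / c) ^ 2))⁻¹ := by
  refine (HasModerateGrowth.const 1).of_abs_le
    (ContinuousOn.inv₀ (by fun_prop) fun y _ => by positivity) fun y _ => ?_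
  rw [abs_one, abs_of_nonneg (by positivity)]
  exact inv_le_one_of_one_le₀ (one_le_sqrt_one_add_sq _)

lemma inv_sqrt_mul_inv_sqrt_le {b y w : ℝ} (hb : 1 ≤ b) (hy : 0 < y) (hyw : y ≤ w) :
    (√(1 + (y / b) ^ 2))⁻¹ * (√(1 + w ^ 2))⁻¹ ≤ (√(1 + y ^ 2))⁻¹ * (√(1 + (w / b) ^ 2))⁻¹ := by
  have hb2 : (b ^ 2)⁻¹ ≤ 1 := inv_le_one_of_one_le₀ (one_le_pow₀ hb)
  have hyw2 : y ^ 2 ≤ w ^ 2 := by gcongr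
  rw [← mul_inv, ← mul_inv, ← sqrt_mul (by positivity), ← sqrt_mul (by positivity)]
  refine inv_anti₀ (by positivity) (sqrt_le_sqrt ?_)
  rw [div_pow, div_pow, div_eq_mul_inv, div_eq_mul_inv]
  nlinarith

lemma nicholsonP_zero_mul_le {b x z : ℝ} (hb : 1 ≤ b) (hx : 0 < x) (hxz : x ≤ z) :
    nicholsonP 0 x * nicholsonP 0 (z * b) ≤ nicholsonP 0 (x * b) * nicholsonP 0 z := by
  have hb0 : 0 < b := one_pos.trans_le hb
  have hP : nicholsonP 0 = coshTransform 0 fun y => (√(1 + y ^ 2))⁻¹ := by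
    ext x
    simp only [nicholsonP, mul_zero, zero_mul, cosh_zero, one_div]
  refine le_of_mul_le_mul_left ?_ hb0
  rw [mul_left_comm, ← mul_assoc b, hP, mul_coshTransform_mul 0 _ z hb0,
    mul_coshTransform_mul 0 _ x hb0]
  exact coshTransform_zero_mul_coshTransform_zero_le (hasModerateGrowth_inv_sqrt_one_add_div_sq b)
    (by simpa using hasModerateGrowth_inv_sqrt_one_add_div_sq 1)
    (fun y hy w => inv_sqrt_mul_inv_sqrt_le hb hy) hx hxz

lemma besselN_zero_mul_div_besselN_zero_le {b x z : ℝ} (hb : 1 ≤ b) (hx : 0 < x) (hxz : x ≤ z) :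
    besselN 0 (z * b) / besselN 0 z ≤ besselN 0 (x * b) / besselN 0 x := by
  have hz : 0 < z := hx.trans_le hxz
  have hb0 : 0 < b := one_pos.trans_le hb
  rw [besselN_eq_nicholsonP le_rfl hx, besselN_eq_nicholsonP le_rfl hz,
    besselN_eq_nicholsonP le_rfl (mul_pos hx hb0), besselN_eq_nicholsonP le_rfl (mul_pos hz hb0),
    mul_div_mul_left _ _ (by positivity), mul_div_mul_left _ _ (by positivity),
    div_le_div_iff₀ (nicholsonP_pos 0 hz) (nicholsonP_pos 0 hx)]
  linarith [nicholsonP_zero_mul_le hb hx hxz]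

/-! ### The phase of `J_ν + i Y_ν` -/

/-- The phase `θ_ν` of `J_ν + i Y_ν`, normalised by `θ_ν(1) = 0`. -/
noncomputable def besselTheta (ν x : ℝ) : ℝ :=
  ∫ s in (1 : ℝ)..x, 2 / (π * (s * besselN ν s))

/-- The Hankel function `J_ν + i Y_ν` of real order and real argument. -/
noncomputable def besselH (ν x : ℝ) : ℂ :=
  besselJ ν x + besselY ν x * Complex.I

section

variable {ν : ℝ} (hν : 0 ≤ ν)

include hν

lemma continuousOn_besselN : ContinuousOn (besselN ν) (Ioi 0) :=
  fun _ hx => (hasDerivAt_besselN (isBesselPair_besselY hν) hx).continuousAt.continuousWithinAt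

lemma two_div_pi_mul_besselN_pos {x : ℝ} (hx : 0 < x) : 0 < 2 / (π * (x * besselN ν x)) :=
  div_pos two_pos (mul_pos pi_pos (mul_pos hx (besselN_pos hν hx)))

lemma hasDerivAt_besselTheta {x : ℝ} (hx : 0 < x) :
    HasDerivAt (besselTheta ν) (2 / (π * (x * besselN ν x))) x := by
  have hcont : ContinuousOn (fun s => 2 / (π * (s * besselN ν s))) (Ioi 0) :=
    continuousOn_const.div
      (continuousOn_const.mul (continuousOn_id.mul (continuousOn_besselN hν)))
      fun s hs => (mul_pos pi_pos (mul_pos hs (besselN_pos hν hs))).ne'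
  refine intervalIntegral.integral_hasDerivAt_right ?_
    (hcont.stronglyMeasurableAtFilter isOpen_Ioi x hx) (hcont.continuousAt (Ioi_mem_nhds hx))
  exact (hcont.mono fun s hs => (lt_min one_pos hx).trans_le hs.1).intervalIntegrable

lemma continuousOn_besselTheta : ContinuousOn (besselTheta ν) (Ioi 0) :=
  fun _ hx => (hasDerivAt_besselTheta hν hx).continuousAt.continuousWithinAt

lemma strictMonoOn_besselTheta : StrictMonoOn (besselTheta ν) (Ioi 0) := by
  refine strictMonoOn_of_deriv_pos (convex_Ioi 0) (continuousOn_besselTheta hν) fun x hx => ?_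
  rw [interior_Ioi] at hx
  rw [(hasDerivAt_besselTheta hν hx).deriv]
  exact two_div_pi_mul_besselN_pos hν hx

lemma exists_besselTheta_sub_eq {x y : ℝ} (hx : 0 < x) (hxy : x < y) :
    ∃ c ∈ Ioo x y,
      besselTheta ν y - besselTheta ν x = 2 / (π * (c * besselN ν c)) * (y - x) := by
  obtain ⟨c, hc, hslope⟩ := exists_hasDerivAt_eq_slope (besselTheta ν)
    (fun c => 2 / (π * (c * besselN ν c))) hxy
    ((continuousOn_besselTheta hν).mono fun s hs => hx.trans_le hs.1)
    fun s hs => hasDerivAt_besselTheta hν (hx.trans hs.1)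
  exact ⟨c, hc, by rw [hslope, div_mul_cancel₀ _ (sub_pos.2 hxy).ne']⟩

end

lemma besselTheta_sub_le {ν : ℝ} (hν : 1 / 2 ≤ ν) {x y : ℝ} (hx : 0 < x) (hxy : x ≤ y) :
    besselTheta ν y - besselTheta ν x ≤ y - x := by
  obtain rfl | hlt := hxy.eq_or_lt
  · simp only [sub_self, le_refl]
  obtain ⟨c, hc, h⟩ := exists_besselTheta_sub_eq (by linarith : 0 ≤ ν) hx hlt
  have hN := two_div_pi_le_mul_besselN hν (hx.trans hc.1)
  rw [h]
  refine mul_le_of_le_one_left (sub_nonneg.2 hxy) ?_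
  rw [← div_div]
  exact div_le_one_of_le₀ hN ((by positivity : 0 ≤ 2 / π).trans hN)

lemma conj_besselH_mul_besselH (ν x : ℝ) :
    starRingEnd ℂ (besselH ν x) * besselH ν x = besselN ν x := by
  rw [← Complex.normSq_eq_conj_mul_self, besselH, Complex.normSq_add_mul_I, besselN]

lemma im_conj_besselH_mul_besselH (ν x y : ℝ) :
    (starRingEnd ℂ (besselH ν x) * besselH ν y).im =
      besselJ ν x * besselY ν y - besselJ ν y * besselY ν x := by
  simp only [besselH, map_add, map_mul, Complex.conj_ofReal, Complex.conj_I, Complex.mul_im,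
    Complex.add_re, Complex.add_im, Complex.mul_re, Complex.ofReal_re, Complex.ofReal_im,
    Complex.neg_re, Complex.neg_im, Complex.I_re, Complex.I_im]
  ring

lemma div_eq_div_of_hasDerivAt_mul_self {f g c : ℝ → ℂ}
    (hf : ∀ x, 0 < x → HasDerivAt f (c x * f x) x) (hg : ∀ x, 0 < x → HasDerivAt g (c x * g x) x)
    (hg0 : ∀ x, 0 < x → g x ≠ 0) {x y : ℝ} (hx : 0 < x) (hy : 0 < y) : f x / g x = f y / g y := by
  have hderiv (z : ℝ) (hz : 0 < z) : HasDerivAt (fun x => f x / g x) 0 z :=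
    ((hf z hz).fun_div (hg z hz) (hg0 z hz)).congr_deriv (by ring)
  exact isOpen_Ioi.is_const_of_deriv_eq_zero isPreconnected_Ioi
    (fun z hz => (hderiv z hz).differentiableAt.differentiableWithinAt)
    (fun z hz => (hderiv z hz).deriv) hx hy

section

variable {ν : ℝ} (hν : 0 ≤ ν)

include hν

lemma conj_besselH_mul_besselH_add_one {x : ℝ} (hx : 0 < x) :
    starRingEnd ℂ (besselH ν x) * besselH (ν + 1) x = besselS ν x - 2 / (π * x) * Complex.I := by
  have hW : 2 / (π * x) = besselJ (ν + 1) x * besselY ν x - besselJ ν x * besselY (ν + 1) x := by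
    rw [← div_div, ← wronskian_besselJ_besselY hν hx, mul_div_cancel_left₀ _ hx.ne']
  have hW' := congrArg ((↑) : ℝ → ℂ) hW
  push_cast at hW'
  rw [hW', besselS, besselH, besselH, map_add, map_mul, Complex.conj_ofReal, Complex.conj_ofReal,
    Complex.conj_I]
  push_cast
  linear_combination -(besselY ν x * besselY (ν + 1) x : ℂ) * Complex.I_sq

lemma hasDerivAt_besselH {x : ℝ} (hx : 0 < x) :
    HasDerivAt (besselH ν) (((ν / x - besselS ν x / besselN ν x : ℝ) +
      (2 / (π * (x * besselN ν x)) : ℝ) * Complex.I) * besselH ν x) x := by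
  have hN : (besselN ν x : ℂ) ≠ 0 := Complex.ofReal_ne_zero.2 (besselN_pos hν hx).ne'
  have hx' : (x : ℂ) ≠ 0 := Complex.ofReal_ne_zero.2 hx.ne'
  have hπ : (π : ℂ) ≠ 0 := Complex.ofReal_ne_zero.2 pi_ne_zero
  have hnext : besselH (ν + 1) x =
      besselH ν x * (besselS ν x - 2 / (π * x) * Complex.I) / besselN ν x := by
    rw [eq_div_iff hN, ← conj_besselH_mul_besselH_add_one hν hx, ← conj_besselH_mul_besselH]
    ring
  have hrec : HasDerivAt (besselH ν) (ν / x * besselH ν x - besselH (ν + 1) x) x := by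
    refine (((isBesselPair_besselJ ν x hx).1.ofReal_comp).add
      ((isBesselPair_besselY hν x hx).1.ofReal_comp.mul_const Complex.I)).congr_deriv ?_
    simp only [besselH]
    push_cast
    ring
  refine hrec.congr_deriv ?_
  rw [hnext]
  push_cast
  field_simp
  ring

lemma hasDerivAt_sqrt_besselN {x : ℝ} (hx : 0 < x) :
    HasDerivAt (fun x => √(besselN ν x))
      ((ν / x - besselS ν x / besselN ν x) * √(besselN ν x)) x := by
  have hN := besselN_pos hν hx
  refine ((hasDerivAt_besselN (isBesselPair_besselY hν) hx).sqrt hN.ne').congr_deriv ?_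
  rw [div_eq_iff (mul_pos two_pos (sqrt_pos.2 hN)).ne']
  linear_combination -2 * (ν / x - besselS ν x / besselN ν x) * sq_sqrt hN.le +
    2 * div_mul_cancel₀ (besselS ν x) hN.ne'

lemma hasDerivAt_sqrt_besselN_mul_exp {x : ℝ} (hx : 0 < x) :
    HasDerivAt (fun x => (√(besselN ν x) : ℂ) * Complex.exp (besselTheta ν x * Complex.I))
      (((ν / x - besselS ν x / besselN ν x : ℝ) +
        (2 / (π * (x * besselN ν x)) : ℝ) * Complex.I) *
        ((√(besselN ν x) : ℂ) * Complex.exp (besselTheta ν x * Complex.I))) x := by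
  refine ((hasDerivAt_sqrt_besselN hν hx).ofReal_comp.mul
    ((hasDerivAt_besselTheta hν hx).ofReal_comp.mul_const Complex.I).cexp).congr_deriv ?_
  push_cast
  ring

lemma conj_besselH_mul_besselH_eq {x y : ℝ} (hx : 0 < x) (hy : 0 < y) :
    starRingEnd ℂ (besselH ν x) * besselH ν y = (√(besselN ν x) * √(besselN ν y) : ℝ) *
      Complex.exp ((besselTheta ν y - besselTheta ν x : ℝ) * Complex.I) := by
  have hsqrt {z : ℝ} (hz : 0 < z) : (√(besselN ν z) : ℂ) ≠ 0 :=
    Complex.ofReal_ne_zero.2 (sqrt_pos.2 (besselN_pos hν hz)).ne'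
  have hpolar {z : ℝ} (hz : 0 < z) :
      (√(besselN ν z) : ℂ) * Complex.exp (besselTheta ν z * Complex.I) ≠ 0 :=
    mul_ne_zero (hsqrt hz) (Complex.exp_ne_zero _)
  have hratio := div_eq_div_of_hasDerivAt_mul_self (fun z hz => hasDerivAt_besselH hν hz)
    (fun z hz => hasDerivAt_sqrt_besselN_mul_exp hν hz) (fun z hz => hpolar hz) hy hx
  have hN : (besselN ν x : ℂ) = √(besselN ν x) * √(besselN ν x) := by
    rw [← Complex.ofReal_mul, mul_self_sqrt (besselN_pos hν hx).le]
  rw [div_eq_iff (hpolar hy)] at hratio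
  rw [hratio, Complex.ofReal_sub, sub_mul, Complex.exp_sub, ← mul_assoc, ← mul_div_assoc,
    conj_besselH_mul_besselH, hN, Complex.ofReal_mul]
  have hx' := hsqrt hx
  have hexp := Complex.exp_ne_zero (besselTheta ν x * Complex.I)
  field_simp

lemma besselJ_mul_besselY_sub {x y : ℝ} (hx : 0 < x) (hy : 0 < y) :
    besselJ ν x * besselY ν y - besselJ ν y * besselY ν x =
      √(besselN ν x) * √(besselN ν y) * sin (besselTheta ν y - besselTheta ν x) := by
  rw [← im_conj_besselH_mul_besselH, conj_besselH_mul_besselH_eq hν hx hy, Complex.im_ofReal_mul,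
    Complex.exp_ofReal_mul_I_im]

end

lemma besselU_eq {b ν ρ t : ℝ} (hν : 0 ≤ ν) (hb : 0 < b) (hρ : 0 < ρ) (ht : 0 < t) :
    besselU b ν ρ t = √(besselN ν (ρ * t)) * √(besselN ν (ρ * b)) *
      sin (besselTheta ν (ρ * b) - besselTheta ν (ρ * t)) :=
  besselJ_mul_besselY_sub hν (mul_pos hρ ht) (mul_pos hρ hb)

lemma nonneg_of_hasDerivAt_neg {A : ℝ → ℝ} {d x₀ x₁ : ℝ} (h : HasDerivAt A (-d) x₁)
    (hx : x₀ < x₁) (hA : ∀ x ∈ Ioo x₀ x₁, 0 < A x) (hA₁ : A x₁ = 0) : 0 ≤ d := by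
  refine neg_nonpos.1 (le_of_tendsto (h.tendsto_slope.mono_left (nhdsLT_le_nhdsNE x₁)) ?_)
  filter_upwards [Ioo_mem_nhdsLT hx] with x hx
  rw [slope_def_field, hA₁, sub_zero]
  exact (div_neg_of_pos_of_neg (hA x hx) (sub_neg.2 hx.2)).le

lemma IsBesselPair.hasDerivAt_rpow_mul_exp_mul {ν : ℝ} {A B : ℝ → ℝ} (h : IsBesselPair ν A B)
    (hν : ν + 1 ≠ 0) {x : ℝ} (hx : 0 < x) :
    HasDerivAt
      (fun x => x ^ ν * exp (-x ^ 2 / (2 * (ν + 1))) * (x ^ 2 * A x / (ν + 1) - x * B x))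
      (x ^ ν * exp (-x ^ 2 / (2 * (ν + 1))) *
        (x * A x / (ν + 1) * (ν + 1 - x ^ 2 / (ν + 1)))) x := by
  obtain ⟨hA, hB⟩ := h x hx
  have hexp := ((hasDerivAt_pow 2 x).fun_neg.div_const (2 * (ν + 1))).exp
  have hpair := (((hasDerivAt_pow 2 x).fun_mul hA).div_const (ν + 1)).fun_sub
    ((hasDerivAt_id x).fun_mul hB)
  refine (((hasDerivAt_rpow_const (p := ν) (.inl hx.ne')).fun_mul hexp).fun_mul
    hpair).congr_deriv ?_
  rw [rpow_sub_one hx.ne', id]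
  field_simp
  ring

/-- Sturm comparison with `v = x^ν e^{-x²/(2(ν+1))}`, which is a supersolution of Bessel's equation
on `(0, ν + 1]`: the function that increases there is `x` times the Wronskian of `v` and `A`. -/
lemma IsBesselPair.add_one_lt_of_eq_zero {ν : ℝ} {A B : ℝ → ℝ} (h : IsBesselPair ν A B)
    (hν : -1 < ν) {x₀ x₁ : ℝ} (h0 : 0 < x₀) (h01 : x₀ < x₁) (hA₀ : A x₀ = 0) (hB₀ : B x₀ < 0)
    (hA : ∀ x ∈ Ioo x₀ x₁, 0 < A x) (hA₁ : A x₁ = 0) : ν + 1 < x₁ := by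
  have h1 : 0 < x₁ := h0.trans h01
  have hn : 0 < ν + 1 := by linarith
  have hB₁ : 0 ≤ B x₁ :=
    nonneg_of_hasDerivAt_neg (by simpa [hA₁] using (h x₁ h1).1) h01 hA hA₁
  by_contra! hle
  have hderiv {x : ℝ} (hx : 0 < x) := h.hasDerivAt_rpow_mul_exp_mul hn.ne' hx
  have hmono : MonotoneOn (fun x => x ^ ν * exp (-x ^ 2 / (2 * (ν + 1))) *
      (x ^ 2 * A x / (ν + 1) - x * B x)) (Icc x₀ x₁) := by
    refine monotoneOn_of_deriv_nonneg (convex_Icc _ _)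
      (fun x hx => (hderiv (h0.trans_le hx.1)).continuousAt.continuousWithinAt)
      (fun x hx => ?_) fun x hx => ?_
    all_goals
      rw [interior_Icc] at hx
      have hx0 : 0 < x := h0.trans hx.1
    · exact (hderiv hx0).differentiableAt.differentiableWithinAt
    · have hAx := hA x hx
      have hfactor : 0 ≤ ν + 1 - x ^ 2 / (ν + 1) := by
        rw [sub_nonneg, div_le_iff₀ hn]
        nlinarith [hx.2]
      rw [(hderiv hx0).deriv]
      positivity
  have hends := hmono (left_mem_Icc.2 h01.le) (right_mem_Icc.2 h01.le) h01.le
  simp only [hA₀, hA₁, mul_zero, zero_div, zero_sub, mul_neg, neg_le_neg_iff] at hends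
  have hpos₀ : 0 < x₀ ^ ν * exp (-x₀ ^ 2 / (2 * (ν + 1))) * (x₀ * -B x₀) := by
    have := neg_pos.2 hB₀
    positivity
  have hnonneg₁ : 0 ≤ x₁ ^ ν * exp (-x₁ ^ 2 / (2 * (ν + 1))) * (x₁ * B x₁) := by positivity
  linarith

lemma add_one_lt_of_besselTheta_sub_eq_pi {ν : ℝ} (hν : 0 ≤ ν) {x₀ x₁ : ℝ} (h0 : 0 < x₀)
    (h01 : x₀ < x₁) (h : besselTheta ν x₁ - besselTheta ν x₀ = π) : ν + 1 < x₁ := by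
  have h1 : 0 < x₁ := h0.trans h01
  have hpair := (isBesselPair_besselY hν).linear_combination (isBesselPair_besselJ ν)
    (besselJ ν x₀) (-besselY ν x₀)
  have hA {x : ℝ} (hx : 0 < x) : besselJ ν x₀ * besselY ν x + -besselY ν x₀ * besselJ ν x =
      √(besselN ν x₀) * √(besselN ν x) * sin (besselTheta ν x - besselTheta ν x₀) := by
    rw [← besselJ_mul_besselY_sub hν h0 hx]
    ring
  refine hpair.add_one_lt_of_eq_zero (by linarith) h0 h01 (by ring) ?_ (fun x hx => ?_) ?_
  · have hW := wronskian_besselJ_besselY hν h0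
    have : 0 < 2 / π := by positivity
    refine neg_pos.1 (pos_of_mul_pos_right (a := x₀) ?_ h0.le)
    linarith
  · have hx0 : 0 < x := h0.trans hx.1
    have hleft := strictMonoOn_besselTheta hν h0 hx0 hx.1
    have hright := strictMonoOn_besselTheta hν hx0 h1 hx.2
    rw [hA hx0]
    exact mul_pos (mul_pos (sqrt_pos.2 (besselN_pos hν h0)) (sqrt_pos.2 (besselN_pos hν hx0)))
      (sin_pos_of_pos_of_lt_pi (by linarith) (by linarith))
  · rw [hA h1, h, sin_pi, mul_zero]

lemma exists_besselTheta_sub_eq_pi {ν : ℝ} (hν : 0 ≤ ν) {x₀ y : ℝ} (h0 : 0 < x₀) (hy : x₀ < y)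
    (h : π ≤ besselTheta ν y - besselTheta ν x₀) :
    ∃ x₁ ∈ Ioc x₀ y, besselTheta ν x₁ - besselTheta ν x₀ = π := by
  obtain ⟨x₁, ⟨h01, h1y⟩, hx₁⟩ := intermediate_value_Icc hy.le
    (f := fun x => besselTheta ν x - besselTheta ν x₀)
    (((continuousOn_besselTheta hν).mono fun s hs => h0.trans_le hs.1).sub continuousOn_const)
    ⟨by simpa only [sub_self] using pi_pos.le, h⟩
  refine ⟨x₁, ⟨h01.lt_of_ne ?_, h1y⟩, hx₁⟩
  rintro rfl
  exact pi_ne_zero (by simpa using hx₁.symm)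

/-! ### The zeros of `U_ν(·, 1)` -/

/-- The phase difference `θ_ν(ρb) - θ_ν(ρ)`, whose positive integer multiples of `π` are attained
exactly at the positive zeros of `U_ν(·, 1)`. -/
noncomputable def besselPhase (b ν ρ : ℝ) : ℝ := besselTheta ν (ρ * b) - besselTheta ν ρ

lemma besselPhase_zero (b ν : ℝ) : besselPhase b ν 0 = 0 := by
  rw [besselPhase, zero_mul, sub_self]

section

variable {b ν : ℝ} (hν : 0 ≤ ν) (hb : 1 < b)

include hν hb

lemma hasDerivAt_besselPhase {ρ : ℝ} (hρ : 0 < ρ) :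
    HasDerivAt (besselPhase b ν)
      (2 / (π * ρ) * ((besselN ν (ρ * b))⁻¹ - (besselN ν ρ)⁻¹)) ρ := by
  have hρb : 0 < ρ * b := mul_pos hρ (one_pos.trans hb)
  refine (((hasDerivAt_besselTheta hν hρb).comp ρ ((hasDerivAt_id ρ).mul_const b)).sub
    (hasDerivAt_besselTheta hν hρ)).congr_deriv ?_
  have hN := besselN_pos hν hρ
  have hNb := besselN_pos hν hρb
  have : 0 < b := one_pos.trans hb
  field_simp

lemma besselPhase_pos {ρ : ℝ} (hρ : 0 < ρ) : 0 < besselPhase b ν ρ :=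
  have hlt : ρ < ρ * b := lt_mul_of_one_lt_right hρ hb
  sub_pos.2 (strictMonoOn_besselTheta hν hρ (hρ.trans hlt) hlt)

lemma strictMonoOn_besselPhase : StrictMonoOn (besselPhase b ν) (Ici 0) := by
  have hpos : StrictMonoOn (besselPhase b ν) (Ioi 0) := by
    refine strictMonoOn_of_deriv_pos (convex_Ioi 0) (fun ρ hρ =>
      (hasDerivAt_besselPhase hν hb hρ).continuousAt.continuousWithinAt) fun ρ hρ => ?_
    rw [interior_Ioi] at hρ
    have hρ : 0 < ρ := hρ
    have hlt : ρ < ρ * b := lt_mul_of_one_lt_right hρ hb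
    rw [(hasDerivAt_besselPhase hν hb hρ).deriv]
    exact mul_pos (by positivity) (sub_pos.2 (inv_strictAnti₀ (besselN_pos hν (hρ.trans hlt))
      (strictAntiOn_besselN hν hρ (hρ.trans hlt) hlt)))
  intro x (hx : 0 ≤ x) y _ hxy
  obtain rfl | hx := hx.eq_or_lt
  · rw [besselPhase_zero]
    exact besselPhase_pos hν hb hxy
  · exact hpos hx (hx.trans hxy) hxy

lemma tendsto_besselPhase_div : Tendsto (fun ρ => besselPhase b ν ρ / ρ) atTop (𝓝 (b - 1)) := by
  have hderiv : Tendsto (fun c => 2 / (π * (c * besselN ν c))) atTop (𝓝 1) := by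
    have h := tendsto_const_nhds (x := (2 : ℝ)).div ((tendsto_mul_besselN hν).const_mul π)
      (by positivity)
    rwa [mul_div_cancel₀ _ pi_ne_zero, div_self two_ne_zero] at h
  have hmean (ρ : ℝ) : ∃ c, 0 < ρ → ρ < c ∧
      besselPhase b ν ρ / ρ = 2 / (π * (c * besselN ν c)) * (b - 1) := by
    by_cases hρ : 0 < ρ
    · obtain ⟨c, hc, h⟩ := exists_besselTheta_sub_eq hν hρ (lt_mul_of_one_lt_right hρ hb)
      refine ⟨c, fun _ => ⟨hc.1, ?_⟩⟩
      rw [besselPhase, h, div_eq_iff hρ.ne']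
      ring
    · exact ⟨0, fun h => absurd h hρ⟩
  choose c hc using hmean
  have hc_tendsto : Tendsto c atTop atTop :=
    tendsto_atTop_mono' _ ((eventually_gt_atTop 0).mono fun ρ hρ => (hc ρ hρ).1.le) tendsto_id
  have h := (hderiv.comp hc_tendsto).mul_const (b - 1)
  rw [one_mul] at h
  exact h.congr' ((eventually_gt_atTop 0).mono fun ρ hρ => (hc ρ hρ).2.symm)

lemma tendsto_besselPhase_atTop : Tendsto (besselPhase b ν) atTop atTop :=
  ((tendsto_besselPhase_div hν hb).pos_mul_atTop (sub_pos.2 hb) tendsto_id).congr'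
    ((eventually_gt_atTop 0).mono fun _ hρ => div_mul_cancel₀ _ hρ.ne')

lemma besselPhase_lt_pi {ρ : ℝ} (hρ : 0 < ρ) (h : ρ * b ≤ ν + 1) : besselPhase b ν ρ < π := by
  by_contra! hπ
  obtain ⟨x, hx, hxπ⟩ := exists_besselTheta_sub_eq_pi hν hρ (lt_mul_of_one_lt_right hρ hb) hπ
  linarith [add_one_lt_of_besselTheta_sub_eq_pi hν hρ hx.1 hxπ, hx.2]

lemma exists_besselPhase_eq {y : ℝ} (hy : π ≤ y) : ∃ ρ, 0 < ρ ∧ besselPhase b ν ρ = y := by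
  have hb0 : 0 < b := one_pos.trans hb
  have hr : 0 < (ν + 1) / b := by positivity
  have hlow := besselPhase_lt_pi hν hb hr (div_mul_cancel₀ _ hb0.ne').le
  obtain ⟨R, hhigh, hrR⟩ := (((tendsto_besselPhase_atTop hν hb).eventually_ge_atTop y).and
    (eventually_ge_atTop ((ν + 1) / b))).exists
  obtain ⟨ρ, hρ, h⟩ := intermediate_value_Icc hrR (f := besselPhase b ν)
    (fun ρ hρ => (hasDerivAt_besselPhase hν hb
      (hr.trans_le hρ.1)).continuousAt.continuousWithinAt) ⟨hlow.le.trans hy, hhigh⟩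
  exact ⟨ρ, hr.trans_le hρ.1, h⟩

lemma besselU_one_eq_zero_iff {ρ : ℝ} (hρ : 0 < ρ) :
    besselU b ν ρ 1 = 0 ↔ ∃ m : ℕ, 1 ≤ m ∧ besselPhase b ν ρ = m * π := by
  have hb0 : 0 < b := one_pos.trans hb
  have hN : √(besselN ν ρ) * √(besselN ν (ρ * b)) ≠ 0 := (mul_pos
    (sqrt_pos.2 (besselN_pos hν hρ)) (sqrt_pos.2 (besselN_pos hν (mul_pos hρ hb0)))).ne'
  have hpos := besselPhase_pos hν hb hρ
  rw [besselU_eq hν hb0 hρ one_pos, mul_one, mul_eq_zero, or_iff_right hN, ← besselPhase,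
    sin_eq_zero_iff]
  constructor
  · rintro ⟨n, hn⟩
    rw [← hn] at hpos
    lift n to ℕ using (by exact_mod_cast (pos_of_mul_pos_left hpos pi_pos.le).le)
    have hn0 : (0 : ℝ) < n := by exact_mod_cast pos_of_mul_pos_left hpos pi_pos.le
    exact ⟨n, by exact_mod_cast hn0, by exact_mod_cast hn.symm⟩
  · rintro ⟨m, -, hm⟩
    exact ⟨m, by exact_mod_cast hm.symm⟩

/-- Also for the dummy value `ρ_{ν,0} = 0`, since `besselPhase b ν 0 = 0`. -/
lemma besselRho_nonneg_and_besselPhase_besselRho (m : ℕ) :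
    0 ≤ besselRho b ν m ∧ besselPhase b ν (besselRho b ν m) = m * π := by
  have hmono := strictMonoOn_besselPhase hν hb
  induction m with
  | zero => simp [besselRho, besselPhase_zero]
  | succ m ih =>
    obtain ⟨ρ, hρ, hphase⟩ := exists_besselPhase_eq hν hb (y := (m + 1 : ℕ) * π)
      (le_mul_of_one_le_left pi_pos.le (by exact_mod_cast m.succ_pos))
    have hleast : IsLeast {r | besselRho b ν m < r ∧ besselU b ν r 1 = 0} ρ := by
      refine ⟨⟨(hmono.lt_iff_lt ih.1 hρ.le).1 ?_,
        (besselU_one_eq_zero_iff hν hb hρ).2 ⟨m + 1, m.succ_pos, hphase⟩⟩, ?_⟩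
      · rw [ih.2, hphase]
        exact mul_lt_mul_of_pos_right (by exact_mod_cast m.lt_succ_self) pi_pos
      · rintro r ⟨hr, hU⟩
        have hr0 : 0 < r := ih.1.trans_lt hr
        obtain ⟨k, -, hk⟩ := (besselU_one_eq_zero_iff hν hb hr0).1 hU
        have hlt : m * π < k * π := by
          rw [← ih.2, ← hk]
          exact hmono ih.1 hr0.le hr
        have hmk : m < k := by exact_mod_cast lt_of_mul_lt_mul_right hlt pi_pos.le
        refine (hmono.le_iff_le hρ.le hr0.le).1 ?_
        rw [hphase, hk]
        exact mul_le_mul_of_nonneg_right (by exact_mod_cast hmk) pi_pos.le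
    rw [besselRho, hleast.csInf_eq]
    exact ⟨hρ.le, hphase⟩

lemma besselPhase_besselRho (m : ℕ) : besselPhase b ν (besselRho b ν m) = m * π :=
  (besselRho_nonneg_and_besselPhase_besselRho hν hb m).2

lemma strictMono_besselRho : StrictMono (besselRho b ν) := by
  have hnonneg (m : ℕ) : besselRho b ν m ∈ Ici 0 :=
    (besselRho_nonneg_and_besselPhase_besselRho hν hb m).1
  intro m n hmn
  refine ((strictMonoOn_besselPhase hν hb).lt_iff_lt (hnonneg m) (hnonneg n)).1 ?_
  rw [besselPhase_besselRho hν hb, besselPhase_besselRho hν hb]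
  exact mul_lt_mul_of_pos_right (by exact_mod_cast hmn) pi_pos

lemma besselRho_pos {m : ℕ} (hm : 1 ≤ m) : 0 < besselRho b ν m :=
  strictMono_besselRho hν hb hm

lemma besselU_besselRho_one {m : ℕ} (hm : 1 ≤ m) : besselU b ν (besselRho b ν m) 1 = 0 :=
  (besselU_one_eq_zero_iff hν hb (besselRho_pos hν hb hm)).2
    ⟨m, hm, besselPhase_besselRho hν hb m⟩

lemma image_besselRho : besselRho b ν '' Ici 1 = {ρ | 0 < ρ ∧ besselU b ν ρ 1 = 0} := by
  ext ρ
  constructor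
  · rintro ⟨m, hm, rfl⟩
    exact ⟨besselRho_pos hν hb hm, besselU_besselRho_one hν hb hm⟩
  · rintro ⟨hρ, hU⟩
    obtain ⟨m, hm, hphase⟩ := (besselU_one_eq_zero_iff hν hb hρ).1 hU
    exact ⟨m, hm, (strictMonoOn_besselPhase hν hb).injOn (besselRho_pos hν hb hm).le hρ.le
      ((besselPhase_besselRho hν hb m).trans hphase.symm)⟩

lemma tendsto_besselRho_atTop : Tendsto (besselRho b ν) atTop atTop := by
  refine tendsto_atTop.2 fun R => ?_
  have hmπ : Tendsto (fun m : ℕ => m * π) atTop atTop :=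
    tendsto_natCast_atTop_atTop.atTop_mul_const pi_pos
  filter_upwards [hmπ.eventually_ge_atTop (besselPhase b ν (max R 0))] with m hm
  rw [← besselPhase_besselRho hν hb m, (strictMonoOn_besselPhase hν hb).le_iff_le
    (mem_Ici.2 (le_max_right R 0)) (besselRho_nonneg_and_besselPhase_besselRho hν hb m).1] at hm
  exact (le_max_left R 0).trans hm

lemma tendsto_besselRho_div :
    Tendsto (fun m : ℕ => besselRho b ν m / m) atTop (𝓝 (π / (b - 1))) := by
  have h := tendsto_const_nhds (x := π).div
    ((tendsto_besselPhase_div hν hb).comp (tendsto_besselRho_atTop hν hb)) (sub_pos.2 hb).ne'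
  refine h.congr fun m => ?_
  simp only [Pi.div_apply, Function.comp, besselPhase_besselRho hν hb]
  have := pi_ne_zero
  field_simp

end

lemma lt_besselRho {b ν : ℝ} (hν : 1 / 2 ≤ ν) (hb : 1 < b) {m : ℕ} (hm : 1 ≤ m) :
    1 / b * (ν + m / 4) < besselRho b ν m := by
  have hν0 : 0 ≤ ν := by linarith
  have hρ := besselRho_pos hν0 hb hm
  have hphase := besselPhase_besselRho hν0 hb m
  set ρ := besselRho b ν m
  have hm1 : (1 : ℝ) ≤ m := by exact_mod_cast hm
  obtain ⟨x, hx, hπ⟩ := exists_besselTheta_sub_eq_pi hν0 hρ (lt_mul_of_one_lt_right hρ hb)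
    ((le_mul_of_one_le_left pi_pos.le hm1).trans_eq hphase.symm)
  have hfirst := add_one_lt_of_besselTheta_sub_eq_pi hν0 hρ hx.1 hπ
  have hrest : m * π - π ≤ ρ * b - x := by
    rw [← hphase, ← hπ, besselPhase, sub_sub_sub_cancel_right]
    exact besselTheta_sub_le hν (hρ.trans hx.1) hx.2
  rw [one_div, inv_mul_lt_iff₀ (one_pos.trans hb)]
  nlinarith [pi_gt_three]

/-! ### Lommel's integral -/

lemma IsBesselPair.hasDerivAt_lommel {ν : ℝ} {A B : ℝ → ℝ} (h : IsBesselPair ν A B) {x : ℝ}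
    (hx : 0 < x) :
    HasDerivAt (fun x => (ν * A x - x * B x) ^ 2 + (x ^ 2 - ν ^ 2) * A x ^ 2)
      (2 * (A x ^ 2 * x)) x := by
  obtain ⟨hA, hB⟩ := h x hx
  have hsq := ((hA.const_mul ν).fun_sub ((hasDerivAt_id x).fun_mul hB)).fun_pow 2
  refine (hsq.fun_add (((hasDerivAt_pow 2 x).sub_const (ν ^ 2)).fun_mul
    (hA.fun_pow 2))).congr_deriv ?_
  simp only [id]
  field_simp
  ring

lemma IsBesselPair.two_mul_integral_sq_mul {ν : ℝ} {A B : ℝ → ℝ} (h : IsBesselPair ν A B)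
    {x y : ℝ} (hx : 0 < x) (hy : 0 < y) (hAx : A x = 0) (hAy : A y = 0) :
    2 * ∫ s in x..y, A s ^ 2 * s = (y * B y) ^ 2 - (x * B x) ^ 2 := by
  have hpos : uIcc x y ⊆ Ioi 0 := ordConnected_Ioi.uIcc_subset hx hy
  have hint : IntervalIntegrable (fun s => 2 * (A s ^ 2 * s)) volume x y :=
    ((((h.continuousOn.pow 2).mul continuousOn_id).mono hpos).intervalIntegrable).const_mul 2
  rw [← intervalIntegral.integral_const_mul, intervalIntegral.integral_eq_sub_of_hasDerivAt
    (fun s hs => h.hasDerivAt_lommel (hpos hs)) hint, hAx, hAy]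
  ring

/-! ### The size of a solution before its first zero -/

section

variable {ν : ℝ} {A B : ℝ → ℝ} (h : IsBesselPair ν A B)

include h

lemma IsBesselPair.hasDerivAt_rpow_neg_mul {x : ℝ} (hx : 0 < x) :
    HasDerivAt (fun x => x ^ (-ν) * (2 * ν * A x - x * B x)) (-(x ^ (-ν) * (x * A x))) x := by
  obtain ⟨hA, hB⟩ := h x hx
  refine ((hasDerivAt_rpow_const (p := -ν) (.inl hx.ne')).fun_mul
    ((hA.const_mul (2 * ν)).fun_sub ((hasDerivAt_id x).fun_mul hB))).congr_deriv ?_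
  rw [rpow_sub_one hx.ne', id]
  field_simp
  ring

lemma IsBesselPair.hasDerivAt_rpow_mul {x : ℝ} (hx : 0 < x) :
    HasDerivAt (fun x => x ^ ν * A x)
      (x ^ (2 * ν) / x * (x ^ (-ν) * (2 * ν * A x - x * B x))) x := by
  refine ((hasDerivAt_rpow_const (p := ν) (.inl hx.ne')).fun_mul (h x hx).1).congr_deriv ?_
  have hpow : x ^ (2 * ν) * x ^ (-ν) = x ^ ν := by
    rw [← rpow_add hx]
    ring_nf
  rw [rpow_sub_one hx.ne', div_mul_eq_mul_div (x ^ (2 * ν)), ← mul_assoc (x ^ (2 * ν)), hpow]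
  field_simp
  ring

lemma IsBesselPair.antitoneOn_rpow_neg_mul {a : ℝ} (hpos : ∀ x ∈ Ioo 0 a, 0 < A x) :
    AntitoneOn (fun x => x ^ (-ν) * (2 * ν * A x - x * B x)) (Ioc 0 a) := by
  refine antitoneOn_of_hasDerivWithinAt_nonpos (f' := fun x => -(x ^ (-ν) * (x * A x)))
    (convex_Ioc 0 a)
    (fun x hx => (h.hasDerivAt_rpow_neg_mul hx.1).continuousAt.continuousWithinAt)
    (fun x hx => ?_) fun x hx => ?_
  all_goals rw [interior_Ioc] at hx
  · exact (h.hasDerivAt_rpow_neg_mul hx.1).hasDerivWithinAt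
  · have hx0 := hx.1
    have hAx := hpos x hx
    exact neg_nonpos.2 (by positivity)

/-- By `IsBesselPair.antitoneOn_rpow_neg_mul`, the derivative of `x ^ ν * A x` is at least
`-x ^ (2 * ν - 1) * (a ^ (1 - ν) * B a)`; integrate from `x` to `a`. -/
lemma IsBesselPair.rpow_mul_le {a : ℝ} (hν : 0 < ν) (hpos : ∀ x ∈ Ioo 0 a, 0 < A x)
    (ha : A a = 0) {x : ℝ} (hx : 0 < x) (hxa : x < a) :
    x ^ ν * A x ≤ a ^ (-ν) * (a * B a) * ((a ^ (2 * ν) - x ^ (2 * ν)) / (2 * ν)) := by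
  have hderiv {s : ℝ} (hs : 0 < s) : HasDerivAt
      (fun s => s ^ ν * A s + a ^ (-ν) * (a * B a) * (s ^ (2 * ν) / (2 * ν)))
      (s ^ (2 * ν) / s * (s ^ (-ν) * (2 * ν * A s - s * B s) + a ^ (-ν) * (a * B a))) s := by
    refine ((h.hasDerivAt_rpow_mul hs).fun_add (((hasDerivAt_rpow_const (p := 2 * ν)
      (.inl hs.ne')).div_const (2 * ν)).const_mul (a ^ (-ν) * (a * B a)))).congr_deriv ?_
    rw [rpow_sub_one hs.ne']
    field_simp
  have hmono : MonotoneOn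
      (fun s => s ^ ν * A s + a ^ (-ν) * (a * B a) * (s ^ (2 * ν) / (2 * ν))) (Icc x a) := by
    refine monotoneOn_of_hasDerivWithinAt_nonneg (convex_Icc x a)
      (fun s hs => (hderiv (hx.trans_le hs.1)).continuousAt.continuousWithinAt)
      (fun s hs => (hderiv (hx.trans_le (interior_subset hs).1)).hasDerivWithinAt) fun s hs => ?_
    obtain ⟨hxs, hsa⟩ := interior_subset hs
    have hs0 : 0 < s := hx.trans_le hxs
    have hg := h.antitoneOn_rpow_neg_mul hpos ⟨hs0, hsa⟩ ⟨hx.trans hxa, le_rfl⟩ hsa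
    simp only [ha, mul_zero, zero_sub, mul_neg] at hg
    exact mul_nonneg (by positivity) (by linarith)
  have hends := hmono (left_mem_Icc.2 hxa.le) (right_mem_Icc.2 hxa.le) hxa.le
  simp only [ha, mul_zero, zero_add] at hends
  rw [sub_div, mul_sub]
  linarith

lemma IsBesselPair.le_rpow_neg_mul {a : ℝ} (hν : 0 < ν) (hpos : ∀ x ∈ Ioo 0 a, 0 < A x)
    (ha : A a = 0) {x : ℝ} (hx : 0 < x) (hxa : x < a) :
    A x ≤ x ^ (-ν) * (a ^ ν * |a * B a| / (2 * ν)) := by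
  have ha0 : 0 < a := hx.trans hxa
  have hBa : 0 ≤ B a :=
    nonneg_of_hasDerivAt_neg (by simpa [ha] using (h a ha0).1) ha0 hpos ha
  have hpow : a ^ (-ν) * a ^ (2 * ν) = a ^ ν := by
    rw [← rpow_add ha0]
    ring_nf
  rw [rpow_neg hx.le, ← div_eq_inv_mul, le_div_iff₀' (rpow_pos_of_pos hx ν),
    abs_of_nonneg (mul_nonneg ha0.le hBa)]
  calc x ^ ν * A x
      ≤ a ^ (-ν) * (a * B a) * ((a ^ (2 * ν) - x ^ (2 * ν)) / (2 * ν)) :=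
        h.rpow_mul_le hν hpos ha hx hxa
    _ ≤ a ^ (-ν) * (a * B a) * (a ^ (2 * ν) / (2 * ν)) := by
        gcongr
        exact sub_le_self _ (rpow_nonneg hx.le _)
    _ = a ^ ν * (a * B a) / (2 * ν) := by
        rw [← hpow]
        ring

lemma IsBesselPair.neg : IsBesselPair ν (fun x => -A x) (fun x => -B x) := fun x hx =>
  ⟨(h x hx).1.fun_neg.congr_deriv (by ring), (h x hx).2.fun_neg.congr_deriv (by ring)⟩

lemma IsBesselPair.abs_le_rpow_neg_mul {a : ℝ} (hν : 0 < ν) (hne : ∀ x ∈ Ioo 0 a, A x ≠ 0)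
    (ha : A a = 0) {x : ℝ} (hx : 0 < x) (hxa : x < a) :
    |A x| ≤ x ^ (-ν) * (a ^ ν * |a * B a| / (2 * ν)) := by
  have hcont : ContinuousOn A (Ioo 0 a) := h.continuousOn.mono fun s hs => hs.1
  have hsign : (∀ s ∈ Ioo 0 a, 0 < A s) ∨ ∀ s ∈ Ioo 0 a, A s < 0 := by
    by_contra! hboth
    obtain ⟨⟨s, hs, hAs⟩, t, ht, hAt⟩ := hboth
    obtain ⟨r, hr, hr0⟩ := isPreconnected_Ioo.intermediate_value hs ht hcont ⟨hAs, hAt⟩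
    exact hne r hr hr0
  obtain hpos | hneg := hsign
  · rw [abs_of_pos (hpos x ⟨hx, hxa⟩)]
    exact h.le_rpow_neg_mul hν hpos ha hx hxa
  · rw [abs_of_neg (hneg x ⟨hx, hxa⟩)]
    simpa only [mul_neg, abs_neg] using h.neg.le_rpow_neg_mul hν
      (fun s hs => neg_pos.2 (hneg s hs)) (neg_eq_zero.2 ha) hx hxa

end

/-! ### The function `U_ν(ρ, ·)` -/

/-- The solution `x ↦ J_ν(x) Y_ν(c) - J_ν(c) Y_ν(x)` of Bessel's equation vanishing at `c`; by
definition `U_ν(ρ, t)` is its value at `x = ρt` for `c = ρb`. -/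
noncomputable def besselCross (ν c x : ℝ) : ℝ :=
  besselJ ν x * besselY ν c - besselJ ν c * besselY ν x

/-- The companion of `besselCross` in the first-order Bessel system. -/
noncomputable def besselCrossSucc (ν c x : ℝ) : ℝ :=
  besselJ (ν + 1) x * besselY ν c - besselJ ν c * besselY (ν + 1) x

lemma besselCross_self (ν c : ℝ) : besselCross ν c c = 0 := by
  rw [besselCross, sub_self]

section

variable {ν : ℝ} (hν : 0 ≤ ν)

include hν

lemma isBesselPair_besselCross (c : ℝ) :
    IsBesselPair ν (besselCross ν c) (besselCrossSucc ν c) := by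
  convert (isBesselPair_besselJ ν).linear_combination (isBesselPair_besselY hν)
    (besselY ν c) (-besselJ ν c) using 2 with x x
  all_goals simp only [besselCross, besselCrossSucc]; ring

lemma sq_mul_besselCrossSucc {c x : ℝ} (hx : 0 < x) (h : besselCross ν c x = 0) :
    (x * besselCrossSucc ν c x) ^ 2 = 4 / π ^ 2 * (besselN ν c / besselN ν x) := by
  have hJ : x * (besselJ ν x * besselCrossSucc ν c x) = 2 / π * besselJ ν c := by
    rw [← wronskian_besselJ_besselY hν hx]
    simp only [besselCross, besselCrossSucc] at h ⊢
    linear_combination x * besselJ (ν + 1) x * h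
  have hY : x * (besselY ν x * besselCrossSucc ν c x) = 2 / π * besselY ν c := by
    rw [← wronskian_besselJ_besselY hν hx]
    simp only [besselCross, besselCrossSucc] at h ⊢
    linear_combination x * besselY (ν + 1) x * h
  rw [← mul_div_assoc, eq_div_iff (besselN_pos hν hx).ne', besselN, besselN]
  linear_combination (x * (besselJ ν x * besselCrossSucc ν c x) + 2 / π * besselJ ν c) * hJ +
    (x * (besselY ν x * besselCrossSucc ν c x) + 2 / π * besselY ν c) * hY

lemma besselN_div_besselN_le_one {x y : ℝ} (hx : 0 < x) (hxy : x ≤ y) :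
    besselN ν y / besselN ν x ≤ 1 :=
  (div_le_one (besselN_pos hν hx)).2
    ((strictAntiOn_besselN hν).antitoneOn hx (hx.trans_le hxy) hxy)

lemma abs_mul_besselCrossSucc_le {c x : ℝ} (hx : 0 < x) (hxc : x ≤ c)
    (h : besselCross ν c x = 0) : |x * besselCrossSucc ν c x| ≤ 2 / π := by
  refine abs_le_of_sq_le_sq ?_ (by positivity)
  rw [sq_mul_besselCrossSucc hν hx h, div_pow]
  norm_num1
  exact mul_le_of_le_one_right (by positivity) (besselN_div_besselN_le_one hν hx hxc)

lemma hasDerivAt_besselU (b : ℝ) {ρ t : ℝ} (hρt : 0 < ρ * t) :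
    HasDerivAt (besselU b ν ρ) (ρ * (ν / (ρ * t) * besselU b ν ρ t -
      besselCrossSucc ν (ρ * b) (ρ * t))) t := by
  have h := (isBesselPair_besselCross hν (ρ * b) (ρ * t) hρt).1.comp t
    ((hasDerivAt_id t).const_mul ρ)
  exact h.congr_deriv (by rw [mul_one, mul_comm]; rfl)

lemma deriv_besselU_sq {b ρ a : ℝ} (hρ : 0 < ρ) (ha : 0 < a) (h : besselU b ν ρ a = 0) :
    deriv (besselU b ν ρ) a ^ 2 =
      4 / (π ^ 2 * a ^ 2) * (besselN ν (ρ * b) / besselN ν (ρ * a)) := by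
  have hρa : 0 < ρ * a := mul_pos hρ ha
  have hsq := sq_mul_besselCrossSucc hν (c := ρ * b) hρa h
  rw [(hasDerivAt_besselU hν b hρa).deriv, h, mul_zero, zero_sub, ← div_div,
    div_mul_eq_mul_div (4 / π ^ 2), ← hsq, eq_div_iff (by positivity)]
  ring

lemma intervalIntegrable_besselU_sq_mul (b : ℝ) {ρ x y : ℝ} (hρ : 0 < ρ) (hx : 0 < x)
    (hy : 0 < y) : IntervalIntegrable (fun t => besselU b ν ρ t ^ 2 * t) volume x y := by
  have hcont : ContinuousOn (besselU b ν ρ) (Ioi 0) := fun t ht =>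
    (hasDerivAt_besselU hν b (mul_pos hρ ht)).continuousAt.continuousWithinAt
  exact (((hcont.pow 2).mul continuousOn_id).mono
    (ordConnected_Ioi.uIcc_subset hx hy)).intervalIntegrable

lemma integral_besselU_sq_mul {b ρ a : ℝ} (hρ : 0 < ρ) (ha : 0 < a) (hb : 0 < b)
    (h : besselU b ν ρ a = 0) :
    ρ ^ 2 * ∫ t in a..b, besselU b ν ρ t ^ 2 * t =
      2 / π ^ 2 * (1 - besselN ν (ρ * b) / besselN ν (ρ * a)) := by
  have hρa : 0 < ρ * a := mul_pos hρ ha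
  have hρb : 0 < ρ * b := mul_pos hρ hb
  have hself := besselCross_self ν (ρ * b)
  have hlommel := (isBesselPair_besselCross hν (ρ * b)).two_mul_integral_sq_mul hρa hρb h hself
  rw [sq_mul_besselCrossSucc hν hρa h, sq_mul_besselCrossSucc hν hρb hself,
    div_self (besselN_pos hν hρb).ne'] at hlommel
  have hsubst : ρ ^ 2 * ∫ t in a..b, besselU b ν ρ t ^ 2 * t =
      ∫ x in ρ * a..ρ * b, besselCross ν (ρ * b) x ^ 2 * x := by
    rw [← intervalIntegral.mul_integral_comp_mul_left, sq, mul_assoc,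
      ← intervalIntegral.integral_const_mul]
    simp only [besselU, besselCross, mul_left_comm]
  rw [hsubst]
  linear_combination hlommel / 2

end

lemma besselN_mul_div_besselN_le_inv {b ν ρ : ℝ} (hν : 1 / 2 ≤ ν) (hb : 1 ≤ b) (hρ : 0 < ρ) :
    besselN ν (ρ * b) / besselN ν ρ ≤ b⁻¹ := by
  have hb0 : 0 < b := one_pos.trans_le hb
  have hle : ρ ≤ ρ * b := le_mul_of_one_le_right hρ.le hb
  have hanti : ρ * b * besselN ν (ρ * b) ≤ ρ * besselN ν ρ :=
    antitoneOn_mul_besselN hν hρ (hρ.trans_le hle) hle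
  rw [div_le_iff₀ (besselN_pos (by linarith) hρ), ← div_eq_inv_mul, le_div_iff₀' hb0]
  exact le_of_mul_le_mul_left (by rwa [← mul_assoc]) hρ

lemma abs_besselU_le {b ν ρ a : ℝ} (hν : 0 < ν) (hρ : 0 < ρ) (hab : a ≤ b) (ha : a ≤ 1)
    (h : IsLeast {t | 0 < t ∧ besselU b ν ρ t = 0} a) {t : ℝ} (ht : 0 < t) (hta : t < a) :
    |besselU b ν ρ t| ≤ t ^ (-ν) / (π * ν) := by
  obtain ⟨⟨ha0, hUa⟩, hleast⟩ := h
  have hρa : 0 < ρ * a := mul_pos hρ ha0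
  have hne : ∀ x ∈ Ioo 0 (ρ * a), besselCross ν (ρ * b) x ≠ 0 := by
    intro x hx hzero
    have hxρ : x / ρ ∈ {t | 0 < t ∧ besselU b ν ρ t = 0} :=
      ⟨div_pos hx.1 hρ, by rw [besselU, mul_div_cancel₀ _ hρ.ne']; exact hzero⟩
    exact ((le_div_iff₀' hρ).1 (hleast hxρ)).not_gt hx.2
  have hcompanion := abs_mul_besselCrossSucc_le hν.le hρa (mul_le_mul_of_nonneg_left hab hρ.le) hUa
  have hscale : (ρ * t) ^ (-ν) * (ρ * a) ^ ν ≤ t ^ (-ν) := by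
    rw [mul_rpow hρ.le ht.le, mul_rpow hρ.le ha0.le, rpow_neg hρ.le, mul_mul_mul_comm,
      inv_mul_cancel₀ (rpow_pos_of_pos hρ ν).ne', one_mul]
    exact mul_le_of_le_one_right (by positivity) (rpow_le_one ha0.le ha hν.le)
  calc |besselU b ν ρ t|
      ≤ (ρ * t) ^ (-ν) * ((ρ * a) ^ ν *
          |ρ * a * besselCrossSucc ν (ρ * b) (ρ * a)| / (2 * ν)) :=
        (isBesselPair_besselCross hν.le (ρ * b)).abs_le_rpow_neg_mul hν hne hUa
          (mul_pos hρ ht) (mul_lt_mul_of_pos_left hta hρ)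
    _ = (ρ * t) ^ (-ν) * (ρ * a) ^ ν *
          (|ρ * a * besselCrossSucc ν (ρ * b) (ρ * a)| / (2 * ν)) := by ring
    _ ≤ t ^ (-ν) * (2 / π / (2 * ν)) := by gcongr
    _ = t ^ (-ν) / (π * ν) := by field_simp

lemma integral_besselU_besselRho_sq_mul {b ν : ℝ} (hν : 0 ≤ ν) (hb : 1 < b) {m : ℕ}
    (hm : 1 ≤ m) :
    besselRho b ν m ^ 2 * ∫ t in 1..b, besselU b ν (besselRho b ν m) t ^ 2 * t =
      2 / π ^ 2 * (1 - besselN ν (besselRho b ν m * b) / besselN ν (besselRho b ν m)) := by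
  rw [integral_besselU_sq_mul hν (besselRho_pos hν hb hm) one_pos (one_pos.trans hb)
    (besselU_besselRho_one hν hb hm), mul_one]

lemma le_integral_besselU_besselRho_sq_mul {b ν : ℝ} (hν : 1 / 2 ≤ ν) (hb : 1 < b) {m : ℕ}
    (hm : 1 ≤ m) :
    2 / π ^ 2 * ((b - 1) / b) ≤
      besselRho b ν m ^ 2 * ∫ t in 1..b, besselU b ν (besselRho b ν m) t ^ 2 * t := by
  have hν0 : 0 ≤ ν := by linarith
  rw [integral_besselU_besselRho_sq_mul hν0 hb hm, sub_div, div_self (one_pos.trans hb).ne',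
    one_div]
  gcongr
  exact besselN_mul_div_besselN_le_inv hν hb.le (besselRho_pos hν0 hb hm)

lemma le_integral_besselU_zero_besselRho_sq_mul {b : ℝ} (hb : 1 < b) {m : ℕ} (hm : 1 ≤ m) :
    2 / π ^ 2 * (1 - besselN 0 (besselRho b 0 1 * b) / besselN 0 (besselRho b 0 1)) ≤
      besselRho b 0 m ^ 2 * ∫ t in 1..b, besselU b 0 (besselRho b 0 m) t ^ 2 * t := by
  rw [integral_besselU_besselRho_sq_mul le_rfl hb hm]
  gcongr 2 / π ^ 2 * (1 - ?_)
  exact besselN_zero_mul_div_besselN_zero_le hb.le (besselRho_pos le_rfl hb le_rfl)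
    ((strictMono_besselRho le_rfl hb).monotone hm)

end

theorem mainTheorem7 (b : ℝ) (hb : 1 < b) :
    -- the numbers `ρ_{ν,m}`, `m ≥ 1`, are the positive zeros of `U_ν(·, 1)` in increasing order
    (∀ ν : ℝ, 0 ≤ ν →
      StrictMonoOn (besselRho b ν) (Set.Ici 1) ∧
      besselRho b ν '' Set.Ici 1 = {ρ : ℝ | 0 < ρ ∧ besselU b ν ρ 1 = 0}) ∧
    -- (i)
    ((∀ ν : ℝ, 1 / 2 ≤ ν → ∀ m : ℕ, 1 ≤ m →
        besselRho b ν m > 1 / b * (ν + (m : ℝ) / 4)) ∧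
      (∀ ν : ℝ, 0 ≤ ν →
        Tendsto (fun m : ℕ => besselRho b ν m / (m : ℝ)) atTop (𝓝 (Real.pi / (b - 1))))) ∧
    -- (ii)
    (∀ ν : ℝ, 0 ≤ ν → ∀ m : ℕ, 1 ≤ m → ∀ a : ℝ, 0 < a → a ≤ b →
      besselU b ν (besselRho b ν m) a = 0 →
        DifferentiableAt ℝ (fun t => besselU b ν (besselRho b ν m) t) a ∧
        (deriv (fun t => besselU b ν (besselRho b ν m) t) a) ^ 2 =
          4 / (Real.pi ^ 2 * a ^ 2) *
            (besselN ν (besselRho b ν m * b) / besselN ν (besselRho b ν m * a)) ∧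
        4 / (Real.pi ^ 2 * a ^ 2) *
            (besselN ν (besselRho b ν m * b) / besselN ν (besselRho b ν m * a)) ≤
          4 / (Real.pi ^ 2 * a ^ 2)) ∧
    -- (iii)
    (∀ ν : ℝ, 0 ≤ ν → ∀ m : ℕ, 1 ≤ m → ∀ a : ℝ, 0 < a → a < b →
      besselU b ν (besselRho b ν m) a = 0 →
        IntervalIntegrable (fun t => besselU b ν (besselRho b ν m) t ^ 2 * t)
          MeasureTheory.volume a b ∧
        besselRho b ν m ^ 2 * (∫ t in a..b, besselU b ν (besselRho b ν m) t ^ 2 * t) =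
          2 / Real.pi ^ 2 *
            (1 - besselN ν (besselRho b ν m * b) / besselN ν (besselRho b ν m * a)) ∧
        2 / Real.pi ^ 2 *
            (1 - besselN ν (besselRho b ν m * b) / besselN ν (besselRho b ν m * a)) ≤
          2 / Real.pi ^ 2) ∧
    -- (iv)
    ((∀ ν : ℝ, 1 / 2 ≤ ν → ∀ m : ℕ, 1 ≤ m →
        besselRho b ν m ^ 2 * (∫ t in (1 : ℝ)..b, besselU b ν (besselRho b ν m) t ^ 2 * t) ≥
          2 / Real.pi ^ 2 * ((b - 1) / b)) ∧
      (∀ m : ℕ, 1 ≤ m →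
        besselRho b 0 m ^ 2 * (∫ t in (1 : ℝ)..b, besselU b 0 (besselRho b 0 m) t ^ 2 * t) ≥
          2 / Real.pi ^ 2 *
            (1 - besselN 0 (besselRho b 0 1 * b) / besselN 0 (besselRho b 0 1)))) ∧
    -- (v)
    (∀ ν : ℝ, 0 < ν → ∀ m : ℕ, 1 ≤ m → ∀ a : ℝ,
      IsLeast {t : ℝ | 0 < t ∧ besselU b ν (besselRho b ν m) t = 0} a →
        ∀ t : ℝ, 0 < t → t < a →
          |besselU b ν (besselRho b ν m) t| ≤ t ^ (-ν) / (Real.pi * ν)) := by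
  have hρ {ν : ℝ} (hν : 0 ≤ ν) {m : ℕ} (hm : 1 ≤ m) := besselRho_pos hν hb hm
  have hb0 : 0 < b := one_pos.trans hb
  refine ⟨fun ν hν => ⟨(strictMono_besselRho hν hb).strictMonoOn _, image_besselRho hν hb⟩,
    ⟨fun ν hν m hm => lt_besselRho hν hb hm, fun ν hν => tendsto_besselRho_div hν hb⟩,
    fun ν hν m hm a ha hab hU => ⟨?_, deriv_besselU_sq hν (hρ hν hm) ha hU, ?_⟩,
    fun ν hν m hm a ha _ hU => ⟨intervalIntegrable_besselU_sq_mul hν b (hρ hν hm) ha hb0,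
      integral_besselU_sq_mul hν (hρ hν hm) ha hb0 hU, ?_⟩,
    ⟨fun ν hν m hm => le_integral_besselU_besselRho_sq_mul hν hb hm,
      fun m hm => le_integral_besselU_zero_besselRho_sq_mul hb hm⟩,
    fun ν hν m hm a ha t ht hta => ?_⟩
  · exact (hasDerivAt_besselU hν b (mul_pos (hρ hν hm) ha)).differentiableAt
  · exact mul_le_of_le_one_right (by positivity) (besselN_div_besselN_le_one hν
      (mul_pos (hρ hν hm) ha) (mul_le_mul_of_nonneg_left hab (hρ hν hm).le))
  · exact mul_le_of_le_one_right (by positivity) (sub_le_self 1 (div_pos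
      (besselN_pos hν (mul_pos (hρ hν hm) hb0)) (besselN_pos hν (mul_pos (hρ hν hm) ha))).le)
  · have ha1 : a ≤ 1 := ha.2 ⟨one_pos, besselU_besselRho_one hν.le hb hm⟩
    exact abs_besselU_le hν (hρ hν.le hm) (ha1.trans hb.le) ha1 ha ht hta
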